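/- **Setting.** Let $d,M,L\in\mathbb N$, $T>0$, $\lambda>0$. Let $\mathcal P_2(\mathbb R^d)$ be the Borel probability measures with finite second moment, with the 2-Wasserstein distance. Let $K_1,K_2\in\mathcal C_b^2(\mathbb R^d,\mathbb R^d)$ and $$v(\mu,\mathbf u)(x)=-(K_1*\mu)(x)-\sum_{\ell=1}^M K_2(x-u^\ell),\qquad \mu\in\mathcal P_2(\mathbb R^d),\ \mathbf u=(u^1,\dots,u^M)\in\mathbb R^{dM}.$$ Let $j\in\mathcal C^1(\mathbb R^L)$ and $g_1,\dots,g_L\in\mathcal C^1(\mathbb R^d)$ with $|\nabla g_i|(x)\le C_g(1+|x|)$, and $J_1(\mu)=j(\langle g_1,\mu\rangle,\dots,\langle g_L,\mu\rangle)$. Let $\hat\mu\in\mathcal P_2(\mathbb R^d)$, $\hat{\mathbf u}\in\mathbb R^{dM}$ and $J_2:H^1((0,T),\mathbb R^{dM})\to\mathbb R$. A pair $(\mu,\mathbf u)$ is admissible if $\mu\in\mathcal C([0,T],\mathcal P_2(\mathbb R^d))$, $\mu_0=\hat\mu$, $\mathbf u\in H^1((0,T),\mathbb R^{dM})$, $\mathbf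 u_0=\hat{\mathbf u}$, and $\partial_t\mu_t+\nabla\cdot(v(\mu_t,\mathbf u_t)\mu_t)=0$ weakly, i.e. for all $\varphi\in\mathcal C_c^1([0,T]\times\mathbb R^d)$ $$\langle\varphi_T,\mu_T\rangle-\langle\varphi_0,\hat\mu\rangle-\int_0^T\langle\partial_t\varphi_t+v(\mu_t,\mathbf u_t)\cdot\nabla\varphi_t,\mu_t\rangle\,dt=0 .$$ Problem $(\mathbf P_\infty)$ is to minimize $J(\mu,\mathbf u)=\int_0^TJ_1(\mu_t)\,dt+\lambda J_2(\mathbf u)$ over all admissible pairs. **Theorem.** Let $(\bar\mu,\bar{\mathbf u})$ be a minimizing pair of $(\mathbf P_\infty)$, and let $J_2$ be Gâteaux differentiable at $\bar{\mathbf u}$ along all $\mathbf h\in H^1((0,T),\mathbb R^{dM})$ with $\mathbf h_0=0$, with derivative $dJ_2(\bar{\mathbf u})$. Write $\bar v_t=v(\bar\mu_t,\bar{\mathbf u}_t)$, and let $\nabla F$ be the transpose of the Jacobian matrix $DF$ of a vector field $F$. Then $\bar\mu_0=\hat\mu$, $\bar{\mathbf u}_0=\hat{\mathbf u}$, the state equation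 $$\partial_t\bar\mu_t+\nabla\cdot(\bar\mu_t\bar v_t)=0$$ holds in the weak sense above, and there is a narrowly continuous family $(\bar m_t)_{t\in[0,T]}$ of $\mathbb R^d$-valued Borel measures of finite total variation such that: 1. $\bar m_T=0$ and $$\partial_t\bar m_t+\nabla\cdot(\bar v_t\otimes\bar m_t)=-\nabla\bar v_t\,\bar m_t-\bar\mu_t\int_{\mathbb R^d}\nabla K_1(y-x)\,d\bar m_t(y)+\bar\mu_t\sum_{i=1}^L(\partial_ij)(\langle g_1,\bar\mu_t\rangle,\dots,\langle g_L,\bar\mu_t\rangle)\nabla g_i$$ weakly on $[0,T]\times\mathbb R^d$, i.e. for all test fields $\varphi\in\mathcal C_c^1([0,T]\times\mathbb R^d,\mathbb R^d)$, including the boundary terms at $t=0$ and $t=T$; 2. $\delta J_2(\bar{\mathbf u})=\frac1\lambda\int\nabla K_2(x-\bar u^\ell_t)\,d\bar m_t(x)$, $\ell=1,\dots,M$, in the weak sense: for all $\mathbf h\in H^1((0,T),\mathbb R^{dM})$ with $\mathbf h_0=0$, $$dJ_2(\bar{\mathbf u})[\mathbf h]=\frac1\lambda\int_0^T\sum_{\ell=1}^M\Big\langle\int_{\mathbb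 R^d}\nabla K_2(x-\bar u^\ell_t)\,d\bar m_t(x),\,h^\ell_t\Big\rangle dt ;$$ 3. if there is a continuous $\mathbf f:[0,T]\to\mathbb R^{dM}$ such that $dJ_2(\bar{\mathbf u})[\mathbf h]=\int_0^T\langle\dot{\bar{\mathbf u}}_t,\dot{\mathbf h}_t\rangle dt+\int_0^T\langle\mathbf f_t,\mathbf h_t\rangle dt$ for all such $\mathbf h$ (in particular, with $\mathbf f=0$, if $J_2(\mathbf u)=\frac12\int_0^T|\dot{\mathbf u}_t|^2dt$), then $\bar{\mathbf u}\in\mathcal C^2([0,T],\mathbb R^{dM})$ and $$\ddot{\bar u}^\ell_t=f^\ell_t-\frac1\lambda\int_{\mathbb R^d}\nabla K_2(x-\bar u^\ell_t)\,d\bar m_t(x)\quad(t\in[0,T],\ \ell=1,\dots,M),\qquad\left.\frac{d\bar{\mathbf u}_t}{dt}\right|_{t=T}=0 .$$ -/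

import Mathlib

open MeasureTheory Set Filter Topology
open scoped ENNReal RealInnerProductSpace BoundedContinuousFunction

noncomputable section

namespace MeanFieldControl

/-- The state space `ℝ^d` with the Euclidean norm. -/
abbrev State (d : ℕ) : Type := EuclideanSpace ℝ (Fin d)

/-- The space `ℝ^{dM}` of control values `(u¹, …, u^M)`, `u^ℓ ∈ ℝ^d`, with the Euclidean norm. -/
abbrev ControlValue (d M : ℕ) : Type := EuclideanSpace ℝ (Fin M × Fin d)

/-- The component `u^ℓ ∈ ℝ^d` of a control value. -/
def ControlValue.part {d M : ℕ} (u : ControlValue d M) (ℓ : Fin M) : State d :=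
  WithLp.toLp 2 fun k => u (ℓ, k)

/-- The Sobolev space `H¹((0,T), ℝ^{dM})`. In one dimension its elements are exactly the functions
`u(t) = u(0) + ∫₀ᵗ u'(s) ds` with `u(0) ∈ ℝ^{dM}` and `u' ∈ L²((0,T), ℝ^{dM})`; such a function is
recorded by the pair `(u(0), u')`. The norm of the product is equivalent to the usual `H¹` norm. -/
abbrev H1Control (T : ℝ) (d M : ℕ) : Type :=
  ControlValue d M × Lp (ControlValue d M) 2 (volume.restrict (Ioc 0 T))

/-- The value `u(t) = u(0) + ∫₀ᵗ u'(s) ds` at the time `t ∈ [0,T]` of (the continuous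
representative of) `u ∈ H¹`. -/
def H1Control.eval {T : ℝ} {d M : ℕ} (u : H1Control T d M) (t : ℝ) : ControlValue d M :=
  u.1 + ∫ s in (0 : ℝ)..t, u.2 s

/-- `μ` is a Borel probability measure on `ℝ^d` with finite second moment. -/
def MemP2 {d : ℕ} (μ : Measure (State d)) : Prop :=
  IsProbabilityMeasure μ ∧ ∫⁻ x, ‖x‖ₑ ^ 2 ∂μ < ∞

/-- The 2-Wasserstein distance: the square root of the infimum of `∫ |x - y|² dπ(x, y)` over all
couplings `π` of `μ` and `ν`. -/
def wasserstein2 {d : ℕ} (μ ν : Measure (State d)) : ℝ≥0∞ :=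
  (⨅ π ∈ {π : Measure (State d × State d) | π.fst = μ ∧ π.snd = ν},
    ∫⁻ p, edist p.1 p.2 ^ 2 ∂π) ^ (1 / 2 : ℝ)

/-- `μ ∈ C([0,T], P₂(ℝ^d))`, continuity being understood in the 2-Wasserstein distance. -/
def IsP2Curve {d : ℕ} (T : ℝ) (μ : ℝ → Measure (State d)) : Prop :=
  (∀ t ∈ Icc 0 T, MemP2 (μ t)) ∧
    ∀ t ∈ Icc 0 T, Tendsto (fun s => wasserstein2 (μ s) (μ t)) (𝓝[Icc 0 T] t) (𝓝 0)

/-- `K ∈ C_b²(ℝ^d, ℝ^d)`: `K` is twice continuously differentiable and `K`, `DK`, `D²K` are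
bounded. -/
def IsCb2 {d : ℕ} (K : State d → State d) : Prop :=
  ContDiff ℝ 2 K ∧ ∀ n : ℕ, n ≤ 2 → ∃ C : ℝ, ∀ x, ‖iteratedFDeriv ℝ n K x‖ ≤ C

/-- The velocity field `v(μ,u)(x) = -(K₁ * μ)(x) - ∑_ℓ K₂(x - u^ℓ)`. -/
def velocity {d M : ℕ} (K₁ K₂ : State d → State d) (μ : Measure (State d))
    (u : ControlValue d M) (x : State d) : State d :=
  -(∫ y, K₁ (x - y) ∂μ) - ∑ ℓ, K₂ (x - u.part ℓ)

/-- The weak form of `∂ₜμ + ∇·(v(μ,u) μ) = 0`, `μ|_{t=0} = μ₀`: for every test function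
`φ ∈ C_c¹([0,T] × ℝ^d)`,
`⟨φ_T, μ_T⟩ - ⟨φ_0, μ₀⟩ - ∫₀ᵀ ⟨∂ₜφ + v(μ_t,u_t)·∇φ, μ_t⟩ dt = 0`.
Test functions are restrictions of functions in `C_c¹(ℝ × ℝ^d)`, and
`∂ₜφ + w·∇φ` is the derivative of `φ` in the direction `(1, w)`. -/
def SolvesContinuityEq {d M : ℕ} (T : ℝ) (K₁ K₂ : State d → State d) (μ₀ : Measure (State d))
    (μ : ℝ → Measure (State d)) (u : ℝ → ControlValue d M) : Prop :=
  ∀ φ : ℝ × State d → ℝ, ContDiff ℝ 1 φ → HasCompactSupport φ →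
    (∫ x, φ (T, x) ∂(μ T)) - (∫ x, φ (0, x) ∂μ₀)
      - (∫ t in (0 : ℝ)..T, ∫ x, fderiv ℝ φ (t, x) (1, velocity K₁ K₂ (μ t) (u t) x) ∂(μ t)) = 0

/-- Admissible pairs: `μ ∈ C([0,T], P₂(ℝ^d))` with `μ_0 = μ₀`, `u ∈ H¹` with `u_0 = u₀`, and the
continuity equation holds. -/
def Admissible {d M : ℕ} (T : ℝ) (K₁ K₂ : State d → State d) (μ₀ : Measure (State d))
    (u₀ : ControlValue d M) (μ : ℝ → Measure (State d)) (u : H1Control T d M) : Prop :=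
  IsP2Curve T μ ∧ μ 0 = μ₀ ∧ u.eval 0 = u₀ ∧ SolvesContinuityEq T K₁ K₂ μ₀ μ u.eval

/-- The vector `(⟨g₁, μ⟩, …, ⟨g_L, μ⟩)`. -/
def moments {d L : ℕ} (g : Fin L → State d → ℝ) (μ : Measure (State d)) : Fin L → ℝ :=
  fun i => ∫ x, g i x ∂μ

/-- The cost `J(μ,u) = ∫₀ᵀ j(⟨g₁, μ_t⟩, …, ⟨g_L, μ_t⟩) dt + lam J₂(u)`. -/
def cost {d M L : ℕ} (T lam : ℝ) (j : (Fin L → ℝ) → ℝ) (g : Fin L → State d → ℝ)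
    (J₂ : H1Control T d M → ℝ) (μ : ℝ → Measure (State d)) (u : H1Control T d M) : ℝ :=
  (∫ t in (0 : ℝ)..T, j (moments g (μ t))) + lam * J₂ u

/-- `(μ,u)` is admissible and minimizes the cost among all admissible pairs. -/
def IsOptimalPair {d M L : ℕ} (T lam : ℝ) (K₁ K₂ : State d → State d) (j : (Fin L → ℝ) → ℝ)
    (g : Fin L → State d → ℝ) (J₂ : H1Control T d M → ℝ) (μ₀ : Measure (State d))
    (u₀ : ControlValue d M) (μ : ℝ → Measure (State d)) (u : H1Control T d M) : Prop :=
  Admissible T K₁ K₂ μ₀ u₀ μ u ∧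
    ∀ (ν : ℝ → Measure (State d)) (w : H1Control T d M), Admissible T K₁ K₂ μ₀ u₀ ν w →
      cost T lam j g J₂ μ u ≤ cost T lam j g J₂ ν w

/-- `∑_i (∂_i j)(⟨g₁, μ⟩, …, ⟨g_L, μ⟩) ∇g_i(x)`. -/
def costGradient {d L : ℕ} (j : (Fin L → ℝ) → ℝ) (g : Fin L → State d → ℝ)
    (μ : Measure (State d)) (x : State d) : State d :=
  ∑ i, fderiv ℝ j (moments g μ) (Pi.single i 1) • gradient (g i) x

/-- The integral `∫ f(x) · dm(x)` of a vector field against a vector-valued measure. -/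
def pairing {d : ℕ} (f : State d → State d) (m : VectorMeasure (State d) (State d)) : ℝ :=
  m.integral f (innerSL ℝ)

/-- The vector `∫ A(x) dm(x)`, for a matrix field `A` and a vector-valued measure `m`. -/
def matIntegral {d : ℕ} (A : State d → State d →L[ℝ] State d)
    (m : VectorMeasure (State d) (State d)) : State d :=
  m.integral A (ContinuousLinearMap.id ℝ (State d →L[ℝ] State d))

/-- The matrix `∇F(x)`, the transpose of the Jacobian matrix `DF(x)`. -/
def nabla {d : ℕ} (F : State d → State d) (x : State d) : State d →L[ℝ] State d :=
  ContinuousLinearMap.adjoint (fderiv ℝ F x)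

/-- `m` is a family of `ℝ^d`-valued Borel measures on `ℝ^d` of finite total variation, narrowly
continuous in `t ∈ [0,T]`. -/
def IsVectorMeasureCurve {d : ℕ} (T : ℝ) (m : ℝ → VectorMeasure (State d) (State d)) : Prop :=
  (∀ t ∈ Icc 0 T, IsFiniteMeasure (m t).variation) ∧
    ∀ φ : State d →ᵇ State d, ContinuousOn (fun t => pairing φ (m t)) (Icc 0 T)

/-- The weak form of the adjoint equation
`∂ₜm + ∇·(v ⊗ m) = -∇v m - μ ∫ ∇K₁(y - x) dm(y) + μ ∑_i (∂_i j)(⟨g, μ⟩) ∇g_i`,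
`v = v(μ_t,u_t)`, on `[0,T] × ℝ^d`, tested with vector fields `φ ∈ C_c¹([0,T] × ℝ^d, ℝ^d)`.
Here `∂ₜφ + Dφ v` is the derivative of `φ` in the direction `(1, v)`, and
`φ · (∇v m) = (Dv φ) · m`. -/
def SolvesAdjointEq {d M L : ℕ} (T : ℝ) (K₁ K₂ : State d → State d) (j : (Fin L → ℝ) → ℝ)
    (g : Fin L → State d → ℝ) (μ : ℝ → Measure (State d)) (u : ℝ → ControlValue d M)
    (m : ℝ → VectorMeasure (State d) (State d)) : Prop :=
  ∀ φ : ℝ × State d → State d, ContDiff ℝ 1 φ → HasCompactSupport φ →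
    pairing (fun x => φ (T, x)) (m T) - pairing (fun x => φ (0, x)) (m 0)
      - (∫ t in (0 : ℝ)..T,
          pairing (fun x => fderiv ℝ φ (t, x) (1, velocity K₁ K₂ (μ t) (u t) x)) (m t))
    = ∫ t in (0 : ℝ)..T,
        (-(pairing (fun x => fderiv ℝ (velocity K₁ K₂ (μ t) (u t)) x (φ (t, x))) (m t))
          - (∫ x, ⟪φ (t, x), matIntegral (fun y => nabla K₁ (y - x)) (m t)⟫ ∂(μ t))
          + ∫ x, ⟪φ (t, x), costGradient j g (μ t) x⟫ ∂(μ t))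

/-- The vector in `ℝ^{dM}` with the components `∫ ∇K₂(x - u^ℓ) dm(x)`, `ℓ = 1, …, M`. -/
def controlForce {d M : ℕ} (K₂ : State d → State d) (m : VectorMeasure (State d) (State d))
    (u : ControlValue d M) : ControlValue d M :=
  WithLp.toLp 2 fun p => matIntegral (fun x => nabla K₂ (x - u.part p.1)) m p.2

/-- `D` is the Gâteaux derivative of `J₂` at `u` along the variations `h` with `h(0) = 0`, i.e.
relative to the affine space of controls with the same initial value as `u`. -/
def IsGateauxDerivAt {T : ℝ} {d M : ℕ} (J₂ : H1Control T d M → ℝ) (D : H1Control T d M →L[ℝ] ℝ)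
    (u : H1Control T d M) : Prop :=
  ∀ h : H1Control T d M, h.eval 0 = 0 → HasLineDerivAt ℝ J₂ (D h) u h

end MeanFieldControl

end

/-!
The theorem is proved in Lagrangian coordinates, in which the state equation is an ordinary
differential equation and the adjoint equation is its classical adjoint.

*State.* The particles driven by a control `w` are described by their displacement `Z t`, a bounded
continuous function on the state space: the particle that starts at `x` is at `x + Z t x`, and the
law of all particles is the image `displaced μ₀ (Z t)` of the initial measure. The displacement solves
`Z' = v(displaced μ₀ Z, w)(x + Z x)`, an equation in the Banach space of bounded continuous functions
with a Lipschitz right-hand side, because the Wasserstein distance of two laws is at most the uniform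
distance of the displacements. It has a unique global solution (`exists_isDisplacement`), whose law
solves the continuity equation (`IsDisplacement.admissible`). Conversely, every admissible pair
arises in this way (`IsDisplacement.eq_displaced`): for a given curve of measures the velocity field
is regular, and a weak solution of the linear continuity equation is transported by the flow
(`IsFlow.eq_map_of_weak_solution`), as is seen by testing with functions that are constant along the
trajectories. Hence the control determines the measures, and minimizing over admissible pairs is
minimizing over controls.

*Adjoint state.* Let `B t` be the linearization of the right-hand side at `Z t`, as an operator on
`L²(μ₀)`: a multiplication operator plus an integral operator with the kernel `DK₁`. The running cost
is a `C¹` function of the displacement with a gradient `c t ∈ L²(μ₀)` (`exists_costState`); this is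
where the linear growth of the `∇gᵢ` and the second moment enter. The adjoint state is the solution
`p` of the linear equation `p' = -B† p + c`, `p(T) = 0` (`exists_adjointState`), and `m t` is the
image of the vector measure `p t • μ₀` under `x ↦ x + Z t x` (`coStateMeasure`). The weak form of the
adjoint equation is the product rule for `⟪φ(t, x + Z t x), p t⟫`, with Fubini's theorem for the
nonlocal term (`solvesAdjointEq_coStateMeasure`).

*Optimality.* For a variation `w' = w + ε h` of the control, `δ = Z' - Z` solves the equation
`δ' = B δ + ∑ DK₂ (w' - w)` up to a quadratic error, and the product rule for `⟪p, δ⟫`, with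
`δ(0) = 0` and `p(T) = 0`, expresses `∫ ⟪c, δ⟫`, the first variation of the running cost, as
`-ε ∫ ⟪controlForce, h⟫` (`hasDerivAt_runningCost`). At a minimum this cancels the derivative of
`lam • J₂` (`IsOptimalPair.gateaux_eq`). For the strong form, integration by parts turns the
condition into `∫ ⟪u' - w, h'⟫ = 0`, where `w` is the primitive of the right-hand side that vanishes
at `T`; the variation with `h' = u' - w` shows that `u' = w`
(`H1Control.exists_hasDerivWithinAt_of_weak`).
-/

open scoped NNReal

namespace MeanFieldControl

/-! ### Ordinary differential equations in a Banach space -/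

section ODE
variable {E : Type*} [NormedAddCommGroup E] [NormedSpace ℝ E]

theorem gronwallBound_nonneg {δ K ε x : ℝ} (hδ : 0 ≤ δ) (hK : 0 ≤ K) (hε : 0 ≤ ε) (hx : 0 ≤ x) :
    0 ≤ gronwallBound δ K ε x := by
  have := gronwallBound_mono hδ hε hK hx
  rw [gronwallBound_x0] at this
  exact hδ.trans this

theorem gronwallBound_mul (c δ K ε x : ℝ) :
    gronwallBound (c * δ) K (c * ε) x = c * gronwallBound δ K ε x := by
  unfold gronwallBound
  split_ifs <;> ring

/-- Grönwall's inequality in both time directions. -/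
theorem norm_le_gronwallBound_abs {f f' : ℝ → E} {K ε t₀ t : ℝ}
    (hf : ∀ t, HasDerivAt f (f' t) t) (hb : ∀ s ∈ uIcc t₀ t, ‖f' s‖ ≤ K * ‖f s‖ + ε) :
    ‖f t‖ ≤ gronwallBound ‖f t₀‖ K ε |t - t₀| := by
  rcases le_total t₀ t with h | h
  · rw [abs_of_nonneg (sub_nonneg.2 h)]
    rw [uIcc_of_le h] at hb
    exact norm_le_gronwallBound_of_norm_deriv_right_le (a := t₀) (b := t)
      (fun s _ => (hf s).continuousAt.continuousWithinAt)
      (fun s _ => (hf s).hasDerivWithinAt) le_rfl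
      (fun s hs => hb s (Ico_subset_Icc_self hs)) t ⟨h, le_rfl⟩
  · rw [abs_of_nonpos (sub_nonpos.2 h)]
    rw [uIcc_of_ge h] at hb
    have hg : ∀ s, HasDerivAt (fun s => f (-s)) (-f' (-s)) s := fun s => by
      simpa [Function.comp_def] using (hf (-s)).scomp s (hasDerivAt_neg s)
    have := norm_le_gronwallBound_of_norm_deriv_right_le (a := -t₀) (b := -t) (δ := ‖f t₀‖)
      (K := K) (ε := ε)
      (fun s _ => (hg s).continuousAt.continuousWithinAt)
      (fun s _ => (hg s).hasDerivWithinAt) (by simp)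
      (fun s hs => by simpa using hb (-s) ⟨by linarith [hs.2], by linarith [hs.1]⟩) (-t)
      ⟨neg_le_neg h, le_rfl⟩
    simpa [sub_eq_add_neg, add_comm] using this

/-- Two solutions of an ODE with `K`-Lipschitz right-hand side separate at most exponentially,
forwards and backwards in time. -/
theorem norm_sub_le_of_hasDerivAt {F : ℝ → E → E} {K : ℝ≥0} (hL : ∀ t, LipschitzWith K (F t))
    {y z : ℝ → E} (hy : ∀ t, HasDerivAt y (F t (y t)) t) (hz : ∀ t, HasDerivAt z (F t (z t)) t)
    (t₀ t : ℝ) : ‖y t - z t‖ ≤ ‖y t₀ - z t₀‖ * Real.exp (K * |t - t₀|) := by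
  have := norm_le_gronwallBound_abs (f := fun t => y t - z t) (K := K) (ε := 0) (t₀ := t₀) (t := t)
    (fun t => (hy t).sub (hz t)) (fun s _ => by
      simpa [dist_eq_norm] using (hL s).dist_le_mul (y s) (z s))
  rwa [gronwallBound_ε0] at this

/-- The radial retraction of a normed space onto the closed ball of radius `R`. -/
noncomputable def radialRetract (R : ℝ) (x : E) : E := (R / max R ‖x‖) • x

theorem radialRetract_of_norm_le {R : ℝ} (hR : 0 < R) {x : E} (hx : ‖x‖ ≤ R) :
    radialRetract R x = x := by
  simp [radialRetract, max_eq_left hx, hR.ne']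

theorem norm_radialRetract_le {R : ℝ} (hR : 0 < R) (x : E) : ‖radialRetract R x‖ ≤ ‖x‖ := by
  have h : 0 < max R ‖x‖ := lt_max_of_lt_left hR
  rw [radialRetract, norm_smul, Real.norm_of_nonneg (by positivity)]
  exact mul_le_of_le_one_left (norm_nonneg _) ((div_le_one h).2 (le_max_left _ _))

theorem norm_radialRetract_le_radius {R : ℝ} (hR : 0 < R) (x : E) : ‖radialRetract R x‖ ≤ R := by
  have h : 0 < max R ‖x‖ := lt_max_of_lt_left hR
  rw [radialRetract, norm_smul, Real.norm_of_nonneg (by positivity), div_mul_eq_mul_div,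
    div_le_iff₀ h]
  exact mul_le_mul_of_nonneg_left (le_max_right _ _) hR.le

theorem lipschitzWith_radialRetract {R : ℝ} (hR : 0 < R) :
    LipschitzWith 2 (radialRetract R : E → E) := by
  refine LipschitzWith.of_dist_le_mul fun x y => ?_
  rw [dist_eq_norm, dist_eq_norm]
  have hx : 0 < max R ‖x‖ := lt_max_of_lt_left hR
  have hy : 0 < max R ‖y‖ := lt_max_of_lt_left hR
  have e : radialRetract R x - radialRetract R y
      = (R / max R ‖x‖) • (x - y) + (R / max R ‖x‖ - R / max R ‖y‖) • y := by
    simp only [radialRetract, smul_sub, sub_smul]; abel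
  have h1 : ‖(R / max R ‖x‖) • (x - y)‖ ≤ ‖x - y‖ := by
    rw [norm_smul, Real.norm_of_nonneg (by positivity)]
    exact mul_le_of_le_one_left (norm_nonneg _) ((div_le_one hx).2 (le_max_left _ _))
  have h2 : ‖(R / max R ‖x‖ - R / max R ‖y‖) • y‖ ≤ ‖x - y‖ := by
    have e2 : R / max R ‖x‖ - R / max R ‖y‖
        = (R / max R ‖x‖) * ((max R ‖y‖ - max R ‖x‖) / max R ‖y‖) := by
      field_simp
    rw [norm_smul, e2, norm_mul, Real.norm_of_nonneg (r := R / max R ‖x‖) (by positivity),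
      norm_div, Real.norm_of_nonneg hy.le]
    have h3 : ‖max R ‖y‖ - max R ‖x‖‖ ≤ ‖x - y‖ := by
      rw [Real.norm_eq_abs]
      refine (abs_max_sub_max_le_max R ‖y‖ R ‖x‖).trans ?_
      simp only [sub_self, abs_zero]
      rw [max_eq_right (abs_nonneg _), ← norm_sub_rev y x]
      exact abs_norm_sub_norm_le y x
    calc R / max R ‖x‖ * (‖max R ‖y‖ - max R ‖x‖‖ / max R ‖y‖) * ‖y‖
        = (R / max R ‖x‖) * (‖y‖ / max R ‖y‖) * ‖max R ‖y‖ - max R ‖x‖‖ := by ring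
      _ ≤ 1 * 1 * ‖x - y‖ := by
        gcongr
        · exact (div_le_one hx).2 (le_max_left _ _)
        · exact (div_le_one hy).2 (le_max_right _ _)
      _ = ‖x - y‖ := by ring
  rw [e]
  calc _ ≤ _ := norm_add_le _ _
    _ ≤ ‖x - y‖ + ‖x - y‖ := add_le_add h1 h2
    _ = _ := by norm_num; ring

/-- Existence on a bounded time interval. The right-hand side is precomposed with the radial
retraction onto a ball that, by Grönwall's inequality, no solution leaves; it is then bounded, and the
local Picard–Lindelöf theorem covers the whole interval. -/
theorem exists_hasDerivWithinAt_of_lipschitz [CompleteSpace E] {F : ℝ → E → E} {K : ℝ≥0}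
    (hF : ∀ x, Continuous fun t => F t x) (hL : ∀ t, LipschitzWith K (F t)) (x₀ : E)
    {b : ℝ} (hb : 0 ≤ b) :
    ∃ Y : ℝ → E, Y 0 = x₀ ∧ ∀ t ∈ Icc (-b) b, HasDerivWithinAt Y (F t (Y t)) (Icc (-b) b) t := by
  obtain ⟨C, hC⟩ : ∃ C, ∀ t ∈ Icc (-b) b, ‖F t x₀‖ ≤ C :=
    isCompact_Icc.exists_bound_of_continuousOn (hF x₀).continuousOn
  have hC0 : 0 ≤ C := (norm_nonneg _).trans (hC 0 ⟨by linarith, hb⟩)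
  -- A solution starting at `x₀` stays in the ball of radius `R` during the time `b`.
  set R : ℝ := gronwallBound 0 K C b + 1 with hRdef
  have hR : 0 < R := by
    have := gronwallBound_nonneg le_rfl K.coe_nonneg hC0 hb
    positivity
  let G : ℝ → E → E := fun t x => F t (x₀ + radialRetract R (x - x₀))
  have hGb : ∀ t ∈ Icc (-b) b, ∀ x, ‖G t x‖ ≤ K * ‖radialRetract R (x - x₀)‖ + C := fun t ht x => by
    have := (hL t).dist_le_mul (x₀ + radialRetract R (x - x₀)) x₀
    rw [dist_eq_norm, dist_eq_norm, add_sub_cancel_left] at this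
    calc ‖G t x‖ = ‖(G t x - F t x₀) + F t x₀‖ := by simp
      _ ≤ _ := (norm_add_le _ _).trans (add_le_add this (hC t ht))
  let L : ℝ≥0 := ⟨K * R + C, by positivity⟩
  have h0 : (0 : ℝ) ∈ Icc (-b) b := ⟨by linarith, hb⟩
  have hPL : IsPicardLindelof G (⟨0, h0⟩ : Icc (-b) b) x₀ (L * ⟨b, hb⟩) 0 L (K * 2) :=
    { lipschitzOnWith := fun t _ => by
        have h1 : LipschitzWith 1 fun x : E => x - x₀ :=
          LipschitzWith.of_dist_le_mul fun x y => by simp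
        have h2 : LipschitzWith 1 fun x : E => x₀ + x :=
          LipschitzWith.of_dist_le_mul fun x y => by simp
        have := (hL t).comp (h2.comp ((lipschitzWith_radialRetract hR).comp h1))
        simpa [G, Function.comp_def] using this.lipschitzOnWith
      continuousOn := fun x _ => (hF _).continuousOn
      norm_le := fun t ht x _ => (hGb t ht x).trans <| by
        change _ ≤ (K : ℝ) * R + C
        gcongr
        exact norm_radialRetract_le_radius hR _
      mul_max_le := by simp; rfl }
  obtain ⟨Y, hY0, hY⟩ := hPL.exists_eq_forall_mem_Icc_hasDerivWithinAt₀
  have hY0 : Y 0 = x₀ := hY0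
  refine ⟨Y, hY0, ?_⟩
  have hfwd : ∀ t ∈ Icc 0 b, ‖Y t - x₀‖ ≤ gronwallBound 0 K C t := by
    have hc : ContinuousOn (fun t => Y t - x₀) (Icc 0 b) := fun t ht =>
      (((hY t ⟨by linarith [ht.1], ht.2⟩).sub_const x₀).continuousWithinAt).mono
        (Icc_subset_Icc_left (by linarith))
    have := norm_le_gronwallBound_of_norm_deriv_right_le (δ := 0) (K := K) (ε := C) hc
      (f' := fun t => G t (Y t))
      (fun t ht => ((hY t ⟨by linarith [ht.1], ht.2.le⟩).sub_const x₀).mono_of_mem_nhdsWithin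
        (mem_of_superset (Icc_mem_nhdsGE ht.2) (Icc_subset_Icc_left (by linarith [ht.1]))))
      (by simp [hY0]) (fun t ht => (hGb t ⟨by linarith [ht.1], ht.2.le⟩ _).trans (by
        gcongr; exact norm_radialRetract_le hR _))
    simpa using this
  have hbwd : ∀ t ∈ Icc 0 b, ‖Y (-t) - x₀‖ ≤ gronwallBound 0 K C t := by
    have hY' : ∀ t ∈ Icc (-b) b,
        HasDerivWithinAt (fun t => Y (-t) - x₀) (-G (-t) (Y (-t))) (Icc (-b) b) t := fun t ht => by
      have h1 := (hY (-t) ⟨by linarith [ht.2], by linarith [ht.1]⟩)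
      have := h1.scomp t (hasDerivAt_neg t).hasDerivWithinAt (s := Icc (-b) b)
        (fun s hs => ⟨by linarith [hs.2], by linarith [hs.1]⟩)
      simpa using this.sub_const x₀
    have hc : ContinuousOn (fun t => Y (-t) - x₀) (Icc 0 b) := fun t ht =>
      ((hY' t ⟨by linarith [ht.1], ht.2⟩).continuousWithinAt).mono
        (Icc_subset_Icc_left (by linarith))
    have := norm_le_gronwallBound_of_norm_deriv_right_le (δ := 0) (K := K) (ε := C) hc
      (f' := fun t => -G (-t) (Y (-t)))
      (fun t ht => (hY' t ⟨by linarith [ht.1], ht.2.le⟩).mono_of_mem_nhdsWithin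
        (mem_of_superset (Icc_mem_nhdsGE ht.2) (Icc_subset_Icc_left (by linarith [ht.1]))))
      (by simp [hY0]) (fun t ht => by
        rw [norm_neg]
        refine (hGb (-t) ⟨by linarith [ht.2], by linarith [ht.1]⟩ _).trans (by
        gcongr; exact norm_radialRetract_le hR _))
    simpa using this
  have hball : ∀ t ∈ Icc (-b) b, ‖Y t - x₀‖ ≤ R := fun t ht => by
    have hm := gronwallBound_mono (le_refl (0 : ℝ)) hC0 K.coe_nonneg
    rcases le_total 0 t with h | h
    · have := (hfwd t ⟨h, ht.2⟩).trans (hm ht.2)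
      linarith
    · have h1 : -t ≤ b := by linarith [ht.1]
      have := (hbwd (-t) ⟨by linarith, h1⟩).trans (hm h1)
      rw [neg_neg] at this
      linarith
  intro t ht
  have := hY t ht
  simp only [G] at this
  rwa [radialRetract_of_norm_le hR (hball t ht), add_sub_cancel] at this

/-- **Global Picard–Lindelöf theorem**: an ODE whose right-hand side is continuous in time and
Lipschitz in space, with a constant independent of time, has a solution on the whole line. -/
theorem exists_hasDerivAt_of_lipschitz [CompleteSpace E] {F : ℝ → E → E} {K : ℝ≥0}
    (hF : ∀ x, Continuous fun t => F t x) (hL : ∀ t, LipschitzWith K (F t)) (t₀ : ℝ) (x₀ : E) :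
    ∃ Y : ℝ → E, Y t₀ = x₀ ∧ ∀ t, HasDerivAt Y (F t (Y t)) t := by
  suffices H : ∀ F : ℝ → E → E, (∀ x, Continuous fun t => F t x) →
      (∀ t, LipschitzWith K (F t)) → ∃ Y : ℝ → E, Y 0 = x₀ ∧ ∀ t, HasDerivAt Y (F t (Y t)) t by
    obtain ⟨Y, h0, hY⟩ := H (fun t => F (t + t₀)) (fun x => (hF x).comp (continuous_add_const t₀))
      (fun t => hL _)
    refine ⟨fun t => Y (t - t₀), by simpa using h0, fun t => ?_⟩
    have := (hY (t - t₀)).comp_sub_const t t₀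
    simpa using this
  clear hF hL F
  intro F hF hL
  have hex : ∀ n : ℕ, ∃ Y : ℝ → E, Y 0 = x₀ ∧ ∀ t ∈ Ioo (-(n + 1 : ℝ)) (n + 1),
      HasDerivAt Y (F t (Y t)) t := fun n => by
    obtain ⟨Y, h0, hY⟩ := exists_hasDerivWithinAt_of_lipschitz hF hL x₀
      (b := n + 1) (by positivity)
    exact ⟨Y, h0, fun t ht => (hY t (Ioo_subset_Icc_self ht)).hasDerivAt
      (Icc_mem_nhds ht.1 ht.2)⟩
  choose Y h0 hY using hex
  -- Solutions on nested intervals agree, so they patch together to a global one.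
  have hEq : ∀ m n : ℕ, m ≤ n → EqOn (Y m) (Y n) (Ioo (-(m + 1 : ℝ)) (m + 1)) := fun m n hmn => by
    have hmn' : (m : ℝ) ≤ n := by exact_mod_cast hmn
    have hpos : (0 : ℝ) < m + 1 := by positivity
    exact ODE_solution_unique_of_mem_Ioo (v := F) (s := fun _ => univ) (K := K) (t₀ := 0)
      (fun t _ => (hL t).lipschitzOnWith) ⟨by linarith, hpos⟩
      (fun t ht => ⟨hY m t ht, mem_univ _⟩)
      (fun t ht => ⟨hY n t ⟨by linarith [ht.1], by linarith [ht.2]⟩, mem_univ _⟩)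
      (by rw [h0, h0])
  refine ⟨fun t => Y ⌈|t|⌉₊ t, h0 _, fun t => ?_⟩
  set n := ⌈|t|⌉₊ with hn
  have htn : |t| ≤ n := Nat.le_ceil _
  have hmem : t ∈ Ioo (-(n + 1 : ℝ)) (n + 1) :=
    ⟨by linarith [neg_abs_le t], by linarith [le_abs_self t]⟩
  refine (hY n t hmem).congr_of_eventuallyEq ?_
  filter_upwards [Ioo_mem_nhds hmem.1 hmem.2] with s hs
  have hsn : |s| ≤ (⌈|s|⌉₊ : ℕ) := Nat.le_ceil _
  rcases le_total ⌈|s|⌉₊ n with h | h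
  · exact hEq _ _ h ⟨by linarith [neg_abs_le s], by linarith [le_abs_self s]⟩
  · exact (hEq _ _ h hs).symm

end ODE

/-! ### Regular vector fields and their flows -/

section Flow
variable {E : Type*} [NormedAddCommGroup E] [NormedSpace ℝ E]

/-- First order Taylor formula with a quadratic remainder. -/
theorem norm_sub_sub_fderiv_le {F : Type*} [NormedAddCommGroup F] [NormedSpace ℝ F] {f : E → F}
    {C : ℝ≥0} (hf : Differentiable ℝ f) (hL : LipschitzWith C (fderiv ℝ f)) (x y : E) :
    ‖f y - f x - fderiv ℝ f x (y - x)‖ ≤ C * ‖y - x‖ ^ 2 := by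
  have := (convex_closedBall x ‖y - x‖).norm_image_sub_le_of_norm_hasFDerivWithin_le' (f := f)
    (f' := fderiv ℝ f) (φ := fderiv ℝ f x) (C := C * ‖y - x‖) (x := x) (y := y)
    (fun z _ => (hf z).hasFDerivAt.hasFDerivWithinAt) (fun z hz => by
      have h1 := hL.dist_le_mul z x
      rw [dist_eq_norm] at h1
      exact h1.trans (mul_le_mul_of_nonneg_left (Metric.mem_closedBall.1 hz) C.coe_nonneg))
    (Metric.mem_closedBall_self (norm_nonneg _)) (by simp [dist_eq_norm])
  calc _ ≤ _ := this
    _ = _ := by ring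

/-- Joint continuity of a function that is continuous in time and Lipschitz in space, with a constant
that is uniform on bounded time intervals. -/
theorem continuous_uncurry_of_locally_lipschitz {E F : Type*} [NormedAddCommGroup E]
    [NormedAddCommGroup F] {f : ℝ → E → F} (hc : ∀ x, Continuous fun t => f t x) (A : ℝ → ℝ)
    (hA : ∀ n t, |t| ≤ n → ∀ x y, ‖f t x - f t y‖ ≤ A n * ‖x - y‖) :
    Continuous (Function.uncurry f) := by
  refine continuous_iff_continuousAt.2 fun ⟨t₀, x₀⟩ => ?_
  rw [ContinuousAt, tendsto_iff_norm_sub_tendsto_zero]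
  have hlim : Tendsto (fun p : ℝ × E => A (|t₀| + 1) * ‖p.2 - x₀‖ + ‖f p.1 x₀ - f t₀ x₀‖)
      (𝓝 (t₀, x₀)) (𝓝 0) := by
    have h : Continuous fun p : ℝ × E =>
        A (|t₀| + 1) * ‖p.2 - x₀‖ + ‖f p.1 x₀ - f t₀ x₀‖ := by
      have := hc x₀
      fun_prop
    simpa using h.tendsto (t₀, x₀)
  refine squeeze_zero' (Eventually.of_forall fun _ => norm_nonneg _) ?_ hlim
  have hev : ∀ᶠ p : ℝ × E in 𝓝 (t₀, x₀), |p.1| < |t₀| + 1 :=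
    (continuous_abs.comp continuous_fst).continuousAt.eventually_lt continuousAt_const (by simp)
  filter_upwards [hev] with p hp
  calc ‖f p.1 p.2 - f t₀ x₀‖ = ‖(f p.1 p.2 - f p.1 x₀) + (f p.1 x₀ - f t₀ x₀)‖ := by simp
    _ ≤ _ := (norm_add_le _ _).trans (by gcongr; exact hA _ _ hp.le _ _)

/-- A time-dependent vector field, defined for all times, that is bounded and continuously
differentiable in space with a bounded Lipschitz derivative, uniformly in time, and that depends
continuously on time together with its space derivative. -/
structure IsRegularField (v : ℝ → E → E) (C : ℝ≥0) : Prop where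
  continuous_time : ∀ x, Continuous fun t => v t x
  differentiable : ∀ t, Differentiable ℝ (v t)
  norm_le : ∀ t x, ‖v t x‖ ≤ C
  norm_fderiv_le : ∀ t x, ‖fderiv ℝ (v t) x‖ ≤ C
  lipschitz_fderiv : ∀ t, LipschitzWith C (fderiv ℝ (v t))
  continuous_fderiv : ∀ x, Continuous fun t => fderiv ℝ (v t) x

namespace IsRegularField
variable {v : ℝ → E → E} {C : ℝ≥0}

theorem lipschitzWith (hv : IsRegularField v C) (t : ℝ) : LipschitzWith C (v t) :=
  lipschitzWith_of_nnnorm_fderiv_le (hv.differentiable t) fun x => hv.norm_fderiv_le t x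

theorem continuous_uncurry (hv : IsRegularField v C) : Continuous (Function.uncurry v) :=
  continuous_prod_of_continuous_lipschitzWith' _ C hv.lipschitzWith hv.continuous_time

theorem continuous_uncurry_fderiv (hv : IsRegularField v C) :
    Continuous (Function.uncurry fun t => fderiv ℝ (v t)) :=
  continuous_prod_of_continuous_lipschitzWith' _ C hv.lipschitz_fderiv hv.continuous_fderiv

end IsRegularField

/-- `X` is the flow of `v` started at time `0`. -/
structure IsFlow (v X : ℝ → E → E) : Prop where
  zero : ∀ x, X 0 x = x
  hasDerivAt : ∀ x t, HasDerivAt (fun t => X t x) (v t (X t x)) t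

namespace IsFlow
variable {v X : ℝ → E → E} {C : ℝ≥0}

theorem continuous_time (hX : IsFlow v X) (x : E) : Continuous fun t => X t x :=
  continuous_iff_continuousAt.2 fun t => (hX.hasDerivAt x t).continuousAt

theorem norm_sub_le (hX : IsFlow v X) (hv : IsRegularField v C) (t : ℝ) (x y : E) :
    ‖X t x - X t y‖ ≤ Real.exp (C * |t|) * ‖x - y‖ := by
  have := norm_sub_le_of_hasDerivAt hv.lipschitzWith (hX.hasDerivAt x) (hX.hasDerivAt y) 0 t
  rw [hX.zero, hX.zero, sub_zero] at this
  rwa [mul_comm]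

/-- The inverse of the flow map is Lipschitz: the flow is followed backwards in time. -/
theorem norm_sub_le' (hX : IsFlow v X) (hv : IsRegularField v C) (t : ℝ) (x y : E) :
    ‖x - y‖ ≤ Real.exp (C * |t|) * ‖X t x - X t y‖ := by
  have := norm_sub_le_of_hasDerivAt hv.lipschitzWith (hX.hasDerivAt x) (hX.hasDerivAt y) t 0
  rw [hX.zero, hX.zero, zero_sub, abs_neg] at this
  rwa [mul_comm]

theorem continuous_uncurry (hX : IsFlow v X) (hv : IsRegularField v C) :
    Continuous (Function.uncurry X) := by
  refine continuous_uncurry_of_locally_lipschitz hX.continuous_time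
    (fun n => Real.exp (C * n)) fun n t ht x y => (hX.norm_sub_le hv t x y).trans ?_
  gcongr

/-- `W t x` solves the variational equation along the trajectory `X · x`. -/
structure IsVariation (v X : ℝ → E → E) (W : ℝ → E → E →L[ℝ] E) : Prop where
  zero : ∀ x, W 0 x = ContinuousLinearMap.id ℝ E
  hasDerivAt : ∀ x t, HasDerivAt (fun t => W t x) ((fderiv ℝ (v t) (X t x)).comp (W t x)) t

theorem exists_isVariation [CompleteSpace E] (hX : IsFlow v X) (hv : IsRegularField v C) :
    ∃ W, IsVariation v X W := by
  have H : ∀ x, ∃ W : ℝ → E →L[ℝ] E, W 0 = ContinuousLinearMap.id ℝ E ∧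
      ∀ t, HasDerivAt W ((fderiv ℝ (v t) (X t x)).comp (W t)) t := fun x => by
    have hc : Continuous fun t => fderiv ℝ (v t) (X t x) :=
      hv.continuous_uncurry_fderiv.comp (continuous_id.prodMk (hX.continuous_time x))
    refine exists_hasDerivAt_of_lipschitz (F := fun t A => (fderiv ℝ (v t) (X t x)).comp A)
      (K := C) (fun A => hc.clm_comp continuous_const) (fun t => ?_) 0 _
    refine LipschitzWith.of_dist_le_mul fun A B => ?_
    rw [dist_eq_norm, dist_eq_norm, ← ContinuousLinearMap.comp_sub]
    exact (ContinuousLinearMap.opNorm_comp_le _ _).trans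
      (mul_le_mul_of_nonneg_right (hv.norm_fderiv_le _ _) (norm_nonneg _))
  choose W h0 hW using H
  exact ⟨fun t x => W x t, h0, hW⟩

variable {W : ℝ → E → E →L[ℝ] E}

theorem IsVariation.norm_le (hW : IsVariation v X W) (hv : IsRegularField v C) (t : ℝ) (x : E) :
    ‖W t x‖ ≤ Real.exp (C * |t|) := by
  have := norm_le_gronwallBound_abs (K := C) (ε := 0) (t₀ := 0) (t := t) (hW.hasDerivAt x)
    (fun s _ => by
      rw [add_zero]
      exact (ContinuousLinearMap.opNorm_comp_le _ _).trans
        (mul_le_mul_of_nonneg_right (hv.norm_fderiv_le _ _) (norm_nonneg _)))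
  rw [gronwallBound_ε0, hW.zero, sub_zero] at this
  exact this.trans (mul_le_of_le_one_left (Real.exp_pos _).le ContinuousLinearMap.norm_id_le)

theorem IsVariation.injective (hW : IsVariation v X W) (hv : IsRegularField v C) (t : ℝ) (x : E) :
    Function.Injective (W t x) := by
  refine (injective_iff_map_eq_zero _).2 fun h hh => ?_
  have := norm_le_gronwallBound_abs (f := fun s => W s x h) (K := C) (ε := 0) (t₀ := t) (t := 0)
    (fun s => (hW.hasDerivAt x s).clm_apply (hasDerivAt_const s h))
    (fun s _ => by
      simpa using (ContinuousLinearMap.le_opNorm _ _).trans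
        (mul_le_mul_of_nonneg_right (hv.norm_fderiv_le s (X s x)) (norm_nonneg (W s x h))))
  rw [gronwallBound_ε0, hW.zero, hh] at this
  simpa using this

/-- The flow map differs from its linearization by a quadratic error. -/
theorem IsVariation.norm_remainder_le (hW : IsVariation v X W) (hX : IsFlow v X)
    (hv : IsRegularField v C) (t : ℝ) (x h : E) :
    ‖X t (x + h) - X t x - W t x h‖
      ≤ ‖h‖ ^ 2 * gronwallBound 0 C (C * Real.exp (C * |t|) ^ 2) |t| := by
  have := norm_le_gronwallBound_abs (f := fun s => X s (x + h) - X s x - W s x h) (K := C)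
    (ε := ‖h‖ ^ 2 * (C * Real.exp (C * |t|) ^ 2)) (t₀ := 0) (t := t)
    (fun s => ((hX.hasDerivAt (x + h) s).sub (hX.hasDerivAt x s)).sub
      ((hW.hasDerivAt x s).clm_apply (hasDerivAt_const s h))) (fun s hs => ?_)
  · rw [← gronwallBound_mul]
    simpa [hX.zero, hW.zero] using this
  · have hst : |s| ≤ |t| := by
      have := abs_sub_left_of_mem_uIcc hs
      simpa using this
    set D := fderiv ℝ (v s) (X s x)
    have e : v s (X s (x + h)) - v s (X s x) -
        ((D.comp (W s x)) h + W s x 0)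
        = D (X s (x + h) - X s x - W s x h) +
          (v s (X s (x + h)) - v s (X s x) - D (X s (x + h) - X s x)) := by
      simp only [map_sub, ContinuousLinearMap.comp_apply, map_zero]; abel
    have h1 : ‖X s (x + h) - X s x‖ ≤ Real.exp (C * |t|) * ‖h‖ := by
      have := hX.norm_sub_le hv s (x + h) x
      rw [add_sub_cancel_left] at this
      exact this.trans (by gcongr)
    rw [e]
    refine (norm_add_le _ _).trans (add_le_add ?_ ?_)
    · exact (D.le_opNorm _).trans (mul_le_mul_of_nonneg_right (hv.norm_fderiv_le _ _) (norm_nonneg _))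
    · refine (norm_sub_sub_fderiv_le (hv.differentiable s) (hv.lipschitz_fderiv s) _ _).trans ?_
      calc (C : ℝ) * ‖X s (x + h) - X s x‖ ^ 2 ≤ C * (Real.exp (C * |t|) * ‖h‖) ^ 2 := by gcongr
        _ = _ := by ring

theorem IsVariation.hasFDerivAt (hW : IsVariation v X W) (hX : IsFlow v X)
    (hv : IsRegularField v C) (t : ℝ) (x : E) : HasFDerivAt (X t) (W t x) x := by
  rw [hasFDerivAt_iff_isLittleO_nhds_zero]
  refine Asymptotics.IsBigO.trans_isLittleO (g := fun h : E => ‖h‖ ^ 2) ?_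
    (Asymptotics.isLittleO_norm_pow_id one_lt_two)
  refine Asymptotics.IsBigO.of_bound
    (gronwallBound 0 C (C * Real.exp (C * |t|) ^ 2) |t|) (Eventually.of_forall fun h => ?_)
  refine (hW.norm_remainder_le hX hv t x h).trans (le_of_eq ?_)
  rw [Real.norm_of_nonneg (by positivity), mul_comm]

theorem IsVariation.continuous_uncurry (hW : IsVariation v X W) (hX : IsFlow v X)
    (hv : IsRegularField v C) : Continuous (Function.uncurry W) := by
  refine continuous_uncurry_of_locally_lipschitz
    (fun x => continuous_iff_continuousAt.2 fun t => (hW.hasDerivAt x t).continuousAt)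
    (fun n => gronwallBound 0 C (C * Real.exp (C * n) ^ 2) n) fun n t ht x y => ?_
  have hn : 0 ≤ n := (abs_nonneg _).trans ht
  have := norm_le_gronwallBound_abs (f := fun s => W s x - W s y) (K := C)
    (ε := ‖x - y‖ * (C * Real.exp (C * n) ^ 2)) (t₀ := 0) (t := t)
    (fun s => (hW.hasDerivAt x s).sub (hW.hasDerivAt y s)) (fun s hs => ?_)
  · have h0 : ‖W 0 x - W 0 y‖ = ‖x - y‖ * 0 := by simp [hW.zero]
    rw [h0, gronwallBound_mul, sub_zero, mul_comm] at this
    refine this.trans (mul_le_mul_of_nonneg_right ?_ (norm_nonneg _))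
    exact gronwallBound_mono le_rfl (by positivity) C.coe_nonneg ht
  · have hst : |s| ≤ n := by
      have := abs_sub_left_of_mem_uIcc hs
      simp only [sub_zero] at this
      exact this.trans ht
    have e : (fderiv ℝ (v s) (X s x)).comp (W s x) - (fderiv ℝ (v s) (X s y)).comp (W s y)
        = (fderiv ℝ (v s) (X s x)).comp (W s x - W s y)
          + (fderiv ℝ (v s) (X s x) - fderiv ℝ (v s) (X s y)).comp (W s y) := by
      simp only [ContinuousLinearMap.comp_sub, ContinuousLinearMap.sub_comp]; abel
    rw [e]
    refine (norm_add_le _ _).trans (add_le_add ?_ ?_)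
    · exact (ContinuousLinearMap.opNorm_comp_le _ _).trans
        (mul_le_mul_of_nonneg_right (hv.norm_fderiv_le _ _) (norm_nonneg _))
    · have h1 := (hv.lipschitz_fderiv s).dist_le_mul (X s x) (X s y)
      rw [dist_eq_norm, dist_eq_norm] at h1
      calc _ ≤ ‖fderiv ℝ (v s) (X s x) - fderiv ℝ (v s) (X s y)‖ * ‖W s y‖ :=
            ContinuousLinearMap.opNorm_comp_le _ _
        _ ≤ (C * (Real.exp (C * n) * ‖x - y‖)) * Real.exp (C * n) := by
          have h2 := hX.norm_sub_le hv s x y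
          have h3 := hW.norm_le hv s y
          have h4 : Real.exp (C * |s|) ≤ Real.exp (C * n) := by gcongr
          gcongr
          · exact h1.trans (by gcongr; exact h2.trans (by gcongr))
          · exact h3.trans h4
        _ = _ := by ring

/-- The flow of a regular field is jointly `C¹` in time and space. -/
theorem contDiff_uncurry [CompleteSpace E] (hX : IsFlow v X) (hv : IsRegularField v C) :
    ∃ W, IsVariation v X W ∧ ContDiff ℝ 1 (Function.uncurry X) ∧
      ∀ p : ℝ × E, HasFDerivAt (Function.uncurry X)
        ((ContinuousLinearMap.toSpanSingleton ℝ (v p.1 (X p.1 p.2))).coprod (W p.1 p.2)) p := by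
  obtain ⟨W, hW⟩ := hX.exists_isVariation hv
  have hvc : Continuous fun q : ℝ × E =>
      ContinuousLinearMap.toSpanSingleton ℝ (v q.1 (X q.1 q.2)) :=
    (ContinuousLinearMap.toSpanSingletonCLE (𝕜 := ℝ) (E := E)).continuous.comp
      (hv.continuous_uncurry.comp (continuous_fst.prodMk (hX.continuous_uncurry hv)))
  have hWc := hW.continuous_uncurry hX hv
  have hdc : Continuous fun p : ℝ × E =>
      (ContinuousLinearMap.toSpanSingleton ℝ (v p.1 (X p.1 p.2))).coprod (W p.1 p.2) := by
    have : Continuous fun p : ℝ × E => W p.1 p.2 := hWc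
    have e : ∀ (A : ℝ →L[ℝ] E) (B : E →L[ℝ] E), A.coprod B =
        A.comp (ContinuousLinearMap.fst ℝ ℝ E) + B.comp (ContinuousLinearMap.snd ℝ ℝ E) :=
      fun A B => ContinuousLinearMap.ext fun q => rfl
    simp only [e]
    exact (hvc.clm_comp continuous_const).add (this.clm_comp continuous_const)
  have hd : ∀ p : ℝ × E, HasStrictFDerivAt (Function.uncurry X)
        ((ContinuousLinearMap.toSpanSingleton ℝ (v p.1 (X p.1 p.2))).coprod (W p.1 p.2)) p := by
    intro p
    exact hasStrictFDerivAt_uncurry_coprod (𝕜 := ℝ) (f := X)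
      (f₁ := fun t x => ContinuousLinearMap.toSpanSingleton ℝ (v t (X t x))) (f₂ := W) (u := p)
      (Eventually.of_forall fun q => (hX.hasDerivAt q.2 q.1).hasFDerivAt)
      (Eventually.of_forall fun q => hW.hasFDerivAt hX hv q.1 q.2)
      hvc.continuousAt hWc.continuousAt
  exact ⟨W, hW, contDiff_one_iff_hasFDerivAt.2 ⟨_, hdc, fun p => (hd p).hasFDerivAt⟩,
    fun p => (hd p).hasFDerivAt⟩

/-- Every state `x` at time `t` is reached by the flow from a unique initial state `Y t x`, which
is a `C¹` function of `(t, x)`. -/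
theorem exists_inverse [FiniteDimensional ℝ E] (hX : IsFlow v X) (hv : IsRegularField v C) :
    ∃ Y : ℝ → E → E, (∀ t x, Y t (X t x) = x) ∧ (∀ t x, X t (Y t x) = x) ∧
      ContDiff ℝ 1 (Function.uncurry Y) := by
  have : CompleteSpace E := FiniteDimensional.complete ℝ E
  have hsurj : ∀ t x, ∃ y, X t y = x := fun t x => by
    obtain ⟨y, hyt, hy⟩ := exists_hasDerivAt_of_lipschitz hv.continuous_time hv.lipschitzWith t x
    refine ⟨y 0, ?_⟩
    have := norm_sub_le_of_hasDerivAt hv.lipschitzWith (hX.hasDerivAt (y 0)) hy 0 t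
    rw [hX.zero, sub_self, norm_zero, zero_mul, hyt] at this
    exact sub_eq_zero.1 (norm_le_zero_iff.1 this)
  choose Y hY using hsurj
  have hYX : ∀ t x, Y t (X t x) = x := fun t x => by
    have := hX.norm_sub_le' hv t (Y t (X t x)) x
    rw [hY, sub_self, norm_zero, mul_zero] at this
    exact sub_eq_zero.1 (norm_le_zero_iff.1 this)
  have hYc : Continuous (Function.uncurry Y) := by
    refine continuous_uncurry_of_locally_lipschitz (fun x => ?_) (fun n => Real.exp (C * n))
      fun n t ht x y => ?_
    · refine continuous_iff_continuousAt.2 fun s => ?_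
      rw [ContinuousAt, tendsto_iff_norm_sub_tendsto_zero]
      have hlim : Tendsto (fun t => Real.exp (C * |t|) * ‖x - X t (Y s x)‖) (𝓝 s) (𝓝 0) := by
        have := hX.continuous_time (Y s x)
        have h : Continuous fun t => Real.exp (C * |t|) * ‖x - X t (Y s x)‖ := by fun_prop
        simpa [hY] using h.tendsto s
      refine squeeze_zero (fun _ => norm_nonneg _) (fun t => ?_) hlim
      have := hX.norm_sub_le' hv t (Y t x) (Y s x)
      rwa [hY] at this
    · have := hX.norm_sub_le' hv t (Y t x) (Y t y)
      rw [hY, hY] at this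
      exact this.trans (by gcongr)
  refine ⟨Y, hYX, hY, ?_⟩
  obtain ⟨W, hW, hcd, hder⟩ := hX.contDiff_uncurry hv
  -- The inverse of `(t, x) ↦ (t, X t x)`, a homeomorphism with invertible derivatives, is `C¹`.
  let G : ℝ × E ≃ₜ ℝ × E :=
    { toFun := fun p => (p.1, X p.1 p.2)
      invFun := fun p => (p.1, Y p.1 p.2)
      left_inv := fun p => by simp [hYX]
      right_inv := fun p => by simp [hY]
      continuous_toFun := continuous_fst.prodMk (hX.continuous_uncurry hv)
      continuous_invFun := continuous_fst.prodMk hYc }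
  let L : ℝ × E → (ℝ × E →L[ℝ] ℝ × E) := fun p => (ContinuousLinearMap.fst ℝ ℝ E).prod
    ((ContinuousLinearMap.toSpanSingleton ℝ (v p.1 (X p.1 p.2))).coprod (W p.1 p.2))
  have hLinj : ∀ p, Function.Injective (L p : ℝ × E →ₗ[ℝ] ℝ × E) := fun p => by
    refine (injective_iff_map_eq_zero _).2 fun q hq => ?_
    have hq1 : q.1 = 0 := congrArg Prod.fst hq
    have hq2 : q.1 • v p.1 (X p.1 p.2) + W p.1 p.2 q.2 = 0 := congrArg Prod.snd hq
    rw [hq1, zero_smul, zero_add] at hq2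
    exact Prod.ext hq1 ((injective_iff_map_eq_zero _).1 (hW.injective hv p.1 p.2) _ hq2)
  have hG : ∀ p, HasFDerivAt G (((LinearEquiv.ofInjectiveEndo _ (hLinj p)).toContinuousLinearEquiv :
      (ℝ × E) ≃L[ℝ] (ℝ × E)) : ℝ × E →L[ℝ] ℝ × E) p := fun p => by
    have h1 : HasFDerivAt G (L p) p := hasFDerivAt_fst.prodMk (hder p)
    convert h1 using 1
    exact ContinuousLinearMap.ext fun q => rfl
  have := G.contDiff_symm hG (n := 1) (contDiff_fst.prodMk hcd)
  exact contDiff_snd.comp this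

end IsFlow

end Flow

/-! ### The Wasserstein distance -/

section Wasserstein
variable {d : ℕ} {F : Type*} [NormedAddCommGroup F] [NormedSpace ℝ F]

theorem integrable_of_continuous_of_norm_le {α F : Type*} [NormedAddCommGroup F]
    [TopologicalSpace α] [MeasurableSpace α] [OpensMeasurableSpace α]
    [SecondCountableTopology α] {μ : Measure α} [IsFiniteMeasure μ]
    {f : α → F} (hf : Continuous f) {C : ℝ} (hC : ∀ x, ‖f x‖ ≤ C) : Integrable f μ :=
  Integrable.of_bound hf.aestronglyMeasurable C (Eventually.of_forall hC)

/-- The easy half of Kantorovich–Rubinstein duality, for the 2-Wasserstein distance. -/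
theorem enorm_integral_sub_le_wasserstein2 {μ ν : Measure (State d)} [IsProbabilityMeasure μ]
    [IsProbabilityMeasure ν] {f : State d → F} {L : ℝ≥0} (hf : LipschitzWith L f) {C : ℝ}
    (hC : ∀ x, ‖f x‖ ≤ C) : ‖∫ x, f x ∂μ - ∫ x, f x ∂ν‖ₑ ≤ L * wasserstein2 μ ν := by
  -- A bound for every coupling, from the Cauchy–Schwarz inequality.
  have key : ∀ π : Measure (State d × State d), π.fst = μ → π.snd = ν →
      ‖∫ x, f x ∂μ - ∫ x, f x ∂ν‖ₑ ≤ L * (∫⁻ p, edist p.1 p.2 ^ 2 ∂π) ^ (1 / 2 : ℝ) := by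
    intro π h1 h2
    have : IsProbabilityMeasure π := ⟨by
      rw [← Measure.fst_univ, h1, measure_univ]⟩
    have e1 : ∫ x, f x ∂μ = ∫ p, f p.1 ∂π := by
      rw [← h1, Measure.fst, integral_map measurable_fst.aemeasurable
        hf.continuous.aestronglyMeasurable]
    have e2 : ∫ x, f x ∂ν = ∫ p, f p.2 ∂π := by
      rw [← h2, Measure.snd, integral_map measurable_snd.aemeasurable
        hf.continuous.aestronglyMeasurable]
    have i1 : Integrable (fun p : State d × State d => f p.1) π :=
      integrable_of_continuous_of_norm_le (hf.continuous.comp continuous_fst) fun p => hC p.1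
    have i2 : Integrable (fun p : State d × State d => f p.2) π :=
      integrable_of_continuous_of_norm_le (hf.continuous.comp continuous_snd) fun p => hC p.2
    rw [e1, e2, ← integral_sub i1 i2]
    have hm : AEMeasurable (fun p : State d × State d => edist p.1 p.2) π :=
      (continuous_fst.edist continuous_snd).aemeasurable
    calc ‖∫ p, (f p.1 - f p.2) ∂π‖ₑ ≤ ∫⁻ p, ‖f p.1 - f p.2‖ₑ ∂π :=
          enorm_integral_le_lintegral_enorm _
      _ ≤ ∫⁻ p, L * edist p.1 p.2 ∂π := lintegral_mono fun p => by
          rw [← edist_eq_enorm_sub]; exact hf p.1 p.2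
      _ = L * ∫⁻ p, edist p.1 p.2 ∂π := lintegral_const_mul'' _ hm
      _ ≤ L * (∫⁻ p, edist p.1 p.2 ^ 2 ∂π) ^ (1 / 2 : ℝ) := by
          gcongr
          have := ENNReal.lintegral_mul_le_Lp_mul_Lq π Real.HolderConjugate.two_two hm
            (aemeasurable_const (b := (1 : ℝ≥0∞)))
          simpa using this
  -- For `L = 0` the bound `0 * wasserstein2 μ ν` is `0`, even if the distance is infinite.
  rcases eq_or_ne L 0 with rfl | hL
  · have h0 := key (μ.prod ν) (by simp) (by simp)
    simpa using h0
  have hL' : (L : ℝ≥0∞) ≠ 0 := by simpa using hL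
  rw [mul_comm, ← ENNReal.div_le_iff_le_mul (Or.inl hL') (Or.inl ENNReal.coe_ne_top)]
  rw [wasserstein2, one_div, ENNReal.le_rpow_inv_iff two_pos]
  refine le_iInf₂ fun π hπ => ?_
  rw [← ENNReal.le_rpow_inv_iff two_pos, ← one_div,
    ENNReal.div_le_iff_le_mul (Or.inl hL') (Or.inl ENNReal.coe_ne_top), mul_comm]
  exact key π hπ.1 hπ.2

/-- The pair of the two maps is a coupling of the two image measures. -/
theorem wasserstein2_map_le {α : Type*} [MeasurableSpace α] {μ : Measure α}
    [IsProbabilityMeasure μ] {X Y : α → State d} (hX : Measurable X) (hY : Measurable Y) {r : ℝ}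
    (h : ∀ x, ‖X x - Y x‖ ≤ r) : wasserstein2 (μ.map X) (μ.map Y) ≤ ENNReal.ofReal r := by
  rw [wasserstein2, one_div, ENNReal.rpow_inv_le_iff two_pos]
  have hfst : (μ.map fun x => (X x, Y x)).fst = μ.map X := Measure.fst_map_prodMk hY
  have hsnd : (μ.map fun x => (X x, Y x)).snd = μ.map Y := Measure.snd_map_prodMk hX
  refine (iInf₂_le (μ.map fun x => (X x, Y x)) ⟨hfst, hsnd⟩).trans ?_
  · rw [lintegral_map (by fun_prop) (hX.prodMk hY)]
    calc ∫⁻ a, edist (X a) (Y a) ^ 2 ∂μ ≤ ∫⁻ _, ENNReal.ofReal r ^ (2 : ℝ) ∂μ := by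
          refine lintegral_mono fun a => ?_
          rw [← ENNReal.rpow_two]
          gcongr
          rw [edist_dist, dist_eq_norm]
          exact ENNReal.ofReal_le_ofReal (h a)
      _ = _ := by simp

end Wasserstein

/-! ### Regularity of the velocity field -/

section Velocity
variable {d M : ℕ}

theorem ControlValue.part_sub (a b : ControlValue d M) (ℓ : Fin M) :
    (a - b).part ℓ = a.part ℓ - b.part ℓ := rfl

theorem ControlValue.norm_part_le (a : ControlValue d M) (ℓ : Fin M) : ‖a.part ℓ‖ ≤ ‖a‖ := by
  rw [EuclideanSpace.norm_eq, EuclideanSpace.norm_eq]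
  refine Real.sqrt_le_sqrt ?_
  rw [Fintype.sum_prod_type]
  exact Finset.single_le_sum (f := fun ℓ => ∑ k, ‖a (ℓ, k)‖ ^ 2)
    (fun i _ => Finset.sum_nonneg fun _ _ => by positivity) (Finset.mem_univ ℓ)

/-- `K` is differentiable, `K` and `DK` are bounded by `C`, and `DK` is `C`-Lipschitz. -/
structure IsKernel (K : State d → State d) (C : ℝ≥0) : Prop where
  differentiable : Differentiable ℝ K
  norm_le : ∀ x, ‖K x‖ ≤ C
  norm_fderiv_le : ∀ x, ‖fderiv ℝ K x‖ ≤ C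
  lipschitz_fderiv : LipschitzWith C (fderiv ℝ K)

theorem IsKernel.mono {K : State d → State d} {C C' : ℝ≥0} (h : IsKernel K C) (hC : C ≤ C') :
    IsKernel K C' :=
  ⟨h.differentiable, fun x => (h.norm_le x).trans hC, fun x => (h.norm_fderiv_le x).trans hC,
    h.lipschitz_fderiv.weaken hC⟩

theorem IsKernel.lipschitzWith {K : State d → State d} {C : ℝ≥0} (h : IsKernel K C) :
    LipschitzWith C K :=
  lipschitzWith_of_nnnorm_fderiv_le h.differentiable h.norm_fderiv_le

theorem IsCb2.exists_isKernel {K : State d → State d} (hK : IsCb2 K) : ∃ C, IsKernel K C := by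
  obtain ⟨hc, hb⟩ := hK
  obtain ⟨C0, h0⟩ := hb 0 (by norm_num)
  obtain ⟨C1, h1⟩ := hb 1 (by norm_num)
  obtain ⟨C2, h2⟩ := hb 2 le_rfl
  simp only [norm_iteratedFDeriv_zero] at h0
  simp only [norm_iteratedFDeriv_one] at h1
  replace h2 : ∀ x, ‖fderiv ℝ (fderiv ℝ K) x‖ ≤ C2 := fun x => by
    rw [← norm_iteratedFDeriv_one, norm_iteratedFDeriv_fderiv]; exact h2 x
  have p0 := (norm_nonneg _).trans (h0 0)
  have p1 := (norm_nonneg _).trans (h1 0)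
  have p2 : 0 ≤ C2 := (norm_nonneg (fderiv ℝ (fderiv ℝ K) 0)).trans (h2 0)
  refine ⟨⟨C0 + C1 + C2, by positivity⟩, hc.differentiable (by norm_num), fun x => ?_, fun x => ?_,
    lipschitzWith_of_nnnorm_fderiv_le (𝕜 := ℝ) ?_ fun x => ?_⟩
  · exact (h0 x).trans (by change C0 ≤ C0 + C1 + C2; linarith)
  · exact (h1 x).trans (by change C1 ≤ C0 + C1 + C2; linarith)
  · exact (hc.fderiv_right (m := 1) (by norm_num)).differentiable (by norm_num)
  · exact (h2 x).trans (by change C2 ≤ C0 + C1 + C2; linarith)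

section Convolution
variable {F : Type*} [NormedAddCommGroup F] [NormedSpace ℝ F] {f : State d → F} {C : ℝ≥0}
  {μ ν : Measure (State d)} [IsProbabilityMeasure μ] [IsProbabilityMeasure ν]

theorem integrable_sub_left {G : Type*} [NormedAddCommGroup G] {f : State d → G}
    (hf : LipschitzWith C f) (hC : ∀ x, ‖f x‖ ≤ C) (x : State d) :
    Integrable (fun y => f (x - y)) μ :=
  integrable_of_continuous_of_norm_le
    (hf.continuous.comp (continuous_const.sub continuous_id)) fun _ => hC _

theorem norm_integral_sub_left_le (hC : ∀ x, ‖f x‖ ≤ C) (x : State d) :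
    ‖∫ y, f (x - y) ∂μ‖ ≤ C := by
  simpa using norm_integral_le_of_norm_le_const (μ := μ)
    (Eventually.of_forall fun y => hC (x - y))

theorem norm_integral_sub_left_sub_le (hf : LipschitzWith C f) (hC : ∀ x, ‖f x‖ ≤ C)
    (x x' : State d) : ‖∫ y, f (x - y) ∂μ - ∫ y, f (x' - y) ∂μ‖ ≤ C * ‖x - x'‖ := by
  rw [← integral_sub (integrable_sub_left hf hC x) (integrable_sub_left hf hC x')]
  refine (norm_integral_le_of_norm_le_const (μ := μ) (C := C * ‖x - x'‖)
    (Eventually.of_forall fun y => ?_)).trans (by simp)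
  simpa [dist_eq_norm] using hf.dist_le_mul (x - y) (x' - y)

theorem enorm_integral_sub_left_sub_le (hf : LipschitzWith C f) (hC : ∀ x, ‖f x‖ ≤ C)
    (x : State d) :
    ‖∫ y, f (x - y) ∂μ - ∫ y, f (x - y) ∂ν‖ₑ ≤ C * wasserstein2 μ ν := by
  refine enorm_integral_sub_le_wasserstein2 (f := fun y => f (x - y)) ?_ fun y => hC (x - y)
  refine LipschitzWith.of_dist_le_mul fun y y' => ?_
  have := hf.dist_le_mul (x - y) (x - y')
  rwa [dist_sub_left] at this

end Convolution

variable {K₁ K₂ : State d → State d} {C : ℝ≥0} {μ ν : Measure (State d)}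
  [IsProbabilityMeasure μ] [IsProbabilityMeasure ν]

theorem norm_velocity_le (h₁ : IsKernel K₁ C) (h₂ : IsKernel K₂ C) (c : ControlValue d M)
    (x : State d) : ‖velocity K₁ K₂ μ c x‖ ≤ C * (M + 1) := by
  refine (norm_sub_le _ _).trans ?_
  rw [norm_neg]
  have a := norm_integral_sub_left_le (μ := μ) h₁.norm_le x
  have b : ‖∑ ℓ, K₂ (x - c.part ℓ)‖ ≤ ∑ _ℓ : Fin M, (C : ℝ) :=
    norm_sum_le_of_le _ fun ℓ _ => h₂.norm_le _
  simp at b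
  linarith

theorem hasFDerivAt_velocity (h₁ : IsKernel K₁ C) (h₂ : IsKernel K₂ C) (c : ControlValue d M)
    (x : State d) : HasFDerivAt (velocity K₁ K₂ μ c)
      (-(∫ y, fderiv ℝ K₁ (x - y) ∂μ) - ∑ ℓ, fderiv ℝ K₂ (x - c.part ℓ)) x := by
  refine HasFDerivAt.sub (HasFDerivAt.neg ?_) (HasFDerivAt.fun_sum fun ℓ _ => ?_)
  · refine hasFDerivAt_integral_of_dominated_of_fderiv_le
      (F' := fun z y => fderiv ℝ K₁ (z - y)) (bound := fun _ => (C : ℝ)) univ_mem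
      (Eventually.of_forall fun z => (integrable_sub_left h₁.lipschitzWith h₁.norm_le z).1)
      (integrable_sub_left h₁.lipschitzWith h₁.norm_le x)
      (integrable_sub_left h₁.lipschitz_fderiv h₁.norm_fderiv_le x).1
      (Eventually.of_forall fun y z _ => h₁.norm_fderiv_le _) (integrable_const _)
      (Eventually.of_forall fun y z _ => ?_)
    simpa using! (h₁.differentiable (z - y)).hasFDerivAt.comp z ((hasFDerivAt_id z).sub_const y)
  · simpa using! (h₂.differentiable (x - c.part ℓ)).hasFDerivAt.comp x
      ((hasFDerivAt_id x).sub_const (c.part ℓ))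

theorem fderiv_velocity (h₁ : IsKernel K₁ C) (h₂ : IsKernel K₂ C) (c : ControlValue d M)
    (x : State d) : fderiv ℝ (velocity K₁ K₂ μ c) x =
      -(∫ y, fderiv ℝ K₁ (x - y) ∂μ) - ∑ ℓ, fderiv ℝ K₂ (x - c.part ℓ) :=
  (hasFDerivAt_velocity h₁ h₂ c x).fderiv

theorem norm_fderiv_velocity_le (h₁ : IsKernel K₁ C) (h₂ : IsKernel K₂ C) (c : ControlValue d M)
    (x : State d) : ‖fderiv ℝ (velocity K₁ K₂ μ c) x‖ ≤ C * (M + 1) := by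
  rw [fderiv_velocity h₁ h₂]
  refine (norm_sub_le _ _).trans ?_
  rw [norm_neg]
  have a := norm_integral_sub_left_le (μ := μ) h₁.norm_fderiv_le x
  have b : ‖∑ ℓ, fderiv ℝ K₂ (x - c.part ℓ)‖ ≤ ∑ _ℓ : Fin M, (C : ℝ) :=
    norm_sum_le_of_le _ fun ℓ _ => h₂.norm_fderiv_le _
  simp at b
  linarith

theorem norm_sum_part_sub_le {F : Type*} [NormedAddCommGroup F] {f : State d → F}
    (hf : LipschitzWith C f) (c c' : ControlValue d M) (x x' : State d) :
    ‖∑ ℓ, f (x - c.part ℓ) - ∑ ℓ, f (x' - c'.part ℓ)‖ ≤ C * M * (‖x - x'‖ + ‖c - c'‖) := by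
  rw [← Finset.sum_sub_distrib]
  have b : ‖∑ ℓ, (f (x - c.part ℓ) - f (x' - c'.part ℓ))‖
      ≤ ∑ _ℓ : Fin M, C * (‖x - x'‖ + ‖c - c'‖) := norm_sum_le_of_le _ fun ℓ _ => by
    have h := hf.dist_le_mul (x - c.part ℓ) (x' - c'.part ℓ)
    rw [dist_eq_norm, dist_eq_norm] at h
    refine h.trans (mul_le_mul_of_nonneg_left ?_ C.coe_nonneg)
    have e : x - c.part ℓ - (x' - c'.part ℓ) = (x - x') - (c - c').part ℓ := by
      rw [ControlValue.part_sub]; abel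
    rw [e]
    exact (norm_sub_le _ _).trans (by gcongr; exact ControlValue.norm_part_le _ _)
  simp only [Finset.sum_const, Finset.card_univ, Fintype.card_fin, nsmul_eq_mul] at b
  linarith

/-- The velocity field depends on the measure, the control and the state in a Lipschitz way. -/
theorem norm_velocity_sub_le (h₁ : IsKernel K₁ C) (h₂ : IsKernel K₂ C) (c c' : ControlValue d M)
    (x x' : State d) {r : ℝ} (hr : 0 ≤ r) (hW : wasserstein2 μ ν ≤ ENNReal.ofReal r) :
    ‖velocity K₁ K₂ μ c x - velocity K₁ K₂ ν c' x'‖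
      ≤ C * r + C * (M + 1) * (‖x - x'‖ + ‖c - c'‖) := by
  have a := norm_integral_sub_left_sub_le (μ := μ) h₁.lipschitzWith h₁.norm_le x x'
  have b : ‖∫ y, K₁ (x' - y) ∂μ - ∫ y, K₁ (x' - y) ∂ν‖ ≤ C * r := by
    have := (enorm_integral_sub_left_sub_le (μ := μ) (ν := ν) h₁.lipschitzWith h₁.norm_le x').trans
      (mul_le_mul_right hW (C : ℝ≥0∞))
    rw [← ofReal_norm, ← ENNReal.ofReal_coe_nnreal, ← ENNReal.ofReal_mul C.coe_nonneg] at this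
    exact (ENNReal.ofReal_le_ofReal_iff (by positivity)).1 this
  have c1 := norm_sum_part_sub_le h₂.lipschitzWith c c' x x'
  have e : velocity K₁ K₂ μ c x - velocity K₁ K₂ ν c' x' =
      -((∫ y, K₁ (x - y) ∂μ - ∫ y, K₁ (x' - y) ∂μ) + (∫ y, K₁ (x' - y) ∂μ - ∫ y, K₁ (x' - y) ∂ν)
        + (∑ ℓ, K₂ (x - c.part ℓ) - ∑ ℓ, K₂ (x' - c'.part ℓ))) := by
    simp only [velocity]; abel
  rw [e, norm_neg]
  refine (norm_add₃_le ..).trans ?_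
  have : 0 ≤ C * ‖c - c'‖ := by positivity
  nlinarith

theorem norm_fderiv_velocity_sub_le (h₁ : IsKernel K₁ C) (h₂ : IsKernel K₂ C)
    (c c' : ControlValue d M)
    (x x' : State d) {r : ℝ} (hr : 0 ≤ r) (hW : wasserstein2 μ ν ≤ ENNReal.ofReal r) :
    ‖fderiv ℝ (velocity K₁ K₂ μ c) x - fderiv ℝ (velocity K₁ K₂ ν c') x'‖
      ≤ C * r + C * (M + 1) * (‖x - x'‖ + ‖c - c'‖) := by
  have a := norm_integral_sub_left_sub_le (μ := μ) h₁.lipschitz_fderiv h₁.norm_fderiv_le x x'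
  have b : ‖∫ y, fderiv ℝ K₁ (x' - y) ∂μ - ∫ y, fderiv ℝ K₁ (x' - y) ∂ν‖ ≤ C * r := by
    have := (enorm_integral_sub_left_sub_le (μ := μ) (ν := ν) h₁.lipschitz_fderiv
      h₁.norm_fderiv_le x').trans (mul_le_mul_right hW (C : ℝ≥0∞))
    rw [← ofReal_norm, ← ENNReal.ofReal_coe_nnreal, ← ENNReal.ofReal_mul C.coe_nonneg] at this
    exact (ENNReal.ofReal_le_ofReal_iff (by positivity)).1 this
  have c1 := norm_sum_part_sub_le h₂.lipschitz_fderiv c c' x x'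
  rw [fderiv_velocity h₁ h₂, fderiv_velocity h₁ h₂]
  have e : -(∫ y, fderiv ℝ K₁ (x - y) ∂μ) - ∑ ℓ, fderiv ℝ K₂ (x - c.part ℓ)
        - (-(∫ y, fderiv ℝ K₁ (x' - y) ∂ν) - ∑ ℓ, fderiv ℝ K₂ (x' - c'.part ℓ)) =
      -((∫ y, fderiv ℝ K₁ (x - y) ∂μ - ∫ y, fderiv ℝ K₁ (x' - y) ∂μ)
        + (∫ y, fderiv ℝ K₁ (x' - y) ∂μ - ∫ y, fderiv ℝ K₁ (x' - y) ∂ν)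
        + (∑ ℓ, fderiv ℝ K₂ (x - c.part ℓ) - ∑ ℓ, fderiv ℝ K₂ (x' - c'.part ℓ))) := by
    abel
  rw [e, norm_neg]
  refine (norm_add₃_le ..).trans ?_
  have : 0 ≤ C * ‖c - c'‖ := by positivity
  nlinarith

theorem wasserstein2_self (μ : Measure (State d)) [IsProbabilityMeasure μ] :
    wasserstein2 μ μ = 0 := by
  have := wasserstein2_map_le (μ := μ) (X := id) (Y := id) (r := 0) measurable_id measurable_id
    (by simp)
  simpa using this

/-- Along a continuous curve of measures and controls, the velocity field is regular. -/
theorem isRegularField_velocity (h₁ : IsKernel K₁ C) (h₂ : IsKernel K₂ C)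
    {m : ℝ → Measure (State d)} (hm : ∀ t, IsProbabilityMeasure (m t))
    (hmc : ∀ t, Tendsto (fun s => wasserstein2 (m s) (m t)) (𝓝 t) (𝓝 0))
    {c : ℝ → ControlValue d M} (hc : Continuous c) :
    IsRegularField (fun t => velocity K₁ K₂ (m t) (c t)) (C * (M + 1)) := by
  have hlim : ∀ t, Tendsto (fun s => C * (wasserstein2 (m s) (m t)).toReal
      + C * (M + 1) * (0 + ‖c s - c t‖)) (𝓝 t) (𝓝 0) := fun t => by
    have h1 : Tendsto (fun s => (wasserstein2 (m s) (m t)).toReal) (𝓝 t) (𝓝 0) := by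
      simpa [Function.comp_def] using (ENNReal.tendsto_toReal ENNReal.zero_ne_top).comp (hmc t)
    have h2 : Tendsto (fun s => ‖c s - c t‖) (𝓝 t) (𝓝 0) :=
      tendsto_iff_norm_sub_tendsto_zero.1 (hc.tendsto t)
    simpa using (h1.const_mul (C : ℝ)).add ((h2.const_add 0).const_mul (C * (M + 1 : ℝ)))
  have hfin : ∀ t, ∀ᶠ s in 𝓝 t,
      wasserstein2 (m s) (m t) ≤ ENNReal.ofReal (wasserstein2 (m s) (m t)).toReal := fun t => by
    filter_upwards [(hmc t).eventually_lt_const ENNReal.zero_lt_top] with s hs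
    rw [ENNReal.ofReal_toReal hs.ne]
  refine ⟨fun x => ?_, fun t x => ?_, fun t x => ?_, fun t x => ?_, fun t => ?_, fun x => ?_⟩
  · refine continuous_iff_continuousAt.2 fun t => ?_
    rw [ContinuousAt, tendsto_iff_norm_sub_tendsto_zero]
    refine squeeze_zero' (Eventually.of_forall fun _ => norm_nonneg _) ?_ (hlim t)
    filter_upwards [hfin t] with s hs
    simpa using norm_velocity_sub_le h₁ h₂ (c s) (c t) x x ENNReal.toReal_nonneg hs
  · exact (hasFDerivAt_velocity h₁ h₂ _ x).differentiableAt
  · exact_mod_cast norm_velocity_le h₁ h₂ _ x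
  · exact_mod_cast norm_fderiv_velocity_le h₁ h₂ _ x
  · refine LipschitzWith.of_dist_le_mul fun x y => ?_
    rw [dist_eq_norm, dist_eq_norm]
    have := norm_fderiv_velocity_sub_le (μ := m t) (ν := m t) h₁ h₂ (c t) (c t) x y le_rfl
      (by rw [wasserstein2_self]; simp)
    simpa using this
  · refine continuous_iff_continuousAt.2 fun t => ?_
    rw [ContinuousAt, tendsto_iff_norm_sub_tendsto_zero]
    refine squeeze_zero' (Eventually.of_forall fun _ => norm_nonneg _) ?_ (hlim t)
    filter_upwards [hfin t] with s hs
    simpa using norm_fderiv_velocity_sub_le h₁ h₂ (c s) (c t) x x ENNReal.toReal_nonneg hs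

end Velocity

/-! ### Uniqueness for the continuity equation -/

/-- Finite measures are determined by the integrals of compactly supported `C¹` functions. -/
theorem measure_eq_of_forall_integral_contDiff {E : Type*} [NormedAddCommGroup E]
    [InnerProductSpace ℝ E] [FiniteDimensional ℝ E] [MeasurableSpace E] [BorelSpace E]
    {μ ν : Measure E} [IsFiniteMeasure μ] [IsFiniteMeasure ν]
    (h : ∀ ψ : E → ℝ, ContDiff ℝ 1 ψ → HasCompactSupport ψ → ∫ x, ψ x ∂μ = ∫ x, ψ x ∂ν) :
    μ = ν := by
  have hopen : ∀ s : Set E, IsOpen s → μ s = ν s := fun s hs => by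
    obtain ⟨f, hfs, hfc, hfr⟩ := hs.exists_contDiff_support_eq (n := 1)
    have hf0 : ∀ x, 0 ≤ f x := fun x => (hfr ⟨x, rfl⟩).1
    -- Smooth cut-off functions increasing to the indicator function of `s`.
    let ψ : ℕ → E → ℝ := fun n x =>
      Real.smoothTransition (n * f x) * Real.smoothTransition (n + 1 - ‖x‖ ^ 2)
    have hψ : ∀ n, ContDiff ℝ 1 (ψ n) := fun n =>
      (Real.smoothTransition.contDiff.comp (contDiff_const.mul hfc)).mul
        (Real.smoothTransition.contDiff.comp (contDiff_const.sub (contDiff_norm_sq ℝ)))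
    have hψc : ∀ n, HasCompactSupport (ψ n) := fun n => by
      refine HasCompactSupport.intro (isCompact_closedBall (0 : E) (n + 1)) fun x hx => ?_
      have hx' : (n : ℝ) + 1 < ‖x‖ := by simpa using hx
      have hn : (0 : ℝ) ≤ n := n.cast_nonneg
      have : (n : ℝ) + 1 - ‖x‖ ^ 2 ≤ 0 := by nlinarith
      simp [ψ, Real.smoothTransition.zero_of_nonpos this]
    have hlim : ∀ x, Tendsto (fun n => ψ n x) atTop (𝓝 (s.indicator 1 x)) := fun x => by
      by_cases hx : x ∈ s
      · have hfx : 0 < f x := lt_of_le_of_ne (hf0 x) (Ne.symm (by rwa [← hfs] at hx))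
        obtain ⟨N, hN⟩ := exists_nat_ge (max (1 / f x) (‖x‖ ^ 2))
        refine tendsto_const_nhds.congr' ?_
        filter_upwards [eventually_ge_atTop N] with n hn
        have hnN : (N : ℝ) ≤ n := by exact_mod_cast hn
        have h1 : 1 ≤ (n : ℝ) * f x := by
          have := ((le_max_left _ _).trans hN).trans hnN
          rwa [div_le_iff₀ hfx] at this
        have h2 : 1 ≤ (n : ℝ) + 1 - ‖x‖ ^ 2 := by
          have := ((le_max_right _ _).trans hN).trans hnN
          linarith
        simp [ψ, hx, Real.smoothTransition.one_of_one_le h1, Real.smoothTransition.one_of_one_le h2]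
      · have hfx : f x = 0 := by
          by_contra hne
          exact hx (hfs ▸ hne)
        simp [ψ, hx, hfx]
    have hint : ∀ (ρ : Measure E) [IsFiniteMeasure ρ],
        Tendsto (fun n => ∫ x, ψ n x ∂ρ) atTop (𝓝 (ρ.real s)) := fun ρ _ => by
      have := tendsto_integral_of_dominated_convergence (μ := ρ) (fun _ => (1 : ℝ))
        (fun n => (hψ n).continuous.aestronglyMeasurable) (integrable_const _)
        (fun n => Eventually.of_forall fun x => ?_) (Eventually.of_forall hlim)
      · rwa [integral_indicator_one hs.measurableSet] at this
      · rw [Real.norm_of_nonneg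
          (mul_nonneg (Real.smoothTransition.nonneg _) (Real.smoothTransition.nonneg _))]
        exact mul_le_one₀ (Real.smoothTransition.le_one _) (Real.smoothTransition.nonneg _)
          (Real.smoothTransition.le_one _)
    have h1 := hint μ
    simp_rw [h _ (hψ _) (hψc _)] at h1
    exact (measureReal_eq_measureReal_iff).1 (tendsto_nhds_unique h1 (hint ν))
  refine ext_of_generate_finite _ (BorelSpace.measurable_eq (α := E)) isPiSystem_isOpen
    (fun s hs => hopen s hs) (hopen _ isOpen_univ)

section Uniqueness
variable {d : ℕ} {v X : ℝ → State d → State d} {C : ℝ≥0} {T : ℝ} {μ : ℝ → Measure (State d)}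

/-- Transporting `ψ` along the flow and cutting off in time yields an admissible test function, for
which the transport operator only sees the time cut-off. -/
theorem IsFlow.testFunction (hX : IsFlow v X) (hv : IsRegularField v C) {Y : ℝ → State d → State d}
    (hYX : ∀ t x, Y t (X t x) = x) (hXY : ∀ t x, X t (Y t x) = x)
    (hY : ContDiff ℝ 1 (Function.uncurry Y)) {χ : ℝ → ℝ} (hχ : ContDiff ℝ 1 χ)
    (hχc : HasCompactSupport χ) {ψ : State d → ℝ} (hψ : ContDiff ℝ 1 ψ)
    (hψc : HasCompactSupport ψ) :
    ContDiff ℝ 1 (fun p : ℝ × State d => χ p.1 * ψ (Y p.1 p.2)) ∧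
    HasCompactSupport (fun p : ℝ × State d => χ p.1 * ψ (Y p.1 p.2)) ∧
    ∀ t x, fderiv ℝ (fun p : ℝ × State d => χ p.1 * ψ (Y p.1 p.2)) (t, x) (1, v t x)
      = deriv χ t * ψ (Y t x) := by
  have hcd : ContDiff ℝ 1 (fun p : ℝ × State d => χ p.1 * ψ (Y p.1 p.2)) :=
    (hχ.comp contDiff_fst).mul (hψ.comp hY)
  refine ⟨hcd, ?_, fun t x => ?_⟩
  · have hK : IsCompact ((fun p : ℝ × State d => (p.1, X p.1 p.2)) ''
        (tsupport χ ×ˢ tsupport ψ)) :=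
      (hχc.isCompact.prod hψc.isCompact).image
        (continuous_fst.prodMk (hX.continuous_uncurry hv))
    refine HasCompactSupport.intro hK fun p hp => ?_
    by_contra hne
    refine hp ⟨(p.1, Y p.1 p.2), ⟨?_, ?_⟩, by simp [hXY]⟩
    · exact subset_tsupport _ (left_ne_zero_of_mul hne)
    · exact subset_tsupport _ (right_ne_zero_of_mul hne)
  · have h1 : HasDerivAt (fun s => (s, X s (Y t x))) ((1 : ℝ), v t x) t := by
      have := (hasDerivAt_id t).prodMk (hX.hasDerivAt (Y t x) t)
      rwa [hXY] at this
    have h2 := ((hcd.differentiable one_ne_zero) (t, X t (Y t x))).hasFDerivAt.comp_hasDerivAt t h1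
    have h3 : HasDerivAt (fun s => χ s * ψ (Y t x)) (deriv χ t * ψ (Y t x)) t :=
      ((hχ.differentiable one_ne_zero) t).hasDerivAt.mul_const _
    have h4 : ((fun p : ℝ × State d => χ p.1 * ψ (Y p.1 p.2)) ∘ fun s => (s, X s (Y t x)))
        = fun s => χ s * ψ (Y t x) := by
      funext s; simp [hYX]
    rw [h4, hXY] at h2
    exact h2.unique h3

/-- A weak solution of the continuity equation with a regular vector field is transported by the
flow of the field. -/
theorem IsFlow.eq_map_of_weak_solution (hX : IsFlow v X) (hv : IsRegularField v C) (hT : 0 < T)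
    (hprob : ∀ t ∈ Icc 0 T, IsProbabilityMeasure (μ t))
    (hW : ∀ t ∈ Icc 0 T, Tendsto (fun s => wasserstein2 (μ s) (μ t)) (𝓝[Icc 0 T] t) (𝓝 0))
    (hsol : ∀ φ : ℝ × State d → ℝ, ContDiff ℝ 1 φ → HasCompactSupport φ →
      (∫ x, φ (T, x) ∂(μ T)) - (∫ x, φ (0, x) ∂(μ 0))
        - (∫ t in (0 : ℝ)..T, ∫ x, fderiv ℝ φ (t, x) (1, v t x) ∂(μ t)) = 0) :
    ∀ t ∈ Icc 0 T, μ t = (μ 0).map (X t) := by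
  obtain ⟨Y, hYX, hXY, hY⟩ := hX.exists_inverse hv
  have h0T : (0 : ℝ) ∈ Icc 0 T := ⟨le_rfl, hT.le⟩
  have hTT : T ∈ Icc 0 T := ⟨hT.le, le_rfl⟩
  have hYt : ∀ t, Continuous (Y t) := fun t =>
    hY.continuous.comp (continuous_const.prodMk continuous_id)
  have hY0 : ∀ x, Y 0 x = x := fun x => by simpa [hX.zero] using hYX 0 x
  -- A smooth cut-off function in time, equal to `1` near `[0,T]`.
  let θ : ContDiffBump (T / 2) := ⟨T, 2 * T, hT, by linarith⟩
  have hθ : ∀ t ∈ Ioo (-(T / 2)) (3 * T / 2), θ t = 1 := fun t ht =>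
    θ.one_of_mem_closedBall (by
      rw [Metric.mem_closedBall, Real.dist_eq]
      exact abs_le.2 ⟨by change -T ≤ _; linarith [ht.1], by change _ ≤ T; linarith [ht.2]⟩)
  have hIcc : ∀ t ∈ Icc 0 T, t ∈ Ioo (-(T / 2)) (3 * T / 2) := fun t ht =>
    ⟨by linarith [ht.1], by linarith [ht.2]⟩
  suffices H : ∀ ψ : State d → ℝ, ContDiff ℝ 1 ψ → HasCompactSupport ψ → ∀ t ∈ Icc 0 T,
      ∫ x, ψ (Y t x) ∂(μ t) = ∫ x, ψ x ∂(μ 0) by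
    intro t ht
    have := hprob t ht
    have := hprob 0 h0T
    have e : (μ t).map (Y t) = μ 0 := by
      have : IsProbabilityMeasure ((μ t).map (Y t)) :=
        Measure.isProbabilityMeasure_map (hYt t).aemeasurable
      refine measure_eq_of_forall_integral_contDiff fun ψ hψ hψc => ?_
      rw [integral_map (hYt t).aemeasurable hψ.continuous.aestronglyMeasurable]
      exact H ψ hψ hψc t ht
    have hXt : Continuous (X t) :=
      (hX.continuous_uncurry hv).comp (continuous_const.prodMk continuous_id)
    rw [← e, Measure.map_map hXt.measurable (hYt t).measurable]
    have : X t ∘ Y t = id := funext (hXY t)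
    rw [this, Measure.map_id]
  intro ψ hψ hψc
  set a : ℝ → ℝ := fun t => ∫ x, ψ (Y t x) ∂(μ t) with ha
  have hweak : ∀ χ : ℝ → ℝ, ContDiff ℝ 1 χ → HasCompactSupport χ →
      χ T * a T - χ 0 * a 0 - ∫ t in (0 : ℝ)..T, deriv χ t * a t = 0 := fun χ hχ hχc => by
    obtain ⟨h1, h2, h3⟩ := hX.testFunction hv hYX hXY hY hχ hχc hψ hψc
    have := hsol _ h1 h2
    simpa only [h3, integral_const_mul, ha] using this
  have hac : ContinuousOn a (Icc 0 T) := by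
    obtain ⟨h1, h2, -⟩ := hX.testFunction hv hYX hXY hY (χ := θ) θ.contDiff θ.hasCompactSupport
      hψ hψc
    obtain ⟨L, hL⟩ := h1.lipschitzWith_of_hasCompactSupport h2 one_ne_zero
    obtain ⟨B, hB⟩ := hψc.exists_bound_of_continuous hψ.continuous
    intro s hs
    have hprobs := hprob s hs
    have hYs : LipschitzWith L fun x => ψ (Y s x) := by
      refine LipschitzWith.of_dist_le_mul fun x y => ?_
      have := hL.dist_le_mul (s, x) (s, y)
      simpa [hθ s (hIcc s hs), Prod.dist_eq] using this
    rw [ContinuousWithinAt, tendsto_iff_norm_sub_tendsto_zero]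
    have hlim : Tendsto (fun t => L * |t - s| + L * (wasserstein2 (μ t) (μ s)).toReal)
        (𝓝[Icc 0 T] s) (𝓝 0) := by
      have t1 : Tendsto (fun t => (wasserstein2 (μ t) (μ s)).toReal) (𝓝[Icc 0 T] s) (𝓝 0) := by
        simpa [Function.comp_def] using
          (ENNReal.tendsto_toReal ENNReal.zero_ne_top).comp (hW s hs)
      have t2 : Tendsto (fun t => |t - s|) (𝓝[Icc 0 T] s) (𝓝 0) := by
        have : Continuous fun t => |t - s| := by fun_prop
        have := this.tendsto s
        rw [sub_self, abs_zero] at this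
        exact this.mono_left nhdsWithin_le_nhds
      simpa using (t2.const_mul (L : ℝ)).add (t1.const_mul (L : ℝ))
    refine squeeze_zero' (Eventually.of_forall fun _ => norm_nonneg _) ?_ hlim
    filter_upwards [(hW s hs).eventually_lt_const ENNReal.zero_lt_top, self_mem_nhdsWithin]
      with t htW ht
    have hprobt := hprob t ht
    have i1 : Integrable (fun x => ψ (Y t x)) (μ t) :=
      integrable_of_continuous_of_norm_le (hψ.continuous.comp (hYt t)) fun x => hB _
    have i2 : Integrable (fun x => ψ (Y s x)) (μ t) :=
      integrable_of_continuous_of_norm_le (hψ.continuous.comp (hYt s)) fun x => hB _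
    have b1 : ‖∫ x, ψ (Y t x) ∂(μ t) - ∫ x, ψ (Y s x) ∂(μ t)‖ ≤ L * |t - s| := by
      rw [← integral_sub i1 i2]
      refine (norm_integral_le_of_norm_le_const (C := L * |t - s|)
        (Eventually.of_forall fun x => ?_)).trans (by simp)
      have := hL.dist_le_mul (t, x) (s, x)
      simpa [hθ s (hIcc s hs), hθ t (hIcc t ht), Prod.dist_eq, Real.dist_eq] using this
    have b2 : ‖∫ x, ψ (Y s x) ∂(μ t) - ∫ x, ψ (Y s x) ∂(μ s)‖
        ≤ L * (wasserstein2 (μ t) (μ s)).toReal := by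
      have := enorm_integral_sub_le_wasserstein2 (μ := μ t) (ν := μ s) hYs fun x => hB _
      rw [← ofReal_norm, ← ENNReal.ofReal_toReal htW.ne, ← ENNReal.ofReal_coe_nnreal,
        ← ENNReal.ofReal_mul L.coe_nonneg] at this
      exact (ENNReal.ofReal_le_ofReal_iff (by positivity)).1 this
    calc ‖a t - a s‖ = ‖(∫ x, ψ (Y t x) ∂(μ t) - ∫ x, ψ (Y s x) ∂(μ t))
          + (∫ x, ψ (Y s x) ∂(μ t) - ∫ x, ψ (Y s x) ∂(μ s))‖ := by simp [ha]
      _ ≤ _ := (norm_add_le _ _).trans (add_le_add b1 b2)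
  -- Du Bois-Reymond: test with the primitive of `a - a 0` that vanishes at time `T`.
  set f : ℝ → ℝ := fun t => a (projIcc 0 T hT.le t) - a 0 with hf
  have hfc : Continuous f := by
    have : Continuous fun t : Icc 0 T => a t := continuousOn_iff_continuous_domRestrict.1 hac
    exact (this.comp continuous_projIcc).sub continuous_const
  have hfI : ∀ t ∈ Icc 0 T, f t = a t - a 0 := fun t ht => by
    simp [hf, projIcc_of_mem hT.le ht]
  set P : ℝ → ℝ := fun t => ∫ s in T..t, f s with hP
  have hPd : ∀ t, HasDerivAt P (f t) t := fun t => hfc.integral_hasStrictDerivAt T t |>.hasDerivAt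
  have hPc : ContDiff ℝ 1 P := contDiff_one_iff_deriv.2
    ⟨fun t => (hPd t).differentiableAt, by rwa [show deriv P = f from funext fun t => (hPd t).deriv]⟩
  have hχd : ∀ t ∈ Icc 0 T, deriv (fun t => θ t * P t) t = f t := fun t ht => by
    have : (fun t => θ t * P t) =ᶠ[𝓝 t] P := by
      filter_upwards [Ioo_mem_nhds (hIcc t ht).1 (hIcc t ht).2] with s hs
      rw [hθ s hs, one_mul]
    rw [this.deriv_eq, (hPd t).deriv]
  have hkey := hweak (fun t => θ t * P t) (θ.contDiff.mul hPc)
    (θ.hasCompactSupport.mul_right)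
  have hPT : P T = 0 := by simp [hP]
  have hP0 : P 0 = -∫ s in (0 : ℝ)..T, f s := by rw [hP]; exact intervalIntegral.integral_symm 0 T
  have hsq : ∫ t in (0 : ℝ)..T, f t ^ 2 = 0 := by
    have e1 : ∫ t in (0 : ℝ)..T, deriv (fun t => θ t * P t) t * a t
        = ∫ t in (0 : ℝ)..T, (f t ^ 2 + f t * a 0) := by
      refine intervalIntegral.integral_congr fun t ht => ?_
      rw [uIcc_of_le hT.le] at ht
      simp only [hχd t ht]
      rw [show a t = f t + a 0 by rw [hfI t ht]; ring]
      ring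
    have i1 : IntervalIntegrable (fun t => f t ^ 2) volume 0 T := (hfc.pow 2).intervalIntegrable _ _
    have i2 : IntervalIntegrable (fun t => f t * a 0) volume 0 T :=
      (hfc.mul continuous_const).intervalIntegrable _ _
    rw [e1, intervalIntegral.integral_add i1 i2, intervalIntegral.integral_mul_const,
      hθ 0 (hIcc 0 h0T), hPT, hP0] at hkey
    linarith
  have hf0 : ∀ t ∈ Icc 0 T, f t = 0 := by
    by_contra! hne
    obtain ⟨c, hc, hc0⟩ := hne
    have := intervalIntegral.integral_pos hT (hfc.pow 2).continuousOn (fun t _ => sq_nonneg (f t))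
      ⟨c, hc, lt_of_le_of_ne (sq_nonneg (f c)) (pow_ne_zero 2 hc0).symm⟩
    simp only [Pi.pow_apply] at this
    linarith
  intro t ht
  have := hf0 t ht
  rw [hfI t ht, sub_eq_zero] at this
  simpa [ha, hY0] using this

end Uniqueness

/-! ### Existence for the continuity equation -/

section Flows
variable {d : ℕ} {v X : ℝ → State d → State d} {C : ℝ≥0} {μ₀ : Measure (State d)}

/-- The flow of a regular field transports its initial measure to a weak solution of the continuity
equation. -/
theorem IsFlow.weak_solution [IsProbabilityMeasure μ₀] (hX : IsFlow v X) (hv : IsRegularField v C)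
    (T : ℝ) {φ : ℝ × State d → ℝ} (hφ : ContDiff ℝ 1 φ) (hφc : HasCompactSupport φ) :
    (∫ x, φ (T, X T x) ∂μ₀) - (∫ x, φ (0, x) ∂μ₀)
      - (∫ t in (0 : ℝ)..T, ∫ x, fderiv ℝ φ (t, X t x) (1, v t (X t x)) ∂μ₀) = 0 := by
  obtain ⟨B, hB⟩ := hφc.exists_bound_of_continuous hφ.continuous
  obtain ⟨B', hB'⟩ := (hφc.fderiv ℝ).exists_bound_of_continuous (hφ.continuous_fderiv one_ne_zero)
  have hXc := hX.continuous_uncurry hv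
  have hvX : Continuous fun p : ℝ × State d => v p.1 (X p.1 p.2) :=
    hv.continuous_uncurry.comp (continuous_fst.prodMk hXc)
  have hcX : Continuous fun p : ℝ × State d => φ (p.1, X p.1 p.2) :=
    hφ.continuous.comp (continuous_fst.prodMk hXc)
  have hcG : Continuous fun p : ℝ × State d =>
      fderiv ℝ φ (p.1, X p.1 p.2) (1, v p.1 (X p.1 p.2)) :=
    ((hφ.continuous_fderiv one_ne_zero).comp (continuous_fst.prodMk hXc)).clm_apply
      (continuous_const.prodMk hvX)
  have hG : ∀ t x, ‖fderiv ℝ φ (t, X t x) (1, v t (X t x))‖ ≤ B' * max 1 C := fun t x => by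
    refine (ContinuousLinearMap.le_opNorm _ _).trans ?_
    have h0 : 0 ≤ B' := (norm_nonneg _).trans (hB' (t, X t x))
    gcongr
    · exact hB' _
    · rw [Prod.norm_def]
      exact max_le_max (by simp) (hv.norm_le _ _)
  have hs : ∀ {F : ℝ × State d → ℝ}, Continuous F → ∀ t, Continuous fun x => F (t, x) :=
    fun hF t => hF.comp (continuous_const.prodMk continuous_id)
  have hder : ∀ t, HasDerivAt (fun t => ∫ x, φ (t, X t x) ∂μ₀)
      (∫ x, fderiv ℝ φ (t, X t x) (1, v t (X t x)) ∂μ₀) t := fun t => by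
    refine (hasDerivAt_integral_of_dominated_loc_of_deriv_le (F := fun t x => φ (t, X t x))
      (F' := fun t x => fderiv ℝ φ (t, X t x) (1, v t (X t x)))
      (bound := fun _ => B' * max 1 C) univ_mem
      (Eventually.of_forall fun s => (hs hcX s).aestronglyMeasurable)
      (integrable_of_continuous_of_norm_le (hs hcX t) fun x => hB _)
      (hs hcG t).aestronglyMeasurable (Eventually.of_forall fun x s _ => hG s x)
      (integrable_const _) (Eventually.of_forall fun x s _ => ?_)).2
    exact ((hφ.differentiable one_ne_zero) (s, X s x)).hasFDerivAt.comp_hasDerivAt s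
      ((hasDerivAt_id s).prodMk (hX.hasDerivAt x s))
  have hc : Continuous fun t => ∫ x, fderiv ℝ φ (t, X t x) (1, v t (X t x)) ∂μ₀ :=
    continuous_of_dominated (bound := fun _ => B' * max 1 C)
      (fun t => (hs hcG t).aestronglyMeasurable) (fun t => Eventually.of_forall (hG t))
      (integrable_const _)
      (Eventually.of_forall fun x => hcG.comp (continuous_id.prodMk continuous_const))
  rw [intervalIntegral.integral_eq_sub_of_hasDerivAt (fun t _ => hder t) (hc.intervalIntegrable _ _)]
  simp [hX.zero]

end Flows

/-! ### The displacement of the particles -/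

section Lagrangian
variable {d M : ℕ}

/-- The displacement field `x ↦ v(ν, c)(x + Z x)`, as a bounded continuous function. (The default
value `0` is not used when the kernels are bounded and Lipschitz.) -/
noncomputable def displacementField (K₁ K₂ : State d → State d) (ν : Measure (State d))
    (c : ControlValue d M) (Z : State d →ᵇ State d) : State d →ᵇ State d :=
  open Classical in
  if h : (Continuous fun x => velocity K₁ K₂ ν c (x + Z x)) ∧
      ∃ B, ∀ x, ‖velocity K₁ K₂ ν c (x + Z x)‖ ≤ B then
    BoundedContinuousFunction.ofNormedAddCommGroup _ h.1 h.2.choose h.2.choose_spec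
  else 0

/-- The image of `μ₀` under the map `x ↦ x + Z x`. -/
noncomputable def displaced (μ₀ : Measure (State d)) (Z : State d →ᵇ State d) :
    Measure (State d) :=
  μ₀.map fun x => x + Z x

variable {K₁ K₂ : State d → State d} {C : ℝ≥0} {μ₀ : Measure (State d)}
  [IsProbabilityMeasure μ₀]

theorem continuous_id_add (Z : State d →ᵇ State d) : Continuous fun x => x + Z x :=
  continuous_id.add Z.continuous

instance (Z : State d →ᵇ State d) : IsProbabilityMeasure (displaced μ₀ Z) :=
  Measure.isProbabilityMeasure_map (continuous_id_add Z).aemeasurable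

theorem wasserstein2_displaced_le (Z Z' : State d →ᵇ State d) :
    wasserstein2 (displaced μ₀ Z) (displaced μ₀ Z') ≤ ENNReal.ofReal ‖Z - Z'‖ :=
  wasserstein2_map_le (continuous_id_add Z).measurable (continuous_id_add Z').measurable
    fun x => by simpa using (Z - Z').norm_coe_le_norm x

theorem tendsto_wasserstein2_displaced {α : Type*} {l : Filter α} {Z : α → State d →ᵇ State d}
    {Z' : State d →ᵇ State d} (h : Tendsto Z l (𝓝 Z')) :
    Tendsto (fun a => wasserstein2 (displaced μ₀ (Z a)) (displaced μ₀ Z')) l (𝓝 0) := by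
  refine tendsto_of_tendsto_of_tendsto_of_le_of_le tendsto_const_nhds ?_ (fun _ => bot_le)
    fun a => wasserstein2_displaced_le (Z a) Z'
  simpa using ENNReal.tendsto_ofReal (tendsto_iff_norm_sub_tendsto_zero.1 h)

theorem memP2_iff {μ : Measure (State d)} :
    MemP2 μ ↔ IsProbabilityMeasure μ ∧ MemLp id 2 μ := by
  refine and_congr_right fun _ => ?_
  rw [MemLp, and_iff_right continuous_id.aestronglyMeasurable,
    eLpNorm_lt_top_iff_lintegral_rpow_enorm_lt_top two_ne_zero ENNReal.ofNat_ne_top]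
  simp

theorem MemP2.displaced {ν : Measure (State d)} (hν : MemP2 ν) (Z : State d →ᵇ State d) :
    MemP2 (displaced ν Z) := by
  obtain ⟨hp, h2⟩ := memP2_iff.1 hν
  refine memP2_iff.2 ⟨inferInstance, ?_⟩
  rw [MeanFieldControl.displaced, memLp_map_measure_iff continuous_id.aestronglyMeasurable
    (continuous_id_add Z).aemeasurable]
  exact h2.add (MemLp.of_bound Z.continuous.aestronglyMeasurable ‖Z‖
    (Eventually.of_forall Z.norm_coe_le_norm))

variable {ν ν' : Measure (State d)} [IsProbabilityMeasure ν] [IsProbabilityMeasure ν']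

theorem lipschitzWith_velocity (h₁ : IsKernel K₁ C) (h₂ : IsKernel K₂ C) (c : ControlValue d M) :
    LipschitzWith (C * (M + 1)) (velocity K₁ K₂ ν c) :=
  lipschitzWith_of_nnnorm_fderiv_le (𝕜 := ℝ)
    (fun x => (hasFDerivAt_velocity h₁ h₂ c x).differentiableAt)
    fun x => by exact_mod_cast norm_fderiv_velocity_le h₁ h₂ c x

theorem displacementField_apply (h₁ : IsKernel K₁ C) (h₂ : IsKernel K₂ C) (c : ControlValue d M)
    (Z : State d →ᵇ State d) (x : State d) :
    displacementField K₁ K₂ ν c Z x = velocity K₁ K₂ ν c (x + Z x) := by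
  rw [displacementField, dif_pos]
  · rfl
  · exact ⟨(lipschitzWith_velocity h₁ h₂ c).continuous.comp (continuous_id_add Z), _,
      fun x => norm_velocity_le h₁ h₂ c _⟩

theorem norm_displacementField_sub_le (h₁ : IsKernel K₁ C) (h₂ : IsKernel K₂ C)
    (c c' : ControlValue d M) (Z Z' : State d →ᵇ State d) {r : ℝ} (hr : 0 ≤ r)
    (hW : wasserstein2 ν ν' ≤ ENNReal.ofReal r) :
    ‖displacementField K₁ K₂ ν c Z - displacementField K₁ K₂ ν' c' Z'‖
      ≤ C * r + C * (M + 1) * (‖Z - Z'‖ + ‖c - c'‖) := by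
  refine (BoundedContinuousFunction.norm_le (by positivity)).2 fun x => ?_
  rw [BoundedContinuousFunction.sub_apply, displacementField_apply h₁ h₂,
    displacementField_apply h₁ h₂]
  refine (norm_velocity_sub_le h₁ h₂ c c' _ _ hr hW).trans ?_
  gcongr
  simpa using (Z - Z').norm_coe_le_norm x

theorem lipschitzWith_displacementField (h₁ : IsKernel K₁ C) (h₂ : IsKernel K₂ C)
    (c : ControlValue d M) : LipschitzWith (C * (M + 1)) (displacementField K₁ K₂ ν c) := by
  refine LipschitzWith.of_dist_le_mul fun Z Z' => ?_
  rw [dist_eq_norm, dist_eq_norm]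
  have := norm_displacementField_sub_le (ν := ν) (ν' := ν) h₁ h₂ c c Z Z' le_rfl
    (by rw [wasserstein2_self]; simp)
  simpa using this

theorem continuous_displacementField (h₁ : IsKernel K₁ C) (h₂ : IsKernel K₂ C)
    {m : ℝ → Measure (State d)} (hm : ∀ t, IsProbabilityMeasure (m t))
    (hmc : ∀ t, Tendsto (fun s => wasserstein2 (m s) (m t)) (𝓝 t) (𝓝 0))
    {w : ℝ → ControlValue d M} (hw : Continuous w) (Z : State d →ᵇ State d) :
    Continuous fun t => displacementField K₁ K₂ (m t) (w t) Z := by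
  refine continuous_iff_continuousAt.2 fun t => ?_
  rw [ContinuousAt, tendsto_iff_norm_sub_tendsto_zero]
  have h1 : Tendsto (fun s => (wasserstein2 (m s) (m t)).toReal) (𝓝 t) (𝓝 0) := by
    simpa [Function.comp_def] using (ENNReal.tendsto_toReal ENNReal.zero_ne_top).comp (hmc t)
  have h2 : Tendsto (fun s => ‖w s - w t‖) (𝓝 t) (𝓝 0) :=
    tendsto_iff_norm_sub_tendsto_zero.1 (hw.tendsto t)
  have hlim : Tendsto (fun s => C * (wasserstein2 (m s) (m t)).toReal
      + C * (M + 1) * (‖Z - Z‖ + ‖w s - w t‖)) (𝓝 t) (𝓝 0) := by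
    simpa using (h1.const_mul (C : ℝ)).add ((h2.const_add 0).const_mul (C * (M + 1 : ℝ)))
  refine squeeze_zero' (Eventually.of_forall fun _ => norm_nonneg _) ?_ hlim
  filter_upwards [(hmc t).eventually_lt_const ENNReal.zero_lt_top] with s hs
  exact norm_displacementField_sub_le h₁ h₂ _ _ _ _ ENNReal.toReal_nonneg
    (ENNReal.ofReal_toReal hs.ne).ge

/-- The displacement `Z t x = X t x - x` of the particles starting at `x` and moving with the
velocity field generated by the control `w` and by the law of all particles, distributed initially
according to `μ₀`. -/
structure IsDisplacement (K₁ K₂ : State d → State d) (μ₀ : Measure (State d))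
    (w : ℝ → ControlValue d M) (Z : ℝ → State d →ᵇ State d) : Prop where
  zero : Z 0 = 0
  hasDerivAt : ∀ t,
    HasDerivAt Z (displacementField K₁ K₂ (displaced μ₀ (Z t)) (w t) (Z t)) t

theorem norm_displacementField_displaced_sub_le (h₁ : IsKernel K₁ C) (h₂ : IsKernel K₂ C)
    (c c' : ControlValue d M) (Z Z' : State d →ᵇ State d) :
    ‖displacementField K₁ K₂ (displaced μ₀ Z) c Z - displacementField K₁ K₂ (displaced μ₀ Z') c' Z'‖
      ≤ C * (M + 2) * ‖Z - Z'‖ + C * (M + 1) * ‖c - c'‖ := by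
  refine (norm_displacementField_sub_le h₁ h₂ c c' Z Z' (norm_nonneg _)
    (wasserstein2_displaced_le Z Z')).trans (le_of_eq ?_)
  ring

theorem lipschitzWith_displacementField_displaced (h₁ : IsKernel K₁ C) (h₂ : IsKernel K₂ C)
    (c : ControlValue d M) : LipschitzWith (C * (M + 2))
      fun Z => displacementField K₁ K₂ (displaced μ₀ Z) c Z := by
  refine LipschitzWith.of_dist_le_mul fun Z Z' => ?_
  rw [dist_eq_norm, dist_eq_norm]
  simpa using norm_displacementField_displaced_sub_le h₁ h₂ c c Z Z'

variable (μ₀) in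
theorem exists_isDisplacement (h₁ : IsKernel K₁ C) (h₂ : IsKernel K₂ C)
    {w : ℝ → ControlValue d M} (hw : Continuous w) : ∃ Z, IsDisplacement K₁ K₂ μ₀ w Z := by
  obtain ⟨Z, h0, hZ⟩ := exists_hasDerivAt_of_lipschitz
    (F := fun t Z => displacementField K₁ K₂ (displaced μ₀ Z) (w t) Z) (fun Z =>
      continuous_displacementField h₁ h₂ (m := fun _ => displaced μ₀ Z) (fun _ => inferInstance)
        (fun _ => by simp [wasserstein2_self]) hw Z)
    (fun t => lipschitzWith_displacementField_displaced h₁ h₂ (w t)) 0 0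
  exact ⟨Z, h0, hZ⟩

namespace IsDisplacement
variable {w w' : ℝ → ControlValue d M} {Z Z' : ℝ → State d →ᵇ State d}

theorem continuous {ν₀ : Measure (State d)} (hZ : IsDisplacement K₁ K₂ ν₀ w Z) : Continuous Z :=
  continuous_iff_continuousAt.2 fun t => (hZ.hasDerivAt t).continuousAt

theorem isRegularField (hZ : IsDisplacement K₁ K₂ μ₀ w Z) (h₁ : IsKernel K₁ C)
    (h₂ : IsKernel K₂ C) (hw : Continuous w) :
    IsRegularField (fun t => velocity K₁ K₂ (displaced μ₀ (Z t)) (w t)) (C * (M + 1)) :=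
  isRegularField_velocity h₁ h₂ (fun _ => inferInstance)
    (fun t => tendsto_wasserstein2_displaced (hZ.continuous.tendsto t)) hw

theorem isFlow (hZ : IsDisplacement K₁ K₂ μ₀ w Z) (h₁ : IsKernel K₁ C) (h₂ : IsKernel K₂ C) :
    IsFlow (fun t => velocity K₁ K₂ (displaced μ₀ (Z t)) (w t)) (fun t x => x + Z t x) := by
  refine ⟨fun x => by simp [hZ.zero], fun x t => ?_⟩
  have := ((BoundedContinuousFunction.evalCLM ℝ x).hasFDerivAt.comp_hasDerivAt t
    (hZ.hasDerivAt t)).const_add x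
  simpa [Function.comp_def, displacementField_apply h₁ h₂] using this

/-- The displacement depends on the control in a Lipschitz way. -/
theorem norm_sub_le (hZ : IsDisplacement K₁ K₂ μ₀ w Z) (hZ' : IsDisplacement K₁ K₂ μ₀ w' Z')
    (h₁ : IsKernel K₁ C) (h₂ : IsKernel K₂ C) {ε : ℝ} (hε : ∀ t, ‖w t - w' t‖ ≤ ε) (t : ℝ) :
    ‖Z t - Z' t‖ ≤ ε * gronwallBound 0 (C * (M + 2)) (C * (M + 1)) |t| := by
  have := norm_le_gronwallBound_abs (f := fun t => Z t - Z' t) (K := C * (M + 2))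
    (ε := ε * (C * (M + 1))) (t₀ := 0) (t := t) (fun t => (hZ.hasDerivAt t).sub (hZ'.hasDerivAt t))
    (fun s _ => (norm_displacementField_displaced_sub_le h₁ h₂ _ _ _ _).trans (by
      rw [mul_comm ε]; gcongr; exact hε s))
  rw [← gronwallBound_mul]
  simpa [hZ.zero, hZ'.zero] using this

end IsDisplacement

end Lagrangian

/-! ### Admissible pairs in Lagrangian coordinates -/

section Admissible
variable {d M : ℕ} {T : ℝ}

/-- The projection of the real line onto `[0,T]`. -/
def clamp (T t : ℝ) : ℝ := max 0 (min T t)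

theorem clamp_mem (hT : 0 ≤ T) (t : ℝ) : clamp T t ∈ Icc 0 T :=
  ⟨le_max_left _ _, max_le hT (min_le_left _ _)⟩

theorem clamp_of_mem {t : ℝ} (ht : t ∈ Icc 0 T) : clamp T t = t := by
  simp [clamp, ht.1, ht.2]

theorem continuous_clamp : Continuous (clamp T) := by
  unfold clamp; fun_prop

theorem H1Control.integrableOn (u : H1Control T d M) : IntegrableOn u.2 (Ioc 0 T) :=
  (Lp.memLp u.2).integrable one_le_two

theorem H1Control.intervalIntegrable (u : H1Control T d M) {t : ℝ} (ht : t ∈ Icc 0 T) :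
    IntervalIntegrable u.2 volume 0 t := by
  rw [intervalIntegrable_iff_integrableOn_Ioc_of_le ht.1]
  exact u.integrableOn.mono_set (Ioc_subset_Ioc_right ht.2)

theorem H1Control.continuousOn_eval (hT : 0 ≤ T) (u : H1Control T d M) :
    ContinuousOn u.eval (Icc 0 T) := by
  have := intervalIntegral.continuousOn_primitive_interval (a := 0) (b := T) (f := u.2)
    (μ := volume) (by
      rw [uIcc_of_le hT, integrableOn_Icc_iff_integrableOn_Ioc]; exact u.integrableOn)
  rw [uIcc_of_le hT] at this
  exact continuousOn_const.add this

theorem H1Control.eval_zero (u : H1Control T d M) : u.eval 0 = u.1 := by simp [H1Control.eval]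

/-- The control `u`, extended continuously to all times by its boundary values. -/
noncomputable def H1Control.extend (u : H1Control T d M) (t : ℝ) : ControlValue d M :=
  u.eval (clamp T t)

theorem H1Control.continuous_extend (hT : 0 ≤ T) (u : H1Control T d M) : Continuous u.extend :=
  (u.continuousOn_eval hT).comp_continuous continuous_clamp (clamp_mem hT)

theorem H1Control.extend_of_mem (u : H1Control T d M) {t : ℝ} (ht : t ∈ Icc 0 T) :
    u.extend t = u.eval t := by rw [H1Control.extend, clamp_of_mem ht]

theorem H1Control.eval_add_smul (u h : H1Control T d M) (ε : ℝ) {t : ℝ} (ht : t ∈ Icc 0 T) :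
    (u + ε • h).eval t = u.eval t + ε • h.eval t := by
  have e : ∫ s in (0 : ℝ)..t, (u + ε • h).2 s = ∫ s in (0 : ℝ)..t, (u.2 s + ε • h.2 s) := by
    rw [intervalIntegral.integral_of_le ht.1, intervalIntegral.integral_of_le ht.1]
    refine integral_congr_ae ?_
    have h1 : (u + ε • h).2 =ᵐ[volume.restrict (Ioc 0 T)] fun s => u.2 s + ε • h.2 s := by
      filter_upwards [Lp.coeFn_add u.2 (ε • h.2), Lp.coeFn_smul ε h.2] with s hs1 hs2
      simp only [Prod.snd_add, Prod.smul_snd, hs1, Pi.add_apply, hs2, Pi.smul_apply]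
    exact ae_mono (Measure.restrict_mono (Ioc_subset_Ioc_right ht.2) le_rfl) h1
  have i2 : IntervalIntegrable (fun s => ε • h.2 s) volume 0 t := (h.intervalIntegrable ht).smul ε
  rw [H1Control.eval, e, intervalIntegral.integral_add (u.intervalIntegrable ht) i2,
    intervalIntegral.integral_smul]
  simp only [H1Control.eval, Prod.fst_add, Prod.smul_fst, smul_add]
  abel

variable {K₁ K₂ : State d → State d} {C : ℝ≥0} {μ₀ : Measure (State d)}
  {Z : ℝ → State d →ᵇ State d} {u : H1Control T d M}

/-- The law of the particles driven by the control `u` is a weak solution of the nonlinear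
continuity equation. -/
theorem IsDisplacement.admissible (hZ : IsDisplacement K₁ K₂ μ₀ u.extend Z) (hT : 0 < T)
    (h₁ : IsKernel K₁ C) (h₂ : IsKernel K₂ C) (hμ₀ : MemP2 μ₀) {u₀ : ControlValue d M}
    (hu : u.eval 0 = u₀) : Admissible T K₁ K₂ μ₀ u₀ (fun t => displaced μ₀ (Z t)) u := by
  have := hμ₀.1
  refine ⟨⟨fun t _ => hμ₀.displaced _, fun t _ => tendsto_wasserstein2_displaced
    ((hZ.continuous.tendsto t).mono_left nhdsWithin_le_nhds)⟩, ?_, hu, fun φ hφ hφc => ?_⟩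
  · simp [hZ.zero, displaced]
  · have hv := hZ.isRegularField h₁ h₂ (u.continuous_extend hT.le)
    have key := (hZ.isFlow h₁ h₂).weak_solution (μ₀ := μ₀) hv T hφ hφc
    have hm : ∀ t, AEMeasurable (fun x => x + Z t x) μ₀ :=
      fun t => (continuous_id_add (Z t)).aemeasurable
    refine Eq.trans ?_ key
    congr 1
    · congr 1
      exact integral_map (hm T)
        (hφ.continuous.comp (continuous_const.prodMk continuous_id)).aestronglyMeasurable
    · refine intervalIntegral.integral_congr fun t ht => ?_
      rw [uIcc_of_le hT.le] at ht
      simp only [← u.extend_of_mem ht]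
      refine integral_map (hm t) (Continuous.aestronglyMeasurable ?_)
      exact ((hφ.continuous_fderiv one_ne_zero).comp
        (continuous_const.prodMk continuous_id)).clm_apply (continuous_const.prodMk
        (lipschitzWith_velocity h₁ h₂ (u.extend t)).continuous)

/-- The measures of an admissible pair are the laws of the particles driven by the control. -/
theorem IsDisplacement.eq_displaced (hZ : IsDisplacement K₁ K₂ μ₀ u.extend Z) (hT : 0 < T)
    (h₁ : IsKernel K₁ C) (h₂ : IsKernel K₂ C) {u₀ : ControlValue d M}
    {μ : ℝ → Measure (State d)} (hμ : Admissible T K₁ K₂ μ₀ u₀ μ u) :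
    ∀ t ∈ Icc 0 T, μ t = displaced μ₀ (Z t) := by
  obtain ⟨⟨hP, hWc⟩, h0, -, hsol⟩ := hμ
  have h0T : (0 : ℝ) ∈ Icc 0 T := ⟨le_rfl, hT.le⟩
  have hprob : ∀ t, IsProbabilityMeasure (μ (clamp T t)) := fun t => (hP _ (clamp_mem hT.le t)).1
  have hμ₀ : IsProbabilityMeasure μ₀ := h0 ▸ (hP 0 h0T).1
  have hWc' : ∀ t, Tendsto (fun s => wasserstein2 (μ (clamp T s)) (μ (clamp T t))) (𝓝 t) (𝓝 0) :=
    fun t => (hWc _ (clamp_mem hT.le t)).comp (tendsto_nhdsWithin_iff.2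
      ⟨continuous_clamp.tendsto t, Eventually.of_forall (clamp_mem hT.le)⟩)
  have hw := u.continuous_extend hT.le
  have hv := isRegularField_velocity h₁ h₂ hprob hWc' hw
  -- The displacement of the flow of the given velocity field.
  obtain ⟨Z', hZ0, hZ'⟩ := exists_hasDerivAt_of_lipschitz
    (F := fun t Z => displacementField K₁ K₂ (μ (clamp T t)) (u.extend t) Z)
    (continuous_displacementField h₁ h₂ hprob hWc' hw)
    (fun t => lipschitzWith_displacementField h₁ h₂ (u.extend t)) 0 0
  have hX : IsFlow (fun t => velocity K₁ K₂ (μ (clamp T t)) (u.extend t))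
      (fun t x => x + Z' t x) := by
    refine ⟨fun x => by simp [hZ0], fun x t => ?_⟩
    have := ((BoundedContinuousFunction.evalCLM ℝ x).hasFDerivAt.comp_hasDerivAt t
      (hZ' t)).const_add x
    simpa [Function.comp_def, displacementField_apply h₁ h₂] using this
  have hμZ' : ∀ t ∈ Icc 0 T, μ t = displaced μ₀ (Z' t) := by
    have := hX.eq_map_of_weak_solution hv hT (fun t ht => (hP t ht).1) hWc (fun φ hφ hφc => by
      rw [h0]
      refine Eq.trans ?_ (hsol φ hφ hφc)
      congr 1
      refine intervalIntegral.integral_congr fun t ht => ?_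
      rw [uIcc_of_le hT.le] at ht
      simp only [clamp_of_mem ht, u.extend_of_mem ht])
    rwa [h0] at this
  -- Hence that displacement solves the nonlocal equation, whose solution is unique.
  have heq : EqOn Z' Z (Icc 0 T) := by
    refine ODE_solution_unique (E := State d →ᵇ State d)
      (v := fun t Z => displacementField K₁ K₂ (displaced μ₀ Z) (u.extend t) Z)
      (fun t => lipschitzWith_displacementField_displaced h₁ h₂ (u.extend t))
      (fun t _ => (hZ' t).continuousAt.continuousWithinAt) (fun t ht => ?_)
      hZ.continuous.continuousOn (fun t _ => (hZ.hasDerivAt t).hasDerivWithinAt)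
      (by rw [hZ0, hZ.zero])
    have ht' := Ico_subset_Icc_self ht
    have := (hZ' t).hasDerivWithinAt (s := Ici t)
    rwa [clamp_of_mem ht', hμZ' t ht'] at this
  intro t ht
  rw [hμZ' t ht, heq ht]

end Admissible

/-! ### Convergence and differentiability in `L²` -/

section SquareIntegrable
variable {α E : Type*} [MeasurableSpace α] {μ : Measure α} [NormedAddCommGroup E]

theorem Lp_norm_le_of_ae_le [IsProbabilityMeasure μ] {f g : Lp E 2 μ} {a b : ℝ} (ha : 0 ≤ a)
    (hb : 0 ≤ b) (h : ∀ᵐ x ∂μ, ‖f x‖ ≤ a * ‖g x‖ + b) : ‖f‖ ≤ a * ‖g‖ + b := by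
  have h1 : eLpNorm f 2 μ ≤ eLpNorm (fun x => a * ‖g x‖ + b) 2 μ :=
    eLpNorm_mono_ae_real h
  have hm : AEStronglyMeasurable (fun x => ‖g x‖) μ := (Lp.aestronglyMeasurable g).norm
  have h2 : eLpNorm (fun x => a * ‖g x‖ + b) 2 μ
      ≤ ENNReal.ofReal a * eLpNorm g 2 μ + ENNReal.ofReal b := by
    refine (eLpNorm_add_le (hm.const_mul a) aestronglyMeasurable_const (by norm_num)).trans ?_
    refine add_le_add (le_of_eq ?_) (le_of_eq ?_)
    · have := eLpNorm_const_smul a (fun x => ‖g x‖) 2 μ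
      rw [eLpNorm_norm] at this
      rw [← Real.enorm_of_nonneg ha, ← this]
      rfl
    · rw [eLpNorm_const _ two_ne_zero (IsProbabilityMeasure.ne_zero μ)]
      simp [Real.enorm_of_nonneg hb]
  have h3 := ENNReal.toReal_mono (by finiteness [Lp.eLpNorm_ne_top g]) (h1.trans h2)
  rwa [ENNReal.toReal_add (by finiteness [Lp.eLpNorm_ne_top g]) (by finiteness),
    ENNReal.toReal_mul, ENNReal.toReal_ofReal ha, ENNReal.toReal_ofReal hb] at h3

theorem Lp_integral_norm_le [IsProbabilityMeasure μ] (f : Lp E 2 μ) : ∫ x, ‖f x‖ ∂μ ≤ ‖f‖ := by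
  rw [integral_norm_eq_lintegral_enorm (Lp.aestronglyMeasurable f), ← eLpNorm_one_eq_lintegral_enorm]
  exact ENNReal.toReal_mono (Lp.eLpNorm_ne_top f)
    (eLpNorm_le_eLpNorm_of_exponent_le one_le_two (Lp.aestronglyMeasurable f))

theorem Lp_integrable [IsFiniteMeasure μ] (f : Lp E 2 μ) : Integrable f μ :=
  (Lp.memLp f).integrable one_le_two

variable [InnerProductSpace ℝ E]

/-- Dominated convergence in `L²`. -/
theorem Lp_tendsto_of_dominated {ι : Type*} {l : Filter ι} [l.IsCountablyGenerated]
    {F : ι → Lp E 2 μ} {G : Lp E 2 μ} {f : ι → α → E} {g : α → E} (hF : ∀ i, F i =ᵐ[μ] f i)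
    (hG : G =ᵐ[μ] g) {b : α → ℝ} (hb : MemLp b 2 μ) (hfb : ∀ᶠ i in l, ∀ x, ‖f i x‖ ≤ b x)
    (hgb : ∀ x, ‖g x‖ ≤ b x) (hlim : ∀ x, Tendsto (fun i => f i x) l (𝓝 (g x))) :
    Tendsto F l (𝓝 G) := by
  rw [tendsto_iff_norm_sub_tendsto_zero]
  have hsq : Tendsto (fun i => ‖F i - G‖ ^ 2) l (𝓝 0) := by
    have e : ∀ i, ‖F i - G‖ ^ 2 = ∫ x, ‖f i x - g x‖ ^ 2 ∂μ := fun i => by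
      rw [← real_inner_self_eq_norm_sq, L2.inner_def]
      refine integral_congr_ae ?_
      filter_upwards [Lp.coeFn_sub (F i) G, hF i, hG] with x h1 h2 h3
      rw [real_inner_self_eq_norm_sq, h1, Pi.sub_apply, h2, h3]
    simp only [e]
    have := tendsto_integral_filter_of_dominated_convergence (μ := μ) (l := l)
      (F := fun i x => ‖f i x - g x‖ ^ 2) (f := fun _ => (0 : ℝ)) (fun x => (2 * b x) ^ 2)
      (Eventually.of_forall fun i => ?_) ?_ (hb.const_mul 2).integrable_sq
      (Eventually.of_forall fun x => ?_)
    · simpa using this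
    · refine AEStronglyMeasurable.pow (AEStronglyMeasurable.norm ?_) 2
      exact ((Lp.aestronglyMeasurable (F i)).congr (hF i)).sub
        ((Lp.aestronglyMeasurable G).congr hG)
    · filter_upwards [hfb] with i hi
      refine Eventually.of_forall fun x => ?_
      rw [Real.norm_of_nonneg (by positivity)]
      have := (norm_sub_le (f i x) (g x)).trans (add_le_add (hi x) (hgb x))
      gcongr
      linarith
    · have := ((hlim x).sub_const (g x)).norm.pow 2
      simpa using this
  have := hsq.sqrt
  simpa [Real.sqrt_sq (norm_nonneg _)] using this

/-- A family of square integrable functions, differentiable pointwise with a dominated derivative,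
is differentiable in `L²`. -/
theorem Lp_hasDerivAt_of_dominated {F F' : ℝ → Lp E 2 μ} {f f' : ℝ → α → E}
    (hF : ∀ t, F t =ᵐ[μ] f t) (hF' : ∀ t, F' t =ᵐ[μ] f' t) {b : α → ℝ} (hb : MemLp b 2 μ)
    (hfb : ∀ t x, ‖f' t x‖ ≤ b x) (hd : ∀ t x, HasDerivAt (fun t => f t x) (f' t x) t) (t : ℝ) :
    HasDerivAt F (F' t) t := by
  rw [hasDerivAt_iff_tendsto_slope]
  refine Lp_tendsto_of_dominated (f := fun s x => slope (fun t => f t x) t s) (g := f' t)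
    (fun s => ?_) (hF' t) hb (Eventually.of_forall fun s x => ?_) (hfb t)
    fun x => hasDerivAt_iff_tendsto_slope.1 (hd t x)
  · rw [slope_def_module]
    filter_upwards [Lp.coeFn_smul (s - t)⁻¹ (F s - F t), Lp.coeFn_sub (F s) (F t), hF s, hF t]
      with x h1 h2 h3 h4
    rw [h1, Pi.smul_apply, h2, Pi.sub_apply, h3, h4, slope_def_module]
  · have := convex_univ.norm_image_sub_le_of_norm_hasDerivWithin_le (f := fun t => f t x)
      (fun r _ => (hd r x).hasDerivWithinAt) (fun r _ => hfb r x) (mem_univ t) (mem_univ s)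
    rw [slope_def_module, norm_smul, norm_inv]
    rcases eq_or_ne s t with rfl | hst
    · simpa using (norm_nonneg _).trans (hfb s x)
    · have hpos : 0 < ‖s - t‖ := norm_pos_iff.2 (sub_ne_zero.2 hst)
      rw [inv_mul_le_iff₀ hpos]
      linarith

end SquareIntegrable

/-! ### Integral operators on `L²` -/

section Operators
variable {α E : Type*} [MeasurableSpace α] {μ : Measure α} [IsProbabilityMeasure μ]
  [NormedAddCommGroup E] [NormedSpace ℝ E]

theorem norm_integral_clm_apply_le {k : α → E →L[ℝ] E} {C : ℝ} (h0 : 0 ≤ C)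
    (hC : ∀ y, ‖k y‖ ≤ C) (ψ : Lp E 2 μ) : ‖∫ y, k y (ψ y) ∂μ‖ ≤ C * ‖ψ‖ :=
  calc ‖∫ y, k y (ψ y) ∂μ‖ ≤ ∫ y, C * ‖ψ y‖ ∂μ :=
        norm_integral_le_of_norm_le ((Lp_integrable ψ).norm.const_mul C)
          (Eventually.of_forall fun y => (k y).le_of_opNorm_le (hC y) _)
    _ = C * ∫ y, ‖ψ y‖ ∂μ := integral_const_mul _ _
    _ ≤ C * ‖ψ‖ := mul_le_mul_of_nonneg_left (Lp_integral_norm_le ψ) h0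

variable [TopologicalSpace α] [BorelSpace α] [SecondCountableTopology α]

theorem aestronglyMeasurable_clm_apply {ν : Measure α} {k : α → E →L[ℝ] E} (hk : Continuous k)
    (ψ : Lp E 2 ν) : AEStronglyMeasurable (fun y => k y (ψ y)) ν :=
  isBoundedBilinearMap_apply.continuous.comp_aestronglyMeasurable
    ((hk.aestronglyMeasurable).prodMk (Lp.aestronglyMeasurable ψ))

theorem integrable_clm_apply {k : α → E →L[ℝ] E} (hk : Continuous k) {C : ℝ}
    (hC : ∀ y, ‖k y‖ ≤ C) (ψ : Lp E 2 μ) : Integrable (fun y => k y (ψ y)) μ :=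
  ((Lp_integrable ψ).norm.const_mul C).mono' (aestronglyMeasurable_clm_apply hk ψ)
    (Eventually.of_forall fun y => (k y).le_of_opNorm_le (hC y) _)

/-- The sum of a bounded multiplication operator and an integral operator with bounded kernel, on
`L²` of a probability measure. -/
theorem exists_operator {A : α → E →L[ℝ] E} {k : α → α → E →L[ℝ] E} (hA : Continuous A)
    (hk : ∀ y, Continuous fun x => k x y) (hk' : ∀ x, Continuous (k x)) {a c : ℝ} (ha0 : 0 ≤ a)
    (hc0 : 0 ≤ c) (ha : ∀ x, ‖A x‖ ≤ a) (hc : ∀ x y, ‖k x y‖ ≤ c) :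
    ∃ B : Lp E 2 μ →L[ℝ] Lp E 2 μ,
      ∀ ψ, B ψ =ᵐ[μ] fun x => A x (ψ x) + ∫ y, k x y (ψ y) ∂μ := by
  have hmem : ∀ ψ : Lp E 2 μ, MemLp (fun x => A x (ψ x) + ∫ y, k x y (ψ y) ∂μ) 2 μ := fun ψ => by
    refine MemLp.add ((Lp.memLp ψ).of_le_mul (c := a) (aestronglyMeasurable_clm_apply hA ψ)
      (Eventually.of_forall fun x => (A x).le_of_opNorm_le (ha x) _)) (MemLp.of_bound
      (C := c * ‖ψ‖) ?_ (Eventually.of_forall fun x => norm_integral_clm_apply_le hc0 (hc x) ψ))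
    refine (continuous_of_dominated (fun x => aestronglyMeasurable_clm_apply (hk' x) ψ)
      (fun x => Eventually.of_forall fun y => (k x y).le_of_opNorm_le (hc x y) _)
      ((Lp_integrable ψ).norm.const_mul c)
      (Eventually.of_forall fun y => (hk y).clm_apply continuous_const)).aestronglyMeasurable
  have hae : ∀ ψ, ((hmem ψ).toLp : Lp E 2 μ) =ᵐ[μ] fun x => A x (ψ x) + ∫ y, k x y (ψ y) ∂μ :=
    fun ψ => (hmem ψ).coeFn_toLp
  let B : Lp E 2 μ →ₗ[ℝ] Lp E 2 μ :=
    { toFun := fun ψ => (hmem ψ).toLp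
      map_add' := fun ψ ψ' => Lp.ext (by
        have hi : ∀ᵐ y ∂μ, (ψ + ψ' : Lp E 2 μ) y = ψ y + ψ' y := Lp.coeFn_add ψ ψ'
        filter_upwards [hae (ψ + ψ'), hae ψ, hae ψ', Lp.coeFn_add ((hmem ψ).toLp) ((hmem ψ').toLp),
          hi] with x h1 h2 h3 h4 h5
        have e : ∫ y, k x y ((ψ + ψ' : Lp E 2 μ) y) ∂μ
            = ∫ y, k x y (ψ y) ∂μ + ∫ y, k x y (ψ' y) ∂μ := by
          rw [← integral_add (integrable_clm_apply (hk' x) (hc x) ψ)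
            (integrable_clm_apply (hk' x) (hc x) ψ')]
          refine integral_congr_ae ?_
          filter_upwards [hi] with y hy
          rw [hy, map_add]
        rw [h1, h4, Pi.add_apply, h2, h3, h5, e, map_add]
        abel)
      map_smul' := fun r ψ => Lp.ext (by
        have hi : ∀ᵐ y ∂μ, (r • ψ : Lp E 2 μ) y = r • ψ y := Lp.coeFn_smul r ψ
        filter_upwards [hae (r • ψ), hae ψ, Lp.coeFn_smul r ((hmem ψ).toLp),
          hi] with x h1 h2 h3 h4
        have e : ∫ y, k x y ((r • ψ : Lp E 2 μ) y) ∂μ = r • ∫ y, k x y (ψ y) ∂μ := by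
          rw [← integral_smul]
          refine integral_congr_ae ?_
          filter_upwards [hi] with y hy
          rw [hy, map_smul]
        rw [RingHom.id_apply, h1, h3, Pi.smul_apply, h2, h4, e, map_smul, smul_add]) }
  refine ⟨B.mkContinuous (a + c) fun ψ => ?_, hae⟩
  refine (Lp_norm_le_of_ae_le (g := ψ) ha0 (b := c * ‖ψ‖) (by positivity) ?_).trans
    (le_of_eq (by ring))
  filter_upwards [hae ψ] with x hx
  refine (le_of_eq (congrArg norm hx)).trans ((norm_add_le _ _).trans (add_le_add ?_ ?_))
  · exact (A x).le_of_opNorm_le (ha x) _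
  · exact norm_integral_clm_apply_le hc0 (hc x) ψ

/-- Norm bound for the difference of two operators as in `exists_operator`. -/
theorem norm_operator_sub_le {B B' : Lp E 2 μ →L[ℝ] Lp E 2 μ} {A A' : α → E →L[ℝ] E}
    {k k' : α → α → E →L[ℝ] E} (hB : ∀ ψ, B ψ =ᵐ[μ] fun x => A x (ψ x) + ∫ y, k x y (ψ y) ∂μ)
    (hB' : ∀ ψ, B' ψ =ᵐ[μ] fun x => A' x (ψ x) + ∫ y, k' x y (ψ y) ∂μ)
    (hk : ∀ x, Continuous (k x)) (hk' : ∀ x, Continuous (k' x)) {a c c₁ c₂ : ℝ} (ha0 : 0 ≤ a)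
    (hc0 : 0 ≤ c) (ha : ∀ x, ‖A x - A' x‖ ≤ a) (hc : ∀ x y, ‖k x y - k' x y‖ ≤ c)
    (hkb : ∀ x y, ‖k x y‖ ≤ c₁) (hkb' : ∀ x y, ‖k' x y‖ ≤ c₂) :
    ‖B - B'‖ ≤ a + c := by
  refine ContinuousLinearMap.opNorm_le_bound _ (by positivity) fun ψ => ?_
  refine (Lp_norm_le_of_ae_le (g := ψ) ha0 (b := c * ‖ψ‖) (by positivity) ?_).trans
    (le_of_eq (by ring))
  filter_upwards [hB ψ, hB' ψ, Lp.coeFn_sub (B ψ) (B' ψ)] with x h1 h2 h3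
  have e : ((B - B') ψ) x = (A x - A' x) (ψ x) + ∫ y, (k x y - k' x y) (ψ y) ∂μ := by
    rw [sub_apply, h3, Pi.sub_apply, h1, h2]
    simp only [sub_apply]
    rw [integral_sub (integrable_clm_apply (hk x) (hkb x) ψ)
      (integrable_clm_apply (hk' x) (hkb' x) ψ)]
    abel
  rw [e]
  exact (norm_add_le _ _).trans (add_le_add ((A x - A' x).le_of_opNorm_le (ha x) _)
    (norm_integral_clm_apply_le hc0 (hc x) ψ))

end Operators

/-! ### The linearized dynamics and the adjoint state -/

section Adjoint
variable {d M : ℕ} {K₁ K₂ : State d → State d} {C : ℝ≥0} {μ₀ : Measure (State d)}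
  [IsProbabilityMeasure μ₀] {w : ℝ → ControlValue d M} {Z : ℝ → State d →ᵇ State d}

/-- `B t` is the linearization at time `t` of the nonlocal Lagrangian dynamics with respect to the
displacement, as an operator on `L²(μ₀)`. -/
def IsLinearization (K₁ K₂ : State d → State d) (w : ℝ → ControlValue d M)
    (Z : ℝ → State d →ᵇ State d) (B : ℝ → Lp (State d) 2 μ₀ →L[ℝ] Lp (State d) 2 μ₀) : Prop :=
  ∀ t ψ, B t ψ =ᵐ[μ₀] fun x =>
    fderiv ℝ (velocity K₁ K₂ (displaced μ₀ (Z t)) (w t)) (x + Z t x) (ψ x)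
      + ∫ y, fderiv ℝ K₁ (x + Z t x - (y + Z t y)) (ψ y) ∂μ₀

theorem lipschitzWith_fderiv_velocity {ν : Measure (State d)} [IsProbabilityMeasure ν]
    (h₁ : IsKernel K₁ C) (h₂ : IsKernel K₂ C) (c : ControlValue d M) :
    LipschitzWith (C * (M + 1)) (fderiv ℝ (velocity K₁ K₂ ν c)) := by
  refine LipschitzWith.of_dist_le_mul fun x y => ?_
  rw [dist_eq_norm, dist_eq_norm]
  have := norm_fderiv_velocity_sub_le (μ := ν) (ν := ν) h₁ h₂ c c x y le_rfl
    (by rw [wasserstein2_self]; simp)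
  simpa using this

theorem IsDisplacement.exists_isLinearization (hZ : IsDisplacement K₁ K₂ μ₀ w Z)
    (h₁ : IsKernel K₁ C) (h₂ : IsKernel K₂ C) (hw : Continuous w) :
    ∃ B : ℝ → Lp (State d) 2 μ₀ →L[ℝ] Lp (State d) 2 μ₀,
      IsLinearization K₁ K₂ w Z B ∧ Continuous B ∧ ∀ t, ‖B t‖ ≤ C * (M + 2) := by
  have hAc : ∀ t, Continuous fun x =>
      fderiv ℝ (velocity K₁ K₂ (displaced μ₀ (Z t)) (w t)) (x + Z t x) := fun t =>
    (lipschitzWith_fderiv_velocity h₁ h₂ (w t)).continuous.comp (continuous_id_add (Z t))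
  have hk1 : ∀ t y, Continuous fun x => fderiv ℝ K₁ (x + Z t x - (y + Z t y)) := fun t y =>
    h₁.lipschitz_fderiv.continuous.comp ((continuous_id_add (Z t)).sub continuous_const)
  have hk2 : ∀ t x, Continuous fun y => fderiv ℝ K₁ (x + Z t x - (y + Z t y)) := fun t x =>
    h₁.lipschitz_fderiv.continuous.comp (continuous_const.sub (continuous_id_add (Z t)))
  choose B hB using fun t => exists_operator (μ := μ₀) (hAc t) (hk1 t) (hk2 t)
    (by positivity) C.coe_nonneg (fun x => norm_fderiv_velocity_le h₁ h₂ (w t) (x + Z t x))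
    (fun x y => h₁.norm_fderiv_le _)
  refine ⟨B, hB, ?_, fun t => ?_⟩
  · refine continuous_iff_continuousAt.2 fun t => ?_
    rw [ContinuousAt, tendsto_iff_norm_sub_tendsto_zero]
    have h1 : Tendsto (fun s => ‖Z s - Z t‖) (𝓝 t) (𝓝 0) :=
      tendsto_iff_norm_sub_tendsto_zero.1 (hZ.continuous.tendsto t)
    have h2 : Tendsto (fun s => ‖w s - w t‖) (𝓝 t) (𝓝 0) :=
      tendsto_iff_norm_sub_tendsto_zero.1 (hw.tendsto t)
    have hlim : Tendsto (fun s => (C * ‖Z s - Z t‖ + C * (M + 1) * (‖Z s - Z t‖ + ‖w s - w t‖))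
        + C * (2 * ‖Z s - Z t‖)) (𝓝 t) (𝓝 0) := by
      simpa using ((h1.const_mul (C : ℝ)).add ((h1.add h2).const_mul (C * (M + 1 : ℝ)))).add
        ((h1.const_mul 2).const_mul (C : ℝ))
    refine squeeze_zero (fun _ => norm_nonneg _) (fun s => ?_) hlim
    refine norm_operator_sub_le (hB s) (hB t) (hk2 s) (hk2 t) (by positivity) (by positivity)
      (fun x => ?_) (fun x y => ?_) (fun x y => h₁.norm_fderiv_le _)
      (fun x y => h₁.norm_fderiv_le _)
    · refine (norm_fderiv_velocity_sub_le h₁ h₂ _ _ _ _ (norm_nonneg _)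
        (wasserstein2_displaced_le (Z s) (Z t))).trans ?_
      gcongr
      simpa using (Z s - Z t).norm_coe_le_norm x
    · have := h₁.lipschitz_fderiv.dist_le_mul (x + Z s x - (y + Z s y)) (x + Z t x - (y + Z t y))
      rw [dist_eq_norm, dist_eq_norm] at this
      refine this.trans ?_
      gcongr
      have e : x + Z s x - (y + Z s y) - (x + Z t x - (y + Z t y))
          = (Z s - Z t) x - (Z s - Z t) y := by
        simp only [BoundedContinuousFunction.sub_apply]; abel
      rw [e, two_mul]
      exact (_root_.norm_sub_le _ _).trans
        (add_le_add ((Z s - Z t).norm_coe_le_norm x) ((Z s - Z t).norm_coe_le_norm y))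
  · have h0 : ∀ ψ : Lp (State d) 2 μ₀, (0 : Lp (State d) 2 μ₀ →L[ℝ] Lp (State d) 2 μ₀) ψ =ᵐ[μ₀]
        fun x => (0 : State d →L[ℝ] State d) (ψ x)
          + ∫ y, (0 : State d →L[ℝ] State d) (ψ y) ∂μ₀ := fun ψ =>
      Eventually.of_forall fun x => by simp
    have := norm_operator_sub_le (hB t) (A' := fun _ => 0) (k' := fun _ _ => 0) (B' := 0) h0
      (hk2 t) (fun _ => continuous_const) (a := C * (M + 1)) (by positivity) C.coe_nonneg
      (fun x => by simpa using norm_fderiv_velocity_le h₁ h₂ (w t) (x + Z t x))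
      (fun x y => by simpa using h₁.norm_fderiv_le _) (fun x y => h₁.norm_fderiv_le _)
      (c₂ := 0) (fun x y => by simp)
    rw [sub_zero] at this
    linarith

/-- The solution of the adjoint linear equation with zero terminal value. -/
theorem exists_adjointState {H : Type*} [NormedAddCommGroup H] [InnerProductSpace ℝ H]
    [CompleteSpace H] {B : ℝ → H →L[ℝ] H} (hB : Continuous B) {b : ℝ≥0} (hb : ∀ t, ‖B t‖ ≤ b)
    {c : ℝ → H} (hc : Continuous c) (T : ℝ) :
    ∃ p : ℝ → H, p T = 0 ∧ ∀ t, HasDerivAt p (-(B t).adjoint (p t) + c t) t := by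
  refine exists_hasDerivAt_of_lipschitz (F := fun t p => -(B t).adjoint p + c t) (K := b)
    (fun p => ?_) (fun t => ?_) T 0
  · have : Continuous fun t => (B t).adjoint :=
      (ContinuousLinearMap.adjoint (𝕜 := ℝ) (E := H) (F := H)).continuous.comp hB
    fun_prop
  · refine LipschitzWith.of_dist_le_mul fun p q => ?_
    rw [dist_eq_norm, dist_eq_norm]
    have e : -(B t).adjoint p + c t - (-(B t).adjoint q + c t) = -((B t).adjoint (p - q)) := by
      rw [map_sub]; abel
    rw [e, norm_neg]
    refine (B t).adjoint.le_of_opNorm_le ?_ _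
    rw [LinearIsometryEquiv.norm_map]
    exact hb t

end Adjoint

/-! ### Vector measures with a density -/

section DensityIntegral
variable {α E F G : Type*} [MeasurableSpace α] {μ : Measure α} [NormedAddCommGroup E]
  [NormedSpace ℝ E] [NormedAddCommGroup F] [NormedSpace ℝ F] [CompleteSpace F]
  [NormedAddCommGroup G] [NormedSpace ℝ G] [CompleteSpace G]

theorem isFiniteMeasure_variation_withDensityᵥ {p : α → F} (hp : Integrable p μ) :
    IsFiniteMeasure (μ.withDensityᵥ p).variation := by
  rw [Measure.variation_withDensityᵥ hp]
  exact ⟨by simpa using! hp.2⟩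

/-- Integration against a vector measure with a density. -/
theorem integral_withDensityᵥ {p : α → F} (hp : Integrable p μ) (B : E →L[ℝ] F →L[ℝ] G)
    {f : α → E} (hf : StronglyMeasurable f) {C : ℝ} (hC : ∀ x, ‖f x‖ ≤ C) :
    (μ.withDensityᵥ p).integral f B = ∫ x, B (f x) (p x) ∂μ := by
  have := isFiniteMeasure_variation_withDensityᵥ hp
  have hint : ∀ {f : α → E}, StronglyMeasurable f → ∀ {C : ℝ}, (∀ x, ‖f x‖ ≤ C) →
      Integrable (fun x => B (f x) (p x)) μ := fun {f} hf {C} hC => by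
    refine (hp.norm.const_mul (‖B‖ * C)).mono' ?_ (Eventually.of_forall fun x => ?_)
    · exact B.aestronglyMeasurable_comp₂ hf.aestronglyMeasurable hp.aestronglyMeasurable
    · exact (B.le_opNorm₂ _ _).trans (by gcongr; exact hC x)
  have hsimple : ∀ f : SimpleFunc α E,
      (μ.withDensityᵥ p).integral f B = ∫ x, B (f x) (p x) ∂μ := by
    intro f
    induction f using SimpleFunc.induction with
    | const c hs =>
      rename_i s
      have e : (SimpleFunc.piecewise s hs (SimpleFunc.const α c) (SimpleFunc.const α 0) : α → E)
          = s.indicator fun _ => c := by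
        ext x; by_cases hx : x ∈ s <;> simp [hx]
      rw [e, VectorMeasure.integral_indicator hs, VectorMeasure.integral_const,
        VectorMeasure.restrict_apply _ hs MeasurableSet.univ, univ_inter, withDensityᵥ_apply hp hs,
        ← (B c).integral_comp_comm hp.integrableOn, ← integral_indicator hs]
      refine integral_congr_ae (Eventually.of_forall fun x => ?_)
      by_cases hx : x ∈ s <;> simp [hx]
    | add hfg hf hg =>
      rename_i f g
      obtain ⟨Cf, hCf⟩ := f.exists_forall_norm_le
      obtain ⟨Cg, hCg⟩ := g.exists_forall_norm_le
      have := VectorMeasure.integral_fun_add (B := B) (f := f) (g := g)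
        (μ := μ.withDensityᵥ p) (f.integrable_of_isFiniteMeasure) (g.integrable_of_isFiniteMeasure)
      rw [SimpleFunc.coe_add]
      refine this.trans ?_
      rw [hf, hg, ← integral_add (hint f.stronglyMeasurable hCf) (hint g.stronglyMeasurable hCg)]
      simp
  set a := hf.approxBounded C
  have h1 : Tendsto (fun n => (μ.withDensityᵥ p).integral (a n) B) atTop
      (𝓝 ((μ.withDensityᵥ p).integral f B)) :=
    VectorMeasure.tendsto_integral_of_dominated_convergence (fun _ => C)
      (fun n => (a n).stronglyMeasurable.aestronglyMeasurable) (integrable_const _)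
      (fun n => Eventually.of_forall fun x => hf.norm_approxBounded_le
        ((norm_nonneg _).trans (hC x)) n x)
      (Eventually.of_forall fun x => hf.tendsto_approxBounded_of_norm_le (hC x))
  have h2 : Tendsto (fun n => ∫ x, B (a n x) (p x) ∂μ) atTop (𝓝 (∫ x, B (f x) (p x) ∂μ)) := by
    refine tendsto_integral_of_dominated_convergence (fun x => ‖B‖ * C * ‖p x‖)
      (fun n => B.aestronglyMeasurable_comp₂ (a n).stronglyMeasurable.aestronglyMeasurable
        hp.aestronglyMeasurable) (hp.norm.const_mul _)
      (fun n => Eventually.of_forall fun x => ?_) (Eventually.of_forall fun x => ?_)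
    · refine (B.le_opNorm₂ _ _).trans ?_
      gcongr
      exact hf.norm_approxBounded_le ((norm_nonneg _).trans (hC x)) n x
    · exact ((B.flip (p x)).continuous.tendsto (f x)).comp
        (hf.tendsto_approxBounded_of_norm_le (hC x))
  simp only [hsimple] at h1
  exact tendsto_nhds_unique h1 h2

/-- Integration against the image of a vector measure with a density. -/
theorem integral_map_withDensityᵥ {β : Type*} [TopologicalSpace β] [MeasurableSpace β]
    [BorelSpace β] [SecondCountableTopology β] {p : α → F} (hp : Integrable p μ)
    (B : E →L[ℝ] F →L[ℝ] G) {X : α → β} (hX : Measurable X) {f : β → E} (hf : Continuous f)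
    {C : ℝ} (hC : ∀ x, ‖f x‖ ≤ C) :
    ((μ.withDensityᵥ p).map X).integral f B = ∫ x, B (f (X x)) (p x) ∂μ := by
  have := isFiniteMeasure_variation_withDensityᵥ hp
  have hfX : StronglyMeasurable (fun x => f (X x)) := hf.stronglyMeasurable.comp_measurable hX
  rw [VectorMeasure.integral_map hX hf.aestronglyMeasurable
    (Integrable.of_bound hfX.aestronglyMeasurable C (Eventually.of_forall fun x => hC _))]
  exact integral_withDensityᵥ hp B hfX fun x => hC _

end DensityIntegral

/-! ### The measures transported from the adjoint state -/

section CoState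
variable {d M : ℕ} {μ₀ : Measure (State d)} [IsProbabilityMeasure μ₀]

/-- The vector measure transported by `x ↦ x + Z x` from the measure with density `p` with respect
to `μ₀`. -/
noncomputable def coStateMeasure (Z : State d →ᵇ State d) (p : Lp (State d) 2 μ₀) :
    VectorMeasure (State d) (State d) :=
  (μ₀.withDensityᵥ p).map fun x => x + Z x

theorem isFiniteMeasure_variation_coStateMeasure (Z : State d →ᵇ State d)
    (p : Lp (State d) 2 μ₀) : IsFiniteMeasure (coStateMeasure Z p).variation := by
  have := isFiniteMeasure_variation_withDensityᵥ (Lp_integrable p)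
  unfold coStateMeasure
  infer_instance

theorem coStateMeasure_zero {ν : Measure (State d)} (Z : State d →ᵇ State d) :
    coStateMeasure Z (0 : Lp (State d) 2 ν) = 0 := by
  have : ν.withDensityᵥ ((0 : Lp (State d) 2 ν) : State d → State d) = 0 := by
    rw [WithDensityᵥEq.congr_ae (Lp.coeFn_zero (State d) 2 ν), withDensityᵥ_zero]
  rw [coStateMeasure, this, VectorMeasure.map_zero]

theorem pairing_coStateMeasure (Z : State d →ᵇ State d) (p : Lp (State d) 2 μ₀)
    {f : State d → State d} (hf : Continuous f) {C : ℝ} (hC : ∀ x, ‖f x‖ ≤ C) :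
    pairing f (coStateMeasure Z p) = ∫ x, ⟪f (x + Z x), p x⟫ ∂μ₀ :=
  integral_map_withDensityᵥ (Lp_integrable p) _ (continuous_id_add Z).measurable hf hC

theorem matIntegral_coStateMeasure (Z : State d →ᵇ State d) (p : Lp (State d) 2 μ₀)
    {A : State d → State d →L[ℝ] State d} (hA : Continuous A) {C : ℝ} (hC : ∀ x, ‖A x‖ ≤ C) :
    matIntegral A (coStateMeasure Z p) = ∫ x, A (x + Z x) (p x) ∂μ₀ :=
  integral_map_withDensityᵥ (Lp_integrable p) _ (continuous_id_add Z).measurable hA hC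

end CoState

/-! ### Differentiability of the moments -/

section Growth
variable {d : ℕ} {G : State d → ℝ} {Cg : ℝ}

theorem norm_fderiv_le_of_gradient (hgr : ∀ x, ‖gradient G x‖ ≤ Cg * (1 + ‖x‖)) (x : State d) :
    ‖fderiv ℝ G x‖ ≤ Cg * (1 + ‖x‖) := by
  have := hgr x
  rwa [gradient, LinearIsometryEquiv.norm_map] at this

theorem growth_nonneg (hgr : ∀ x, ‖gradient G x‖ ≤ Cg * (1 + ‖x‖)) : 0 ≤ Cg := by
  simpa using (norm_nonneg _).trans (hgr 0)

/-- A function whose gradient grows linearly is Lipschitz with a linearly growing constant. -/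
theorem norm_sub_le_of_growth (hG : ContDiff ℝ 1 G)
    (hgr : ∀ x, ‖gradient G x‖ ≤ Cg * (1 + ‖x‖)) (y z : State d) :
    ‖G y - G z‖ ≤ Cg * (1 + ‖y‖ + ‖z‖) * ‖y - z‖ := by
  have h0 := growth_nonneg hgr
  refine (convex_closedBall (0 : State d) (‖y‖ + ‖z‖)).norm_image_sub_le_of_norm_fderiv_le
    (𝕜 := ℝ) (fun x _ => hG.differentiable one_ne_zero x) (fun x hx => ?_) ?_ ?_
  · rw [mem_closedBall_zero_iff] at hx
    refine (norm_fderiv_le_of_gradient hgr x).trans (mul_le_mul_of_nonneg_left ?_ h0)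
    linarith
  · rw [mem_closedBall_zero_iff]; linarith [norm_nonneg y]
  · rw [mem_closedBall_zero_iff]; linarith [norm_nonneg z]

variable {μ₀ : Measure (State d)}

theorem continuous_gradient (hG : ContDiff ℝ 1 G) : Continuous (gradient G) :=
  (InnerProductSpace.toDual ℝ (State d)).symm.continuous.comp (hG.continuous_fderiv one_ne_zero)

theorem norm_add_displacement_le (Z : State d →ᵇ State d) (x : State d) :
    ‖x + Z x‖ ≤ ‖x‖ + ‖Z‖ :=
  (norm_add_le _ _).trans (by gcongr; exact Z.norm_coe_le_norm x)

theorem memLp_affine (hμ₀ : MemP2 μ₀) (a b : ℝ) : MemLp (fun x => a * (b + ‖x‖)) 2 μ₀ := by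
  obtain ⟨hp, h2⟩ := memP2_iff.1 hμ₀
  exact ((memLp_const b).add h2.norm).const_mul a

theorem integrable_comp_displacement (hμ₀ : MemP2 μ₀) (hG : ContDiff ℝ 1 G)
    (hgr : ∀ x, ‖gradient G x‖ ≤ Cg * (1 + ‖x‖)) (Z : State d →ᵇ State d) :
    Integrable (fun x => G (x + Z x)) μ₀ := by
  have hp := hμ₀.1
  have h0 := growth_nonneg hgr
  refine (((memLp_affine hμ₀ 1 (1 + ‖Z‖)).integrable_sq.const_mul Cg).add
    (integrable_const ‖G 0‖)).mono'
    (hG.continuous.comp (continuous_id_add Z)).aestronglyMeasurable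
    (Eventually.of_forall fun x => ?_)
  have h1 := norm_sub_le_of_growth hG hgr (x + Z x) 0
  have h2 := norm_add_displacement_le Z x
  have h3 := norm_le_norm_sub_add (G (x + Z x)) (G 0)
  simp only [Pi.add_apply, norm_zero, sub_zero, add_zero] at h1 ⊢
  refine h3.trans (add_le_add (h1.trans ?_) le_rfl)
  rw [mul_assoc]
  gcongr
  have := norm_nonneg (x + Z x)
  nlinarith

theorem integral_displaced (hG : ContDiff ℝ 1 G) (Z : State d →ᵇ State d) :
    ∫ x, G x ∂(displaced μ₀ Z) = ∫ x, G (x + Z x) ∂μ₀ :=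
  integral_map (continuous_id_add Z).aemeasurable hG.continuous.aestronglyMeasurable

theorem memLp_gradient_comp (hμ₀ : MemP2 μ₀) (hG : ContDiff ℝ 1 G)
    (hgr : ∀ x, ‖gradient G x‖ ≤ Cg * (1 + ‖x‖)) (Z : State d →ᵇ State d) :
    MemLp (fun x => gradient G (x + Z x)) 2 μ₀ := by
  refine (memLp_affine hμ₀ Cg (1 + ‖Z‖)).mono'
    ((continuous_gradient hG).comp (continuous_id_add Z)).aestronglyMeasurable
    (Eventually.of_forall fun x => (hgr _).trans ?_)
  have h0 := growth_nonneg hgr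
  have := norm_add_displacement_le Z x
  exact mul_le_mul_of_nonneg_left (by linarith) h0

/-- The inclusion of the bounded continuous displacements into `L²`. -/
noncomputable def toL2 (μ₀ : Measure (State d)) [IsProbabilityMeasure μ₀] :
    (State d →ᵇ State d) →L[ℝ] Lp (State d) 2 μ₀ :=
  BoundedContinuousFunction.toLp 2 μ₀ ℝ

theorem toL2_ae_eq [IsProbabilityMeasure μ₀] (Z : State d →ᵇ State d) : toL2 μ₀ Z =ᵐ[μ₀] Z :=
  BoundedContinuousFunction.coeFn_toLp 2 μ₀ ℝ Z

/-- The moments are continuously differentiable functions of the displacement. -/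
theorem exists_momentGradient [IsProbabilityMeasure μ₀] (hμ₀ : MemP2 μ₀) (hG : ContDiff ℝ 1 G)
    (hgr : ∀ x, ‖gradient G x‖ ≤ Cg * (1 + ‖x‖)) :
    ∃ γ : (State d →ᵇ State d) → Lp (State d) 2 μ₀, Continuous γ ∧
      (∀ Z, γ Z =ᵐ[μ₀] fun x => gradient G (x + Z x)) ∧
      ∀ Z, HasFDerivAt (fun Z => ∫ x, G x ∂(displaced μ₀ Z)) (innerSL ℝ (γ Z) ∘L toL2 μ₀) Z := by
  have h0 := growth_nonneg hgr
  have hγ := fun Z => (memLp_gradient_comp hμ₀ hG hgr Z).coeFn_toLp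
  have hnear : ∀ Z : State d →ᵇ State d, ∀ᶠ Z' in 𝓝 Z, ‖Z' - Z‖ ≤ 1 := fun Z => by
    filter_upwards [Metric.closedBall_mem_nhds Z one_pos] with Z' hZ'
    rwa [← dist_eq_norm]
  have hnorm : ∀ {Z Z' : State d →ᵇ State d} (x : State d), ‖Z' - Z‖ ≤ 1 →
      ‖x + Z' x‖ ≤ ‖x‖ + ‖Z‖ + 1 := fun {Z Z'} x h => by
    have h1 := norm_add_displacement_le Z' x
    have h2 := norm_le_norm_sub_add Z' Z
    linarith
  refine ⟨fun Z => (memLp_gradient_comp hμ₀ hG hgr Z).toLp, ?_, hγ, fun Z => ?_⟩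
  · refine continuous_iff_continuousAt.2 fun Z => ?_
    refine Lp_tendsto_of_dominated (hF := hγ) (hG := hγ Z) (memLp_affine hμ₀ Cg (2 + ‖Z‖)) ?_ ?_ ?_
    · filter_upwards [hnear Z] with Z' hZ' x
      refine (hgr _).trans ?_
      have := hnorm x hZ'
      exact mul_le_mul_of_nonneg_left (by linarith) h0
    · intro x
      refine (hgr _).trans ?_
      have := norm_add_displacement_le Z x
      exact mul_le_mul_of_nonneg_left (by linarith [norm_nonneg Z]) h0
    · intro x
      have hc : Continuous fun Z' : State d →ᵇ State d => gradient G (x + Z' x) :=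
        (continuous_gradient hG).comp
          (continuous_const.add (BoundedContinuousFunction.evalCLM ℝ x).continuous)
      exact hc.tendsto Z
  · simp only [integral_displaced hG]
    have hpt : ∀ x, HasFDerivAt (fun Z' : State d →ᵇ State d => G (x + Z' x))
        (fderiv ℝ G (x + Z x) ∘L BoundedContinuousFunction.evalCLM ℝ x) Z := fun x =>
      (hG.differentiable one_ne_zero (x + Z x)).hasFDerivAt.comp Z
        ((BoundedContinuousFunction.evalCLM ℝ x).hasFDerivAt.const_add x)
    have hinner : ∀ H, ⟪(memLp_gradient_comp hμ₀ hG hgr Z).toLp, toL2 μ₀ H⟫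
        = ∫ x, fderiv ℝ G (x + Z x) (H x) ∂μ₀ := fun H => by
      rw [L2.inner_def]
      refine integral_congr_ae ?_
      filter_upwards [hγ Z, toL2_ae_eq (μ₀ := μ₀) H] with x h1 h2
      rw [h1, h2, inner_gradient_left]
    have hint : ∀ H : State d →ᵇ State d,
        Integrable (fun x => fderiv ℝ G (x + Z x) (H x)) μ₀ := fun H => by
      refine (((memLp_affine hμ₀ Cg (1 + ‖Z‖)).integrable one_le_two).mul_const ‖H‖).mono' ?_
        (Eventually.of_forall fun x => ?_)
      · exact (((hG.continuous_fderiv one_ne_zero).comp (continuous_id_add Z)).clm_apply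
          H.continuous).aestronglyMeasurable
      · refine ((fderiv ℝ G (x + Z x)).le_of_opNorm_le_of_le
          (norm_fderiv_le_of_gradient hgr _) (H.norm_coe_le_norm x)).trans ?_
        have := norm_add_displacement_le Z x
        exact mul_le_mul_of_nonneg_right (mul_le_mul_of_nonneg_left (by linarith) h0)
          (norm_nonneg _)
    rw [hasFDerivAt_iff_tendsto]
    have hptlim : ∀ x, Tendsto (fun Z' : State d →ᵇ State d => ‖Z' - Z‖⁻¹ *
        ‖G (x + Z' x) - G (x + Z x) - fderiv ℝ G (x + Z x) ((Z' - Z) x)‖) (𝓝 Z) (𝓝 0) := by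
      intro x
      have := hasFDerivAt_iff_tendsto.1 (hpt x)
      simp only [ContinuousLinearMap.comp_apply, BoundedContinuousFunction.evalCLM_apply] at this
      exact this
    have hbd : Integrable (fun x => 3 * (Cg * ((2 + 2 * ‖Z‖) + ‖x‖))) μ₀ :=
      ((memLp_affine hμ₀ Cg (2 + 2 * ‖Z‖)).integrable one_le_two).const_mul 3
    have hlim : Tendsto (fun Z' : State d →ᵇ State d => ∫ x, ‖Z' - Z‖⁻¹ *
        ‖G (x + Z' x) - G (x + Z x) - fderiv ℝ G (x + Z x) ((Z' - Z) x)‖ ∂μ₀) (𝓝 Z)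
        (𝓝 (∫ _, (0 : ℝ) ∂μ₀)) := by
      refine tendsto_integral_filter_of_dominated_convergence
        (fun x => 3 * (Cg * ((2 + 2 * ‖Z‖) + ‖x‖))) (Eventually.of_forall fun Z' => ?_) ?_ hbd
        (Eventually.of_forall hptlim)
      · refine Continuous.aestronglyMeasurable ?_
        refine continuous_const.mul (Continuous.norm (((hG.continuous.comp (continuous_id_add Z')).sub
          (hG.continuous.comp (continuous_id_add Z))).sub ?_))
        exact ((hG.continuous_fderiv one_ne_zero).comp (continuous_id_add Z)).clm_apply
            (Z' - Z).continuous
      · filter_upwards [hnear Z] with Z' hZ'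
        refine Eventually.of_forall fun x => ?_
        rw [Real.norm_of_nonneg (by positivity)]
        refine inv_mul_le_of_le_mul₀ (norm_nonneg _) (by positivity) ?_
        have e1 : ‖x + Z' x - (x + Z x)‖ ≤ ‖Z' - Z‖ := by
          simpa using (Z' - Z).norm_coe_le_norm x
        have h1 : ‖G (x + Z' x) - G (x + Z x)‖ ≤ Cg * (1 + (‖x‖ + ‖Z‖ + 1) + (‖x‖ + ‖Z‖))
            * ‖Z' - Z‖ := by
          refine (norm_sub_le_of_growth hG hgr _ _).trans ?_
          gcongr
          · exact hnorm x hZ'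
          · exact norm_add_displacement_le Z x
        have h2 : ‖fderiv ℝ G (x + Z x) ((Z' - Z) x)‖ ≤ Cg * (1 + (‖x‖ + ‖Z‖)) * ‖Z' - Z‖ := by
          refine ((fderiv ℝ G (x + Z x)).le_of_opNorm_le_of_le
            (norm_fderiv_le_of_gradient hgr _) ((Z' - Z).norm_coe_le_norm x)).trans ?_
          gcongr
          exact norm_add_displacement_le Z x
        refine (norm_sub_le _ _).trans ((add_le_add h1 h2).trans ?_)
        have : 0 ≤ Cg * ‖Z' - Z‖ := by positivity
        nlinarith [norm_nonneg Z, norm_nonneg x, mul_nonneg this (norm_nonneg Z)]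
    rw [integral_zero] at hlim
    refine squeeze_zero (fun _ => by positivity) (fun Z' => ?_) hlim
    rw [integral_const_mul]
    gcongr
    have hsub : Integrable (fun x => G (x + Z' x) - G (x + Z x)) μ₀ :=
      (integrable_comp_displacement hμ₀ hG hgr Z').sub (integrable_comp_displacement hμ₀ hG hgr Z)
    rw [ContinuousLinearMap.comp_apply, innerSL_apply_apply, hinner,
      ← integral_sub (integrable_comp_displacement hμ₀ hG hgr Z')
        (integrable_comp_displacement hμ₀ hG hgr Z), ← integral_sub hsub (hint _)]
    exact norm_integral_le_integral_norm _

end Growth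

/-! ### Differentiability of the running cost -/

section Cost
variable {d L : ℕ} {g : Fin L → State d → ℝ} {Cg : ℝ} {j : (Fin L → ℝ) → ℝ}
  {μ₀ : Measure (State d)} [IsProbabilityMeasure μ₀]

/-- The running cost is a continuously differentiable function of the displacement. Its gradient in
`L²` is `costGradient` along the displaced particles. -/
theorem exists_costState (hμ₀ : MemP2 μ₀) (hj : ContDiff ℝ 1 j) (hg : ∀ i, ContDiff ℝ 1 (g i))
    (hgr : ∀ i x, ‖gradient (g i) x‖ ≤ Cg * (1 + ‖x‖)) :
    ∃ c : (State d →ᵇ State d) → Lp (State d) 2 μ₀, Continuous c ∧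
      (∀ Z, c Z =ᵐ[μ₀] fun x => costGradient j g (displaced μ₀ Z) (x + Z x)) ∧
      ∀ Z, HasFDerivAt (fun Z => j (moments g (displaced μ₀ Z)))
        (innerSL ℝ (c Z) ∘L toL2 μ₀) Z := by
  choose γ hγc hγ hγd using fun i => exists_momentGradient hμ₀ (hg i) (hgr i)
  have hm : ∀ Z, HasFDerivAt (fun Z => moments g (displaced μ₀ Z))
      (ContinuousLinearMap.pi fun i => innerSL ℝ (γ i Z) ∘L toL2 μ₀) Z := fun Z =>
    hasFDerivAt_pi.2 fun i => hγd i Z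
  have hmc : Continuous fun Z => moments g (displaced μ₀ Z) :=
    continuous_iff_continuousAt.2 fun Z => (hm Z).continuousAt
  refine ⟨fun Z => ∑ i, fderiv ℝ j (moments g (displaced μ₀ Z)) (Pi.single i 1) • γ i Z, ?_,
    fun Z => ?_, fun Z => ?_⟩
  · exact continuous_finsetSum _ fun i _ => ((((hj.continuous_fderiv one_ne_zero).comp hmc).clm_apply
      continuous_const)).smul (hγc i)
  · have hall : ∀ᵐ x ∂μ₀, ∀ i, γ i Z x = gradient (g i) (x + Z x) := ae_all_iff.2 fun i => hγ i Z
    have hsum := Lp.coeFn_finsetSum (p := 2) (μ := μ₀) Finset.univ fun i =>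
      fderiv ℝ j (moments g (displaced μ₀ Z)) (Pi.single i 1) • γ i Z
    have hsmul : ∀ᵐ x ∂μ₀, ∀ i,
      (fderiv ℝ j (moments g (displaced μ₀ Z)) (Pi.single i 1) • γ i Z : Lp (State d) 2 μ₀) x
        = fderiv ℝ j (moments g (displaced μ₀ Z)) (Pi.single i 1) • γ i Z x :=
      ae_all_iff.2 fun i => Lp.coeFn_smul _ _
    filter_upwards [hall, hsum, hsmul] with x h1 h2 h3
    rw [h2, costGradient]
    simp [h3, h1]
  · refine (((hj.differentiable one_ne_zero _).hasFDerivAt.comp Z (hm Z))).congr_fderiv ?_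
    ext H
    rw [ContinuousLinearMap.comp_apply, ContinuousLinearMap.comp_apply, innerSL_apply_apply,
      sum_inner]
    conv_lhs => rw [pi_eq_sum_univ' (ContinuousLinearMap.pi (fun i => innerSL ℝ (γ i Z) ∘L toL2 μ₀) H)]
    simp [map_sum, inner_smul_left, mul_comm]

/-- First order expansion of a continuously differentiable function, uniformly along a compact
set. -/
theorem exists_norm_sub_sub_le_of_isCompact {E F : Type*} [NormedAddCommGroup E] [NormedSpace ℝ E]
    [NormedAddCommGroup F] [NormedSpace ℝ F] {f : E → F} {f' : E → E →L[ℝ] F}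
    (hf : ∀ x, HasFDerivAt f (f' x) x) (hf' : Continuous f') {s : Set E} (hs : IsCompact s)
    {η : ℝ} (hη : 0 < η) :
    ∃ r > 0, ∀ x ∈ s, ∀ y, ‖y - x‖ < r → ‖f y - f x - f' x (y - x)‖ ≤ η * ‖y - x‖ := by
  have h := hs.uniformContinuousAt_of_continuousAt f' (fun x _ => hf'.continuousAt)
    (Metric.dist_mem_uniformity hη)
  obtain ⟨r, hr, hr'⟩ := Metric.mem_uniformity_dist.1 h
  refine ⟨r, hr, fun x hx y hy => ?_⟩
  refine (convex_ball x r).norm_image_sub_le_of_norm_hasFDerivWithin_le' (φ := f' x)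
    (fun z _ => (hf z).hasFDerivWithinAt) (fun z hz => ?_) (Metric.mem_ball_self hr)
    (by rwa [Metric.mem_ball, dist_eq_norm])
  have := hr' (a := x) (b := z) (by rwa [dist_comm]) hx
  rw [← dist_eq_norm, dist_comm]
  exact le_of_lt this

end Cost

/-! ### The nonlocal term and the force on the control -/

section FixedTime
variable {d M : ℕ} {μ₀ : Measure (State d)} [IsProbabilityMeasure μ₀] {K : State d → State d}
  {C : ℝ≥0}

theorem IsKernel.continuous_nabla (hK : IsKernel K C) : Continuous (nabla K) :=
  (ContinuousLinearMap.adjoint (𝕜 := ℝ) (E := State d) (F := State d)).continuous.comp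
    hK.lipschitz_fderiv.continuous

theorem IsKernel.norm_nabla_le (hK : IsKernel K C) (x : State d) : ‖nabla K x‖ ≤ C := by
  rw [nabla, LinearIsometryEquiv.norm_map]
  exact hK.norm_fderiv_le x

theorem inner_nabla (x a b : State d) : ⟪a, nabla K x b⟫ = ⟪fderiv ℝ K x a, b⟫ :=
  ContinuousLinearMap.adjoint_inner_right _ _ _

theorem matIntegral_nabla_sub_left (hK : IsKernel K C) (Z : State d →ᵇ State d)
    (p : Lp (State d) 2 μ₀) (a : State d) :
    matIntegral (fun y => nabla K (y - a)) (coStateMeasure Z p)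
      = ∫ y, nabla K (y + Z y - a) (p y) ∂μ₀ :=
  matIntegral_coStateMeasure Z p (hK.continuous_nabla.comp (continuous_id.sub continuous_const))
    fun _ => hK.norm_nabla_le _

/-- The nonlocal term of the adjoint equation, as the transpose of the nonlocal part of the
linearized dynamics. -/
theorem integral_inner_matIntegral (hK : IsKernel K C) (Z : State d →ᵇ State d)
    (p : Lp (State d) 2 μ₀) {f : State d → State d} (hf : Continuous f) {Cf : ℝ}
    (hCf : ∀ x, ‖f x‖ ≤ Cf) :
    ∫ x, ⟪f x, matIntegral (fun y => nabla K (y - x)) (coStateMeasure Z p)⟫ ∂(displaced μ₀ Z)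
      = ∫ x, ⟪p x, ∫ y, fderiv ℝ K (x + Z x - (y + Z y)) (f (y + Z y)) ∂μ₀⟫ ∂μ₀ := by
  have h0 : 0 ≤ Cf := (norm_nonneg _).trans (hCf 0)
  have hX := continuous_id_add Z
  have hky : ∀ a, Continuous fun y => nabla K (y + Z y - a) := fun a =>
    hK.continuous_nabla.comp (hX.sub continuous_const)
  have hcont : Continuous fun x => ∫ y, nabla K (y + Z y - x) (p y) ∂μ₀ :=
    continuous_of_dominated (bound := fun y => C * ‖p y‖)
      (fun x => aestronglyMeasurable_clm_apply (hky x) p)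
      (fun x => Eventually.of_forall fun y => (nabla K _).le_of_opNorm_le (hK.norm_nabla_le _) _)
      ((Lp_integrable p).norm.const_mul _)
      (Eventually.of_forall fun y => (hK.continuous_nabla.comp
        (continuous_const.sub continuous_id)).clm_apply continuous_const)
  simp only [matIntegral_nabla_sub_left hK]
  have h1 : ∫ x, ⟪f x, ∫ y, nabla K (y + Z y - x) (p y) ∂μ₀⟫ ∂(displaced μ₀ Z)
      = ∫ x, ⟪f (x + Z x), ∫ y, nabla K (y + Z y - (x + Z x)) (p y) ∂μ₀⟫ ∂μ₀ :=
    integral_map hX.aemeasurable (hf.inner hcont).aestronglyMeasurable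
  have h2 : ∀ x, ⟪f (x + Z x), ∫ y, nabla K (y + Z y - (x + Z x)) (p y) ∂μ₀⟫
      = ∫ y, ⟪fderiv ℝ K (y + Z y - (x + Z x)) (f (x + Z x)), p y⟫ ∂μ₀ := fun x => by
    rw [← integral_inner (integrable_clm_apply (hky _) (fun y => hK.norm_nabla_le _) p)]
    simp only [inner_nabla]
  have hkc : Continuous fun z : State d × State d =>
      fderiv ℝ K (z.2 + Z z.2 - (z.1 + Z z.1)) (f (z.1 + Z z.1)) :=
    (hK.lipschitz_fderiv.continuous.comp ((hX.comp continuous_snd).sub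
      (hX.comp continuous_fst))).clm_apply (hf.comp (hX.comp continuous_fst))
  have hint : Integrable (fun z : State d × State d =>
      ⟪fderiv ℝ K (z.2 + Z z.2 - (z.1 + Z z.1)) (f (z.1 + Z z.1)), p z.2⟫) (μ₀.prod μ₀) := by
    refine (((Lp_integrable p).norm.comp_snd μ₀).const_mul (C * Cf)).mono' ?_
      (Eventually.of_forall fun z => ?_)
    · exact hkc.aestronglyMeasurable.inner (Lp.aestronglyMeasurable p).comp_snd
    · refine (norm_inner_le_norm _ _).trans ?_
      gcongr
      exact (fderiv ℝ K _).le_of_opNorm_le_of_le (hK.norm_fderiv_le _) (hCf _)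
  rw [h1]
  simp only [h2]
  rw [integral_integral_swap hint]
  refine integral_congr_ae (Eventually.of_forall fun y => ?_)
  have hi : Integrable (fun x => fderiv ℝ K (y + Z y - (x + Z x)) (f (x + Z x))) μ₀ :=
    integrable_of_continuous_of_norm_le (hkc.comp (continuous_id.prodMk continuous_const))
      (C := C * Cf) fun x => (fderiv ℝ K _).le_of_opNorm_le_of_le (hK.norm_fderiv_le _) (hCf _)
  simp only [real_inner_comm]
  exact integral_inner hi (p y)

variable {K₂ : State d → State d}

/-- The first order change of the velocity at `x` caused by the variation `e` of the control `c`. -/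
noncomputable def controlSource (K₂ : State d → State d) (c e : ControlValue d M)
    (x : State d) : State d :=
  ∑ ℓ, fderiv ℝ K₂ (x - c.part ℓ) (e.part ℓ)

theorem norm_controlSource_le (h₂ : IsKernel K₂ C) (c e : ControlValue d M) (x : State d) :
    ‖controlSource K₂ c e x‖ ≤ M * (C * ‖e‖) := by
  have : ‖controlSource K₂ c e x‖ ≤ ∑ _ℓ : Fin M, C * ‖e‖ := norm_sum_le_of_le _ fun ℓ _ =>
    (fderiv ℝ K₂ _).le_of_opNorm_le_of_le (h₂.norm_fderiv_le _) (e.norm_part_le ℓ)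
  simpa using this

theorem continuous_controlSource (h₂ : IsKernel K₂ C) (c e : ControlValue d M) :
    Continuous (controlSource K₂ c e) :=
  continuous_finsetSum _ fun _ _ => (h₂.lipschitz_fderiv.continuous.comp
    (continuous_id.sub continuous_const)).clm_apply continuous_const

theorem ControlValue.inner_eq_sum (a b : ControlValue d M) :
    ⟪a, b⟫ = ∑ ℓ, ⟪a.part ℓ, b.part ℓ⟫ := by
  simp only [PiLp.inner_apply, ControlValue.part, Fintype.sum_prod_type]

theorem controlForce_coStateMeasure_part (h₂ : IsKernel K₂ C) (Z : State d →ᵇ State d)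
    (p : Lp (State d) 2 μ₀) (c : ControlValue d M) (ℓ : Fin M) :
    (controlForce K₂ (coStateMeasure Z p) c).part ℓ
      = ∫ x, nabla K₂ (x + Z x - c.part ℓ) (p x) ∂μ₀ := by
  rw [← matIntegral_nabla_sub_left h₂]
  rfl

/-- The force on the control is the transpose of the effect of the control on the velocity. -/
theorem inner_controlForce (h₂ : IsKernel K₂ C) (Z : State d →ᵇ State d)
    (p : Lp (State d) 2 μ₀) (c e : ControlValue d M) :
    ⟪controlForce K₂ (coStateMeasure Z p) c, e⟫
      = ∫ x, ⟪p x, controlSource K₂ c e (x + Z x)⟫ ∂μ₀ := by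
  have hk : ∀ ℓ, Continuous fun x => nabla K₂ (x + Z x - c.part ℓ) := fun ℓ =>
    h₂.continuous_nabla.comp ((continuous_id_add Z).sub continuous_const)
  have hi : ∀ ℓ, Integrable (fun x => nabla K₂ (x + Z x - c.part ℓ) (p x)) μ₀ := fun ℓ =>
    integrable_clm_apply (hk ℓ) (fun x => h₂.norm_nabla_le _) p
  rw [ControlValue.inner_eq_sum]
  simp only [controlForce_coStateMeasure_part h₂]
  have h1 : ∀ ℓ, ⟪∫ x, nabla K₂ (x + Z x - c.part ℓ) (p x) ∂μ₀, e.part ℓ⟫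
      = ∫ x, ⟪p x, fderiv ℝ K₂ (x + Z x - c.part ℓ) (e.part ℓ)⟫ ∂μ₀ := fun ℓ => by
    rw [real_inner_comm, ← integral_inner (hi ℓ)]
    simp only [inner_nabla, real_inner_comm]
  simp only [h1, controlSource, inner_sum]
  rw [integral_finsetSum]
  intro ℓ _
  have := (hi ℓ).const_inner (𝕜 := ℝ) (e.part ℓ)
  simpa only [inner_nabla, real_inner_comm] using this

theorem continuous_controlForce (h₂ : IsKernel K₂ C) {Z : ℝ → State d →ᵇ State d}
    (hZ : Continuous Z) {p : ℝ → Lp (State d) 2 μ₀} (hp : Continuous p)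
    {w : ℝ → ControlValue d M} (hw : Continuous w) :
    Continuous fun t => controlForce K₂ (coStateMeasure (Z t) (p t)) (w t) := by
  have hpart : ∀ ℓ, Continuous fun t =>
      (controlForce K₂ (coStateMeasure (Z t) (p t)) (w t)).part ℓ := fun ℓ => by
    simp only [controlForce_coStateMeasure_part h₂]
    refine continuous_iff_continuousAt.2 fun t => ?_
    rw [ContinuousAt, tendsto_iff_norm_sub_tendsto_zero]
    have l1 := tendsto_iff_norm_sub_tendsto_zero.1 (hZ.tendsto t)
    have l2 := tendsto_iff_norm_sub_tendsto_zero.1 (hw.tendsto t)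
    have l3 := tendsto_iff_norm_sub_tendsto_zero.1 (hp.tendsto t)
    have hlim : Tendsto (fun s => C * (‖Z s - Z t‖ + ‖w s - w t‖) * ‖p t‖ + C * ‖p s - p t‖)
        (𝓝 t) (𝓝 0) := by
      simpa using (((l1.add l2).const_mul (C : ℝ)).mul_const ‖p t‖).add (l3.const_mul (C : ℝ))
    refine squeeze_zero (fun _ => norm_nonneg _) (fun s => ?_) hlim
    have hk : ∀ r, Continuous fun x => nabla K₂ (x + Z r x - (w r).part ℓ) := fun r =>
      h₂.continuous_nabla.comp ((continuous_id_add _).sub continuous_const)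
    have hi : ∀ r (q : Lp (State d) 2 μ₀), Integrable
        (fun x => nabla K₂ (x + Z r x - (w r).part ℓ) (q x)) μ₀ := fun r q =>
      integrable_clm_apply (hk r) (fun x => h₂.norm_nabla_le _) q
    have e : ∫ x, nabla K₂ (x + Z s x - (w s).part ℓ) (p s x) ∂μ₀
          - ∫ x, nabla K₂ (x + Z t x - (w t).part ℓ) (p t x) ∂μ₀
        = ∫ x, (nabla K₂ (x + Z s x - (w s).part ℓ) - nabla K₂ (x + Z t x - (w t).part ℓ))
            (p t x) ∂μ₀
          + ∫ x, nabla K₂ (x + Z s x - (w s).part ℓ) ((p s - p t : Lp (State d) 2 μ₀) x) ∂μ₀ := by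
      have e1 : ∫ x, nabla K₂ (x + Z s x - (w s).part ℓ) ((p s - p t : Lp (State d) 2 μ₀) x) ∂μ₀
          = ∫ x, nabla K₂ (x + Z s x - (w s).part ℓ) (p s x) ∂μ₀
            - ∫ x, nabla K₂ (x + Z s x - (w s).part ℓ) (p t x) ∂μ₀ := by
        rw [← integral_sub (hi s _) (hi s _)]
        refine integral_congr_ae ?_
        filter_upwards [Lp.coeFn_sub (p s) (p t)] with x hx
        rw [hx, Pi.sub_apply, map_sub]
      have e2 : ∫ x, (nabla K₂ (x + Z s x - (w s).part ℓ) - nabla K₂ (x + Z t x - (w t).part ℓ))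
            (p t x) ∂μ₀ = ∫ x, nabla K₂ (x + Z s x - (w s).part ℓ) (p t x) ∂μ₀
              - ∫ x, nabla K₂ (x + Z t x - (w t).part ℓ) (p t x) ∂μ₀ :=
        integral_sub (hi s _) (hi t _)
      rw [e1, e2]
      abel
    rw [e]
    refine (norm_add_le _ _).trans (add_le_add ?_ ?_)
    · refine norm_integral_clm_apply_le (by positivity) (fun x => ?_) (p t)
      rw [nabla, nabla, ← map_sub, LinearIsometryEquiv.norm_map]
      have := h₂.lipschitz_fderiv.dist_le_mul (x + Z s x - (w s).part ℓ) (x + Z t x - (w t).part ℓ)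
      rw [dist_eq_norm, dist_eq_norm] at this
      refine this.trans ?_
      gcongr
      have e : x + Z s x - (w s).part ℓ - (x + Z t x - (w t).part ℓ)
          = (Z s - Z t) x - (w s - w t).part ℓ := by
        rw [ControlValue.part_sub, BoundedContinuousFunction.sub_apply]; abel
      rw [e]
      exact (norm_sub_le _ _).trans
        (add_le_add ((Z s - Z t).norm_coe_le_norm x) (ControlValue.norm_part_le _ _))
    · exact norm_integral_clm_apply_le C.coe_nonneg (fun x => h₂.norm_nabla_le _) _
  refine (PiLp.continuous_toLp 2 _).comp (continuous_pi fun q => ?_)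
  exact (EuclideanSpace.proj (𝕜 := ℝ) q.2).continuous.comp (hpart q.1)

end FixedTime

/-! ### The adjoint equation -/

section AdjointEquation
variable {d M L : ℕ} {T : ℝ} {K₁ K₂ : State d → State d} {C : ℝ≥0} {μ₀ : Measure (State d)}
  [IsProbabilityMeasure μ₀] {w : ℝ → ControlValue d M} {Z : ℝ → State d →ᵇ State d}
  {B : ℝ → Lp (State d) 2 μ₀ →L[ℝ] Lp (State d) 2 μ₀} {c p : ℝ → Lp (State d) 2 μ₀}

/-- Narrow continuity: testing with `φ` gives the `L²` inner product of `p t` and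
`x ↦ φ (x + Z t x)`, both of which depend continuously on time. -/
theorem isVectorMeasureCurve_coStateMeasure (hZ : Continuous Z) (hp : Continuous p) :
    IsVectorMeasureCurve T fun t => coStateMeasure (Z t) (p t) := by
  refine ⟨fun t _ => isFiniteMeasure_variation_coStateMeasure _ _, fun φ => ?_⟩
  refine Continuous.continuousOn ?_
  have hm : ∀ t, MemLp (fun x => φ (x + Z t x)) 2 μ₀ := fun t =>
    MemLp.of_bound (φ.continuous.comp (continuous_id_add _)).aestronglyMeasurable ‖φ‖
      (Eventually.of_forall fun x => φ.norm_coe_le_norm _)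
  have hae := fun t => (hm t).coeFn_toLp
  have hc : Continuous fun t => (hm t).toLp := by
    refine continuous_iff_continuousAt.2 fun t => ?_
    refine Lp_tendsto_of_dominated hae (hae t) (memLp_const ‖φ‖)
      (Eventually.of_forall fun s x => φ.norm_coe_le_norm _) (fun x => φ.norm_coe_le_norm _)
      fun x => ?_
    exact (φ.continuous.comp (continuous_const.add
      ((BoundedContinuousFunction.evalCLM ℝ x).continuous.comp hZ))).tendsto t
  have e : (fun t => pairing φ (coStateMeasure (Z t) (p t)))
      = fun t => ⟪(hm t).toLp, p t⟫ := by
    funext t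
    rw [pairing_coStateMeasure (Z t) (p t) φ.continuous φ.norm_coe_le_norm, L2.inner_def]
    refine integral_congr_ae ?_
    filter_upwards [hae t] with x hx
    rw [hx]
  rw [e]
  exact hc.inner hp

/-- The measures built from the adjoint state solve the adjoint equation: with `Φ t` the test field
along the trajectories, the weak form is the integral over `[0,T]` of the derivative of `⟪Φ t, p t⟫`,
in which `⟪Φ t, B† p t⟫ = ⟪B Φ t, p t⟫` yields the terms with the transposed Jacobians. -/
theorem solvesAdjointEq_coStateMeasure (hT : 0 < T) (h₁ : IsKernel K₁ C) (h₂ : IsKernel K₂ C)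
    (hw : Continuous w) (hZ : IsDisplacement K₁ K₂ μ₀ w Z) (hB : IsLinearization K₁ K₂ w Z B)
    (hBc : Continuous B) (hcc : Continuous c)
    (hp : ∀ t, HasDerivAt p (-(B t).adjoint (p t) + c t) t) {j : (Fin L → ℝ) → ℝ}
    {g : Fin L → State d → ℝ} (hg : ∀ i, ContDiff ℝ 1 (g i))
    (hc : ∀ t, c t =ᵐ[μ₀] fun x => costGradient j g (displaced μ₀ (Z t)) (x + Z t x))
    {μ : ℝ → Measure (State d)} (hμ : ∀ t ∈ Icc 0 T, μ t = displaced μ₀ (Z t))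
    {u : ℝ → ControlValue d M} (hu : ∀ t ∈ Icc 0 T, u t = w t) :
    SolvesAdjointEq T K₁ K₂ j g μ u fun t => coStateMeasure (Z t) (p t) := by
  intro φ hφ hφc
  obtain ⟨b, hb⟩ := hφc.exists_bound_of_continuous hφ.continuous
  obtain ⟨b', hb'⟩ := (hφc.fderiv ℝ).exists_bound_of_continuous (hφ.continuous_fderiv one_ne_zero)
  have hv := hZ.isRegularField h₁ h₂ hw
  have hX := hZ.isFlow h₁ h₂
  have hXc := hX.continuous_uncurry hv
  set v : ℝ → State d → State d := fun t => velocity K₁ K₂ (displaced μ₀ (Z t)) (w t) with hvdef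
  have hvX : Continuous fun q : ℝ × State d => v q.1 (q.2 + Z q.1 q.2) :=
    hv.continuous_uncurry.comp (continuous_fst.prodMk hXc)
  have hcX : Continuous fun q : ℝ × State d => φ (q.1, q.2 + Z q.1 q.2) :=
    hφ.continuous.comp (continuous_fst.prodMk hXc)
  have hcG : Continuous fun q : ℝ × State d =>
      fderiv ℝ φ (q.1, q.2 + Z q.1 q.2) (1, v q.1 (q.2 + Z q.1 q.2)) :=
    ((hφ.continuous_fderiv one_ne_zero).comp (continuous_fst.prodMk hXc)).clm_apply
      (continuous_const.prodMk hvX)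
  have hG' : ∀ t x, ‖fderiv ℝ φ (t, x) (1, v t x)‖ ≤ b' * max 1 ((C * (M + 1) : ℝ≥0) : ℝ) :=
    fun t x => by
      refine (ContinuousLinearMap.le_opNorm _ _).trans ?_
      have h0 : 0 ≤ b' := (norm_nonneg _).trans (hb' (t, x))
      gcongr
      · exact hb' _
      · rw [Prod.norm_def]
        exact max_le_max (by simp) (hv.norm_le _ _)
  have hs : ∀ {F : ℝ × State d → State d}, Continuous F → ∀ t, Continuous fun x => F (t, x) :=
    fun hF t => hF.comp (continuous_const.prodMk continuous_id)
  -- The test field along the trajectories, and its time derivative.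
  have hm : ∀ t, MemLp (fun x => φ (t, x + Z t x)) 2 μ₀ := fun t =>
    MemLp.of_bound (hs hcX t).aestronglyMeasurable b (Eventually.of_forall fun x => hb _)
  have hm' : ∀ t, MemLp (fun x => fderiv ℝ φ (t, x + Z t x) (1, v t (x + Z t x))) 2 μ₀ := fun t =>
    MemLp.of_bound (hs hcG t).aestronglyMeasurable _ (Eventually.of_forall fun x => hG' _ _)
  have hae := fun t => (hm t).coeFn_toLp
  have hae' := fun t => (hm' t).coeFn_toLp
  have hder : ∀ t, HasDerivAt (fun t => (hm t).toLp) (hm' t).toLp t :=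
    Lp_hasDerivAt_of_dominated hae hae' (memLp_const _) (fun t x => hG' _ _) fun t x =>
      ((hφ.differentiable one_ne_zero) (t, x + Z t x)).hasFDerivAt.comp_hasDerivAt t
        ((hasDerivAt_id t).prodMk (hX.hasDerivAt x t))
  have hcΦ : Continuous fun t => (hm t).toLp :=
    continuous_iff_continuousAt.2 fun t => (hder t).continuousAt
  have hcΦ' : Continuous fun t => (hm' t).toLp := by
    refine continuous_iff_continuousAt.2 fun t => ?_
    exact Lp_tendsto_of_dominated hae' (hae' t) (memLp_const _)
      (Eventually.of_forall fun s x => hG' _ _) (fun x => hG' _ _)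
      fun x => (hcG.comp (continuous_id.prodMk continuous_const)).tendsto t
  have hpc : Continuous p := continuous_iff_continuousAt.2 fun t => (hp t).continuousAt
  have hq : ∀ t, HasDerivAt (fun t => ⟪(hm t).toLp, p t⟫)
      (⟪(hm' t).toLp, p t⟫ + (-⟪B t (hm t).toLp, p t⟫ + ⟪(hm t).toLp, c t⟫)) t := fun t => by
    convert! (hder t).inner ℝ (hp t) using 1
    rw [inner_add_right, inner_neg_right, ContinuousLinearMap.adjoint_inner_right]
    ring
  have i1 : Continuous fun t => ⟪(hm' t).toLp, p t⟫ := hcΦ'.inner hpc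
  have i2 : Continuous fun t => -⟪B t (hm t).toLp, p t⟫ + ⟪(hm t).toLp, c t⟫ :=
    ((hBc.clm_apply hcΦ).inner hpc).neg.add (hcΦ.inner hcc)
  have hFTC := intervalIntegral.integral_eq_sub_of_hasDerivAt (a := 0) (b := T)
    (fun t _ => hq t) ((i1.add i2).intervalIntegrable _ _)
  rw [intervalIntegral.integral_add (i1.intervalIntegrable _ _) (i2.intervalIntegrable _ _)] at hFTC
  have hcφ : ∀ t, Continuous fun x => φ (t, x) := hs hφ.continuous
  have hpair : ∀ t, pairing (fun x => φ (t, x)) (coStateMeasure (Z t) (p t))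
      = ⟪(hm t).toLp, p t⟫ := fun t => by
    rw [pairing_coStateMeasure (Z t) (p t) (hcφ t) (fun x => hb _), L2.inner_def]
    refine integral_congr_ae ?_
    filter_upwards [hae t] with x hx
    rw [hx]
  have hpair' : ∫ t in (0 : ℝ)..T, pairing (fun x => fderiv ℝ φ (t, x)
        (1, velocity K₁ K₂ (μ t) (u t) x)) (coStateMeasure (Z t) (p t))
      = ∫ t in (0 : ℝ)..T, ⟪(hm' t).toLp, p t⟫ := by
    refine intervalIntegral.integral_congr fun t ht => ?_
    rw [uIcc_of_le hT.le] at ht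
    simp only [hμ t ht, hu t ht]
    rw [pairing_coStateMeasure (Z t) (p t) (f := fun x => fderiv ℝ φ (t, x) (1, v t x)) ?_
      (hG' t), L2.inner_def]
    · refine integral_congr_ae ?_
      filter_upwards [hae' t] with x hx
      rw [hx]
    · exact ((hφ.continuous_fderiv one_ne_zero).comp (continuous_const.prodMk continuous_id)).clm_apply
        (continuous_const.prodMk (lipschitzWith_velocity h₁ h₂ (w t)).continuous)
  rw [hpair T, hpair 0, hpair', ← hFTC, add_sub_cancel_left]
  refine intervalIntegral.integral_congr fun t ht => ?_
  rw [uIcc_of_le hT.le] at ht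
  simp only [hμ t ht, hu t ht]
  have hDv : ∀ x, ‖fderiv ℝ (velocity K₁ K₂ (displaced μ₀ (Z t)) (w t)) x (φ (t, x))‖
      ≤ C * (M + 1) * b := fun x =>
    ContinuousLinearMap.le_of_opNorm_le_of_le _ (norm_fderiv_velocity_le h₁ h₂ (w t) x) (hb _)
  have hDvc : Continuous fun x =>
      fderiv ℝ (velocity K₁ K₂ (displaced μ₀ (Z t)) (w t)) x (φ (t, x)) :=
    (lipschitzWith_fderiv_velocity h₁ h₂ (w t)).continuous.clm_apply (hcφ t)
  have e1 : ⟪B t (hm t).toLp, p t⟫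
      = pairing (fun x => fderiv ℝ (velocity K₁ K₂ (displaced μ₀ (Z t)) (w t)) x (φ (t, x)))
          (coStateMeasure (Z t) (p t))
        + ∫ x, ⟪φ (t, x), matIntegral (fun y => nabla K₁ (y - x)) (coStateMeasure (Z t) (p t))⟫
            ∂(displaced μ₀ (Z t)) := by
    have hkc : Continuous fun q : State d × State d =>
        fderiv ℝ K₁ (q.1 + Z t q.1 - (q.2 + Z t q.2)) (φ (t, q.2 + Z t q.2)) :=
      (h₁.lipschitz_fderiv.continuous.comp (((continuous_id_add (Z t)).comp continuous_fst).sub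
        ((continuous_id_add (Z t)).comp continuous_snd))).clm_apply
        ((hcφ t).comp ((continuous_id_add (Z t)).comp continuous_snd))
    have hkb : ∀ x y, ‖fderiv ℝ K₁ (x + Z t x - (y + Z t y)) (φ (t, y + Z t y))‖ ≤ C * b :=
      fun x y => ContinuousLinearMap.le_of_opNorm_le_of_le _ (h₁.norm_fderiv_le _) (hb _)
    have hnl : Continuous fun x =>
        ∫ y, fderiv ℝ K₁ (x + Z t x - (y + Z t y)) (φ (t, y + Z t y)) ∂μ₀ :=
      continuous_of_dominated (bound := fun _ => C * b)
        (fun x => (hkc.comp (continuous_const.prodMk continuous_id)).aestronglyMeasurable)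
        (fun x => Eventually.of_forall fun y => hkb x y) (integrable_const _)
        (Eventually.of_forall fun y => hkc.comp (continuous_id.prodMk continuous_const))
    have hnlb : ∀ x, ‖∫ y, fderiv ℝ K₁ (x + Z t x - (y + Z t y)) (φ (t, y + Z t y)) ∂μ₀‖
        ≤ C * b := fun x => by
      simpa using norm_integral_le_of_norm_le_const (μ := μ₀) (Eventually.of_forall (hkb x))
    have hpi : ∀ {f : State d → State d}, Continuous f → ∀ {a : ℝ}, (∀ x, ‖f x‖ ≤ a) →
        Integrable (fun x => ⟪f x, p t x⟫) μ₀ := fun {f} hf {a} ha => by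
      refine ((Lp_integrable (p t)).norm.const_mul a).mono'
        (hf.aestronglyMeasurable.inner (Lp.aestronglyMeasurable (p t)))
        (Eventually.of_forall fun x => (norm_inner_le_norm _ _).trans ?_)
      gcongr
      exact ha x
    rw [integral_inner_matIntegral h₁ (Z t) (p t) (hcφ t) (fun x => hb _),
      pairing_coStateMeasure (Z t) (p t) hDvc hDv, L2.inner_def]
    simp only [real_inner_comm _ (p t _)]
    have hDvi : Integrable (fun x => ⟪fderiv ℝ (velocity K₁ K₂ (displaced μ₀ (Z t)) (w t))
        (x + Z t x) (φ (t, x + Z t x)), p t x⟫) μ₀ :=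
      hpi (hDvc.comp (continuous_id_add (Z t))) fun x => hDv _
    rw [← integral_add hDvi (hpi hnl hnlb)]
    refine integral_congr_ae ?_
    filter_upwards [hB t (hm t).toLp, hae t] with x hx1 hx2
    have e : ∫ y, fderiv ℝ K₁ (x + Z t x - (y + Z t y)) (((hm t).toLp _ : State d → State d) y) ∂μ₀
        = ∫ y, fderiv ℝ K₁ (x + Z t x - (y + Z t y)) (φ (t, y + Z t y)) ∂μ₀ := by
      refine integral_congr_ae ?_
      filter_upwards [hae t] with y hy
      rw [hy]
    rw [hx1, hx2, e, inner_add_left]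
  have e2 : ⟪(hm t).toLp, c t⟫
      = ∫ x, ⟪φ (t, x), costGradient j g (displaced μ₀ (Z t)) x⟫ ∂(displaced μ₀ (Z t)) := by
    have hcg : Continuous (costGradient j g (displaced μ₀ (Z t))) := by
      have := fun i => continuous_gradient (hg i)
      unfold costGradient
      fun_prop
    have := integral_map (μ := μ₀) (φ := fun x => x + Z t x) (continuous_id_add (Z t)).aemeasurable
      (f := fun x => ⟪φ (t, x), costGradient j g (displaced μ₀ (Z t)) x⟫)
      ((hcφ t).inner hcg).aestronglyMeasurable
    refine Eq.trans ?_ this.symm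
    rw [L2.inner_def]
    refine integral_congr_ae ?_
    filter_upwards [hae t, hc t] with x h1 h2
    rw [h1, h2]
  rw [e1, e2]
  ring

end AdjointEquation

/-! ### The first variation of the running cost -/

section Variation
variable {d M : ℕ} {T : ℝ} {K₁ K₂ : State d → State d} {C : ℝ≥0} {μ₀ : Measure (State d)}
  [IsProbabilityMeasure μ₀]

theorem velocity_displaced {ν : Measure (State d)} (h₁ : IsKernel K₁ C) (Z : State d →ᵇ State d)
    (c : ControlValue d M) (a : State d) : velocity K₁ K₂ (displaced ν Z) c a
      = -(∫ y, K₁ (a - (y + Z y)) ∂ν) - ∑ ℓ, K₂ (a - c.part ℓ) := by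
  rw [velocity]
  congr 2
  exact integral_map (continuous_id_add Z).aemeasurable
    (h₁.lipschitzWith.continuous.comp (continuous_const.sub continuous_id)).aestronglyMeasurable

theorem fderiv_velocity_displaced_apply (h₁ : IsKernel K₁ C) (h₂ : IsKernel K₂ C)
    (Z : State d →ᵇ State d) (c : ControlValue d M) (a b : State d) :
    fderiv ℝ (velocity K₁ K₂ (displaced μ₀ Z) c) a b
      = -(∫ y, fderiv ℝ K₁ (a - (y + Z y)) b ∂μ₀) - ∑ ℓ, fderiv ℝ K₂ (a - c.part ℓ) b := by
  have hi := integrable_sub_left (μ := displaced μ₀ Z) h₁.lipschitz_fderiv h₁.norm_fderiv_le a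
  have e : (∫ y, fderiv ℝ K₁ (a - y) ∂(displaced μ₀ Z)) b
      = ∫ y, fderiv ℝ K₁ (a - (y + Z y)) b ∂μ₀ := by
    rw [ContinuousLinearMap.integral_apply hi]
    exact integral_map (continuous_id_add Z).aemeasurable
      (((h₁.lipschitz_fderiv.continuous.comp (continuous_const.sub continuous_id))).clm_apply
        continuous_const).aestronglyMeasurable
  rw [fderiv_velocity h₁ h₂]
  simp only [sub_apply, neg_apply, e, FunLike.coe_sum, Finset.sum_apply]

/-- The linearization of the dynamics with respect to the displacement and the control, with a
quadratic error. -/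
theorem norm_velocity_sub_linearization_le (h₁ : IsKernel K₁ C) (h₂ : IsKernel K₂ C)
    (Z Z' : State d →ᵇ State d) (c c' : ControlValue d M) (x : State d) :
    ‖velocity K₁ K₂ (displaced μ₀ Z') c' (x + Z' x) - velocity K₁ K₂ (displaced μ₀ Z) c (x + Z x)
      - (fderiv ℝ (velocity K₁ K₂ (displaced μ₀ Z) c) (x + Z x) ((Z' - Z) x)
        + ∫ y, fderiv ℝ K₁ (x + Z x - (y + Z y)) ((Z' - Z) y) ∂μ₀)
      - controlSource K₂ c (c' - c) (x + Z x)‖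
    ≤ C * (M + 4) * (‖Z' - Z‖ + ‖c' - c‖) ^ 2 := by
  have hX := fun Z : State d →ᵇ State d => continuous_id_add Z
  have i1 : ∀ Z : State d →ᵇ State d, Integrable (fun y => K₁ (x + Z x - (y + Z y))) μ₀ := fun Z =>
    integrable_of_continuous_of_norm_le
      (h₁.lipschitzWith.continuous.comp (continuous_const.sub (hX Z))) fun y => h₁.norm_le _
  have hDc : Continuous fun y => fderiv ℝ K₁ (x + Z x - (y + Z y)) :=
    h₁.lipschitz_fderiv.continuous.comp (continuous_const.sub (hX Z))
  have i2 : ∀ H : State d →ᵇ State d,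
      Integrable (fun y => fderiv ℝ K₁ (x + Z x - (y + Z y)) (H y)) μ₀ := fun H =>
    integrable_of_continuous_of_norm_le (hDc.clm_apply H.continuous) fun y =>
      ContinuousLinearMap.le_of_opNorm_le_of_le _ (h₁.norm_fderiv_le _) (H.norm_coe_le_norm y)
  have i3 : Integrable (fun y => fderiv ℝ K₁ (x + Z x - (y + Z y)) ((Z' - Z) x)) μ₀ :=
    integrable_of_continuous_of_norm_le (hDc.clm_apply continuous_const) fun y =>
      ContinuousLinearMap.le_of_opNorm_le _ (h₁.norm_fderiv_le _) _
  -- The remainders of the Taylor expansions of the two kernels.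
  set R₁ : State d → State d := fun y => K₁ (x + Z' x - (y + Z' y)) - K₁ (x + Z x - (y + Z y))
    - fderiv ℝ K₁ (x + Z x - (y + Z y)) ((x + Z' x - (y + Z' y)) - (x + Z x - (y + Z y))) with hR₁
  set R₂ : Fin M → State d := fun ℓ => K₂ (x + Z' x - c'.part ℓ) - K₂ (x + Z x - c.part ℓ)
    - fderiv ℝ K₂ (x + Z x - c.part ℓ) ((x + Z' x - c'.part ℓ) - (x + Z x - c.part ℓ)) with hR₂
  have e1 : ∫ y, R₁ y ∂μ₀ = ∫ y, K₁ (x + Z' x - (y + Z' y)) ∂μ₀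
      - ∫ y, K₁ (x + Z x - (y + Z y)) ∂μ₀
      - (∫ y, fderiv ℝ K₁ (x + Z x - (y + Z y)) ((Z' - Z) x) ∂μ₀
        - ∫ y, fderiv ℝ K₁ (x + Z x - (y + Z y)) ((Z' - Z) y) ∂μ₀) := by
    have i4 : Integrable (fun y => K₁ (x + Z' x - (y + Z' y)) - K₁ (x + Z x - (y + Z y))) μ₀ :=
      (i1 Z').sub (i1 Z)
    have i5 : Integrable (fun y => fderiv ℝ K₁ (x + Z x - (y + Z y)) ((Z' - Z) x)
        - fderiv ℝ K₁ (x + Z x - (y + Z y)) ((Z' - Z) y)) μ₀ := i3.sub (i2 _)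
    rw [← integral_sub (i1 Z') (i1 Z), ← integral_sub i3 (i2 _), ← integral_sub i4 i5]
    refine integral_congr_ae (Eventually.of_forall fun y => ?_)
    simp only [hR₁, ← map_sub]
    congr 2
    simp only [BoundedContinuousFunction.sub_apply]
    abel
  have e2 : ∑ ℓ, R₂ ℓ = ∑ ℓ, K₂ (x + Z' x - c'.part ℓ) - ∑ ℓ, K₂ (x + Z x - c.part ℓ)
      - (∑ ℓ, fderiv ℝ K₂ (x + Z x - c.part ℓ) ((Z' - Z) x)
        - controlSource K₂ c (c' - c) (x + Z x)) := by
    simp only [controlSource, ← Finset.sum_sub_distrib]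
    refine Finset.sum_congr rfl fun ℓ _ => ?_
    simp only [hR₂, ← map_sub]
    congr 2
    simp only [BoundedContinuousFunction.sub_apply, ControlValue.part_sub]
    abel
  have hZx : ∀ y, ‖(Z' - Z) y‖ ≤ ‖Z' - Z‖ := (Z' - Z).norm_coe_le_norm
  have b1 : ‖∫ y, R₁ y ∂μ₀‖ ≤ C * (2 * ‖Z' - Z‖) ^ 2 := by
    have := norm_integral_le_of_norm_le_const (μ := μ₀) (f := R₁) (C := C * (2 * ‖Z' - Z‖) ^ 2)
      (Eventually.of_forall fun y => ?_)
    · simpa using this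
    · refine (norm_sub_sub_fderiv_le h₁.differentiable h₁.lipschitz_fderiv _ _).trans ?_
      have e : x + Z' x - (y + Z' y) - (x + Z x - (y + Z y)) = (Z' - Z) x - (Z' - Z) y := by
        simp only [BoundedContinuousFunction.sub_apply]; abel
      rw [e]
      gcongr
      exact (norm_sub_le _ _).trans (by linarith [hZx x, hZx y])
  have b2 : ‖∑ ℓ, R₂ ℓ‖ ≤ M * (C * (‖Z' - Z‖ + ‖c' - c‖) ^ 2) := by
    have : ‖∑ ℓ, R₂ ℓ‖ ≤ ∑ _ℓ : Fin M, C * (‖Z' - Z‖ + ‖c' - c‖) ^ 2 :=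
      norm_sum_le_of_le _ fun ℓ _ => by
        refine (norm_sub_sub_fderiv_le h₂.differentiable h₂.lipschitz_fderiv _ _).trans ?_
        have e : x + Z' x - c'.part ℓ - (x + Z x - c.part ℓ) = (Z' - Z) x - (c' - c).part ℓ := by
          simp only [BoundedContinuousFunction.sub_apply, ControlValue.part_sub]; abel
        rw [e]
        gcongr
        exact (norm_sub_le _ _).trans (add_le_add (hZx x) (ControlValue.norm_part_le _ _))
    simpa using this
  have e : velocity K₁ K₂ (displaced μ₀ Z') c' (x + Z' x)
        - velocity K₁ K₂ (displaced μ₀ Z) c (x + Z x)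
      - (fderiv ℝ (velocity K₁ K₂ (displaced μ₀ Z) c) (x + Z x) ((Z' - Z) x)
        + ∫ y, fderiv ℝ K₁ (x + Z x - (y + Z y)) ((Z' - Z) y) ∂μ₀)
      - controlSource K₂ c (c' - c) (x + Z x) = -(∫ y, R₁ y ∂μ₀) - ∑ ℓ, R₂ ℓ := by
    rw [e1, e2, velocity_displaced h₁, velocity_displaced h₁,
      fderiv_velocity_displaced_apply h₁ h₂]
    abel
  rw [e]
  refine (norm_sub_le _ _).trans ?_
  rw [norm_neg]
  have h3 : (2 * ‖Z' - Z‖) ^ 2 ≤ 4 * (‖Z' - Z‖ + ‖c' - c‖) ^ 2 := by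
    nlinarith [norm_nonneg (Z' - Z), norm_nonneg (c' - c)]
  nlinarith [mul_le_mul_of_nonneg_left h3 C.coe_nonneg]

theorem continuous_displacementField_comp (h₁ : IsKernel K₁ C) (h₂ : IsKernel K₂ C)
    {Z : ℝ → State d →ᵇ State d} (hZ : Continuous Z) {w : ℝ → ControlValue d M}
    (hw : Continuous w) :
    Continuous fun t => displacementField K₁ K₂ (displaced μ₀ (Z t)) (w t) (Z t) := by
  refine continuous_iff_continuousAt.2 fun t => ?_
  rw [ContinuousAt, tendsto_iff_norm_sub_tendsto_zero]
  have l1 := tendsto_iff_norm_sub_tendsto_zero.1 (hZ.tendsto t)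
  have l2 := tendsto_iff_norm_sub_tendsto_zero.1 (hw.tendsto t)
  have hlim : Tendsto (fun s => C * (M + 2) * ‖Z s - Z t‖ + C * (M + 1) * ‖w s - w t‖)
      (𝓝 t) (𝓝 0) := by
    simpa using (l1.const_mul (C * (M + 2 : ℝ))).add (l2.const_mul (C * (M + 1 : ℝ)))
  exact squeeze_zero (fun _ => norm_nonneg _)
    (fun s => norm_displacementField_displaced_sub_le h₁ h₂ _ _ _ _) hlim

variable {w w' : ℝ → ControlValue d M} {Z Z' : ℝ → State d →ᵇ State d}
  {B : ℝ → Lp (State d) 2 μ₀ →L[ℝ] Lp (State d) 2 μ₀} {c p : ℝ → Lp (State d) 2 μ₀}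

/-- The remainder of the linearized dynamics, tested with the adjoint state. -/
theorem norm_inner_sub_linearization_le (h₁ : IsKernel K₁ C) (h₂ : IsKernel K₂ C)
    (hB : IsLinearization K₁ K₂ w Z B) (t : ℝ) :
    ‖⟪p t, toL2 μ₀ (displacementField K₁ K₂ (displaced μ₀ (Z' t)) (w' t) (Z' t)
        - displacementField K₁ K₂ (displaced μ₀ (Z t)) (w t) (Z t)) - B t (toL2 μ₀ (Z' t - Z t))⟫
      - ⟪controlForce K₂ (coStateMeasure (Z t) (p t)) (w t), w' t - w t⟫‖
    ≤ ‖p t‖ * (C * (M + 4) * (‖Z' t - Z t‖ + ‖w' t - w t‖) ^ 2) := by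
  have hm : MemLp (fun x => controlSource K₂ (w t) (w' t - w t) (x + Z t x)) 2 μ₀ :=
    MemLp.of_bound ((continuous_controlSource h₂ _ _).comp
      (continuous_id_add (Z t))).aestronglyMeasurable _
      (Eventually.of_forall fun x => norm_controlSource_le h₂ _ _ _)
  have hS : ⟪controlForce K₂ (coStateMeasure (Z t) (p t)) (w t), w' t - w t⟫
      = ⟪p t, hm.toLp⟫ := by
    rw [inner_controlForce h₂, L2.inner_def]
    refine integral_congr_ae ?_
    filter_upwards [hm.coeFn_toLp] with x hx
    rw [hx]
  rw [hS, ← inner_sub_right]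
  refine (norm_inner_le_norm _ _).trans (mul_le_mul_of_nonneg_left ?_ (norm_nonneg _))
  set D := displacementField K₁ K₂ (displaced μ₀ (Z' t)) (w' t) (Z' t)
        - displacementField K₁ K₂ (displaced μ₀ (Z t)) (w t) (Z t) with hD
  have hδ := toL2_ae_eq (μ₀ := μ₀) (Z' t - Z t)
  have := Lp_norm_le_of_ae_le (f := toL2 μ₀ D - B t (toL2 μ₀ (Z' t - Z t)) - hm.toLp)
    (g := p t) (a := 0) (b := C * (M + 4) * (‖Z' t - Z t‖ + ‖w' t - w t‖) ^ 2) le_rfl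
    (by positivity) (by
      filter_upwards [Lp.coeFn_sub (toL2 μ₀ D - B t (toL2 μ₀ (Z' t - Z t))) hm.toLp,
        Lp.coeFn_sub (toL2 μ₀ D) (B t (toL2 μ₀ (Z' t - Z t))), hm.coeFn_toLp,
        toL2_ae_eq (μ₀ := μ₀) D, hB t (toL2 μ₀ (Z' t - Z t)), hδ] with x a1 a2 a3 a4 a5 a6
      have a7 : ∫ y, fderiv ℝ K₁ (x + Z t x - (y + Z t y)) ((toL2 μ₀ (Z' t - Z t)) y) ∂μ₀
          = ∫ y, fderiv ℝ K₁ (x + Z t x - (y + Z t y)) ((Z' t - Z t) y) ∂μ₀ := by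
        refine integral_congr_ae ?_
        filter_upwards [hδ] with y hy
        rw [hy]
      rw [a1, Pi.sub_apply, a2, Pi.sub_apply, a3, a4, a5, a6, a7, hD,
        BoundedContinuousFunction.sub_apply, displacementField_apply h₁ h₂,
        displacementField_apply h₁ h₂, zero_mul, zero_add]
      exact norm_velocity_sub_linearization_le h₁ h₂ _ _ _ _ x)
  simpa using this

/-- Duality between the linearized dynamics and the adjoint state: the first variation of the
running cost along a variation of the control, up to a quadratic error. -/
theorem norm_integral_inner_add_le (hT : 0 ≤ T) (h₁ : IsKernel K₁ C) (h₂ : IsKernel K₂ C)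
    (hw : Continuous w) (hw' : Continuous w') (hZ : IsDisplacement K₁ K₂ μ₀ w Z)
    (hZ' : IsDisplacement K₁ K₂ μ₀ w' Z') (hB : IsLinearization K₁ K₂ w Z B)
    (hBc : Continuous B) (hcc : Continuous c) (hpT : p T = 0)
    (hp : ∀ t, HasDerivAt p (-(B t).adjoint (p t) + c t) t) {P ρ : ℝ}
    (hP : ∀ t ∈ Icc 0 T, ‖p t‖ ≤ P)
    (hρ : ∀ t ∈ Icc 0 T, ‖Z' t - Z t‖ + ‖w' t - w t‖ ≤ ρ) :
    ‖(∫ t in (0 : ℝ)..T, ⟪c t, toL2 μ₀ (Z' t - Z t)⟫)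
      + ∫ t in (0 : ℝ)..T, ⟪controlForce K₂ (coStateMeasure (Z t) (p t)) (w t), w' t - w t⟫‖
    ≤ P * (C * (M + 4) * ρ ^ 2) * T := by
  have hpc : Continuous p := continuous_iff_continuousAt.2 fun t => (hp t).continuousAt
  have hδ : ∀ t, HasDerivAt (fun t => toL2 μ₀ (Z' t - Z t))
      (toL2 μ₀ (displacementField K₁ K₂ (displaced μ₀ (Z' t)) (w' t) (Z' t)
        - displacementField K₁ K₂ (displaced μ₀ (Z t)) (w t) (Z t))) t := fun t =>
    (toL2 μ₀).hasFDerivAt.comp_hasDerivAt t ((hZ'.hasDerivAt t).sub (hZ.hasDerivAt t))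
  set D : ℝ → Lp (State d) 2 μ₀ := fun t =>
    toL2 μ₀ (displacementField K₁ K₂ (displaced μ₀ (Z' t)) (w' t) (Z' t)
        - displacementField K₁ K₂ (displaced μ₀ (Z t)) (w t) (Z t)) with hD
  set δ : ℝ → Lp (State d) 2 μ₀ := fun t => toL2 μ₀ (Z' t - Z t) with hδdef
  set F : ℝ → ℝ := fun t =>
    ⟪controlForce K₂ (coStateMeasure (Z t) (p t)) (w t), w' t - w t⟫ with hF
  have hDc : Continuous D := (toL2 μ₀).continuous.comp
    ((continuous_displacementField_comp h₁ h₂ hZ'.continuous hw').sub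
      (continuous_displacementField_comp h₁ h₂ hZ.continuous hw))
  have hδc : Continuous δ := (toL2 μ₀).continuous.comp (hZ'.continuous.sub hZ.continuous)
  have hFc : Continuous F :=
    (continuous_controlForce h₂ hZ.continuous hpc hw).inner (hw'.sub hw)
  have hRc : Continuous fun t => ⟪p t, D t - B t (δ t)⟫ - F t :=
    (hpc.inner (hDc.sub (hBc.clm_apply hδc))).sub hFc
  have hq : ∀ t, HasDerivAt (fun t => ⟪p t, δ t⟫)
      (⟪c t, δ t⟫ + F t + (⟪p t, D t - B t (δ t)⟫ - F t)) t := fun t => by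
    convert! (hp t).inner ℝ (hδ t) using 1
    rw [inner_add_left, inner_neg_left, ContinuousLinearMap.adjoint_inner_left, inner_sub_right]
    ring
  have hcδ : Continuous fun t => ⟪c t, δ t⟫ := hcc.inner hδc
  have hFTC := intervalIntegral.integral_eq_sub_of_hasDerivAt (a := 0) (b := T)
    (fun t _ => hq t) (((hcδ.add hFc).add hRc).intervalIntegrable _ _)
  have hsum : Continuous fun t => ⟪c t, δ t⟫ + F t := hcδ.add hFc
  have h0 : δ 0 = 0 := by simp [hδdef, hZ.zero, hZ'.zero]
  rw [hpT, h0, inner_zero_left, inner_zero_right, sub_zero,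
    intervalIntegral.integral_add (hsum.intervalIntegrable _ _)
      (hRc.intervalIntegrable _ _), intervalIntegral.integral_add (hcδ.intervalIntegrable _ _)
      (hFc.intervalIntegrable _ _)] at hFTC
  rw [eq_neg_of_add_eq_zero_left hFTC, norm_neg]
  refine (intervalIntegral.norm_integral_le_of_norm_le_const (C := P * (C * (M + 4) * ρ ^ 2))
    fun t ht => ?_).trans (by rw [sub_zero, abs_of_nonneg hT])
  rw [uIoc_of_le hT] at ht
  have ht' := Ioc_subset_Icc_self ht
  refine (norm_inner_sub_linearization_le h₁ h₂ hB t).trans ?_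
  have hP0 := (norm_nonneg _).trans (hP t ht')
  have := hρ t ht'
  have := hP t ht'
  gcongr

/-- The running cost is differentiable along variations of the control, with a derivative given by
the adjoint state. -/
theorem hasDerivAt_runningCost (hT : 0 ≤ T) (h₁ : IsKernel K₁ C) (h₂ : IsKernel K₂ C)
    (hw : Continuous w) (hZ : IsDisplacement K₁ K₂ μ₀ w Z) (hB : IsLinearization K₁ K₂ w Z B)
    (hBc : Continuous B) {J : (State d →ᵇ State d) → ℝ}
    {γ : (State d →ᵇ State d) → Lp (State d) 2 μ₀} (hγc : Continuous γ)
    (hJ : ∀ Z, HasFDerivAt J (innerSL ℝ (γ Z) ∘L toL2 μ₀) Z) (hpT : p T = 0)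
    (hp : ∀ t, HasDerivAt p (-(B t).adjoint (p t) + γ (Z t)) t) {h : ℝ → ControlValue d M}
    (hh : Continuous h) {H : ℝ} (hH : ∀ t, ‖h t‖ ≤ H) {Zf : ℝ → ℝ → State d →ᵇ State d}
    (hZf : ∀ ε, IsDisplacement K₁ K₂ μ₀ (fun t => w t + ε • h t) (Zf ε)) :
    HasDerivAt (fun ε => ∫ t in (0 : ℝ)..T, J (Zf ε t))
      (-∫ t in (0 : ℝ)..T, ⟪controlForce K₂ (coStateMeasure (Z t) (p t)) (w t), h t⟫) 0 := by
  have hH0 : 0 ≤ H := (norm_nonneg _).trans (hH 0)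
  have hpc : Continuous p := continuous_iff_continuousAt.2 fun t => (hp t).continuousAt
  have hZc := hZ.continuous
  have hcc : Continuous fun t => γ (Z t) := hγc.comp hZc
  have hJc : Continuous J := continuous_iff_continuousAt.2 fun Z => (hJ Z).continuousAt
  obtain ⟨P, hP⟩ := isCompact_Icc.exists_bound_of_continuousOn (s := Icc 0 T) hpc.continuousOn
  have hP0 : 0 ≤ P := (norm_nonneg _).trans (hP 0 ⟨le_rfl, hT⟩)
  set a : ℝ := gronwallBound 0 (C * (M + 2)) (C * (M + 1)) T with ha
  have hmono : Monotone (gronwallBound 0 (C * (M + 2) : ℝ) (C * (M + 1))) :=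
    gronwallBound_mono le_rfl (by positivity) (by positivity)
  have ha0 : 0 ≤ a := gronwallBound_nonneg le_rfl (by positivity) (by positivity) hT
  have hZd : ∀ ε, ∀ t ∈ Icc 0 T, ‖Zf ε t - Z t‖ ≤ |ε| * (H * a) := fun ε t ht => by
    refine ((hZf ε).norm_sub_le hZ h₁ h₂ (ε := |ε| * H) (fun s => ?_) t).trans ?_
    · rw [add_sub_cancel_left, norm_smul, Real.norm_eq_abs]
      gcongr
      exact hH s
    · rw [mul_assoc]
      gcongr
      exact hmono (by rw [abs_of_nonneg ht.1]; exact ht.2)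
  have hZ0 : ∀ t ∈ Icc 0 T, Zf 0 t = Z t := fun t ht => by
    have := hZd 0 t ht
    rw [abs_zero, zero_mul] at this
    exact sub_eq_zero.1 (norm_le_zero_iff.1 this)
  set κ : ℝ := P * (C * (M + 4) * (H * a + H) ^ 2) * T with hκ
  have hκ0 : 0 ≤ κ := by positivity
  rw [hasDerivAt_iff_isLittleO, Asymptotics.isLittleO_iff]
  intro η hη
  -- The first order expansion of `J` is uniform along the compact trajectory of `Z` on `[0,T]`.
  obtain ⟨r, hr, hr'⟩ := exists_norm_sub_sub_le_of_isCompact hJ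
    (((innerSL ℝ).continuous.comp hγc).clm_comp continuous_const)
    ((isCompact_Icc (a := (0 : ℝ)) (b := T)).image hZc)
    (η := η / (2 * (H * a * T + 1))) (by positivity)
  have hev1 : ∀ᶠ ε : ℝ in 𝓝 0, |ε| * (H * a) < r := by
    have : Tendsto (fun ε : ℝ => |ε| * (H * a)) (𝓝 0) (𝓝 (|0| * (H * a))) :=
      (continuous_abs.mul continuous_const).tendsto 0
    rw [abs_zero, zero_mul] at this
    exact this.eventually_lt_const hr
  have hev2 : ∀ᶠ ε : ℝ in 𝓝 0, |ε| * κ < η / 2 := by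
    have : Tendsto (fun ε : ℝ => |ε| * κ) (𝓝 0) (𝓝 (|0| * κ)) :=
      (continuous_abs.mul continuous_const).tendsto 0
    rw [abs_zero, zero_mul] at this
    exact this.eventually_lt_const (by positivity)
  filter_upwards [hev1, hev2] with ε he1 he2
  have hZfc := (hZf ε).continuous
  have hwε : Continuous fun t => w t + ε • h t := hw.add (hh.const_smul ε)
  have hmain := norm_integral_inner_add_le (c := fun t => γ (Z t)) (P := P)
    (ρ := |ε| * (H * a + H)) hT h₁ h₂ hw hwε hZ (hZf ε) hB hBc hcc hpT hp hP
    (fun t ht => by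
      rw [mul_add]
      refine add_le_add (hZd ε t ht) ?_
      rw [add_sub_cancel_left, norm_smul, Real.norm_eq_abs]
      gcongr
      exact hH t)
  simp only [add_sub_cancel_left, inner_smul_right] at hmain
  rw [intervalIntegral.integral_const_mul] at hmain
  set I := ∫ t in (0 : ℝ)..T, ⟪controlForce K₂ (coStateMeasure (Z t) (p t)) (w t), h t⟫
  set I' := ∫ t in (0 : ℝ)..T, ⟪γ (Z t), toL2 μ₀ (Zf ε t - Z t)⟫
  have i1 : Continuous fun t => J (Zf ε t) := hJc.comp hZfc
  have i2 : Continuous fun t => J (Z t) := hJc.comp hZc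
  have i3 : Continuous fun t => ⟪γ (Z t), toL2 μ₀ (Zf ε t - Z t)⟫ :=
    hcc.inner ((toL2 μ₀).continuous.comp (hZfc.sub hZc))
  have e0 : ∫ t in (0 : ℝ)..T, J (Zf 0 t) = ∫ t in (0 : ℝ)..T, J (Z t) :=
    intervalIntegral.integral_congr fun t ht => by
      rw [uIcc_of_le hT] at ht
      simp only [hZ0 t ht]
  have hexp : ‖(∫ t in (0 : ℝ)..T, J (Zf ε t)) - (∫ t in (0 : ℝ)..T, J (Z t)) - I'‖
      ≤ η / 2 * |ε| := by
    have i12 : Continuous fun t => J (Zf ε t) - J (Z t) := i1.sub i2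
    rw [← intervalIntegral.integral_sub (i1.intervalIntegrable _ _) (i2.intervalIntegrable _ _)]
    change ‖_ - ∫ t in (0 : ℝ)..T, ⟪γ (Z t), toL2 μ₀ (Zf ε t - Z t)⟫‖ ≤ _
    rw [← intervalIntegral.integral_sub (i12.intervalIntegrable _ _) (i3.intervalIntegrable _ _)]
    refine (intervalIntegral.norm_integral_le_of_norm_le_const
      (C := η / (2 * (H * a * T + 1)) * (|ε| * (H * a))) fun t ht => ?_).trans ?_
    · rw [uIoc_of_le hT] at ht
      have ht' := Ioc_subset_Icc_self ht
      have := hr' (Z t) (mem_image_of_mem _ ht') (Zf ε t) ((hZd ε t ht').trans_lt he1)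
      rw [ContinuousLinearMap.comp_apply, innerSL_apply_apply] at this
      refine this.trans ?_
      have := hZd ε t ht'
      gcongr
    · rw [sub_zero, abs_of_nonneg hT]
      have hpos : 0 < H * a * T + 1 := by positivity
      have : η / (2 * (H * a * T + 1)) * (|ε| * (H * a)) * T
          = η / 2 * |ε| * ((H * a * T) / (H * a * T + 1)) := by
        field_simp
      rw [this]
      refine mul_le_of_le_one_right (by positivity) ?_
      rw [div_le_one hpos]
      linarith
  have e : (∫ t in (0 : ℝ)..T, J (Zf ε t)) - (∫ t in (0 : ℝ)..T, J (Zf 0 t)) - (ε - 0) • (-I)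
      = ((∫ t in (0 : ℝ)..T, J (Zf ε t)) - (∫ t in (0 : ℝ)..T, J (Z t)) - I')
        + (I' + ε * I) := by
    rw [e0, smul_eq_mul]
    ring
  have hκε : P * (C * (M + 4) * (|ε| * (H * a + H)) ^ 2) * T = |ε| * (|ε| * κ) := by
    rw [hκ]; ring
  rw [hκε] at hmain
  rw [e]
  refine (norm_add_le _ _).trans ((add_le_add hexp hmain).trans ?_)
  rw [sub_zero, Real.norm_eq_abs]
  nlinarith [abs_nonneg ε]

end Variation

/-! ### The optimality condition -/

section Optimality
variable {d M L : ℕ} {T lam : ℝ} {K₁ K₂ : State d → State d} {C : ℝ≥0} {μ₀ : Measure (State d)}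
  {Z : ℝ → State d →ᵇ State d} {u : H1Control T d M}

theorem H1Control.exists_norm_extend_le (hT : 0 ≤ T) (u : H1Control T d M) :
    ∃ H, ∀ t, ‖u.extend t‖ ≤ H := by
  obtain ⟨H, hH⟩ := isCompact_Icc.exists_bound_of_continuousOn (u.continuousOn_eval hT)
  exact ⟨H, fun t => hH _ (clamp_mem hT t)⟩

theorem H1Control.extend_add_smul (hT : 0 ≤ T) (u h : H1Control T d M) (ε : ℝ) (t : ℝ) :
    (u + ε • h).extend t = u.extend t + ε • h.extend t :=
  u.eval_add_smul h ε (clamp_mem hT t)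

/-- The first order optimality condition: the derivative of the cost along every admissible
variation of the control vanishes. -/
theorem IsOptimalPair.gateaux_eq [IsProbabilityMeasure μ₀] (hT : 0 < T) (h₁ : IsKernel K₁ C)
    (h₂ : IsKernel K₂ C) (hμ₀ : MemP2 μ₀) {j : (Fin L → ℝ) → ℝ} {g : Fin L → State d → ℝ}
    {J₂ : H1Control T d M → ℝ} {u₀ : ControlValue d M} {μ : ℝ → Measure (State d)}
    (hopt : IsOptimalPair T lam K₁ K₂ j g J₂ μ₀ u₀ μ u) {dJ₂ : H1Control T d M →L[ℝ] ℝ}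
    (hdJ₂ : IsGateauxDerivAt J₂ dJ₂ u) (hZ : IsDisplacement K₁ K₂ μ₀ u.extend Z)
    {B : ℝ → Lp (State d) 2 μ₀ →L[ℝ] Lp (State d) 2 μ₀}
    (hB : IsLinearization K₁ K₂ u.extend Z B) (hBc : Continuous B)
    {γ : (State d →ᵇ State d) → Lp (State d) 2 μ₀} (hγc : Continuous γ)
    (hJ : ∀ Z, HasFDerivAt (fun Z => j (moments g (displaced μ₀ Z)))
      (innerSL ℝ (γ Z) ∘L toL2 μ₀) Z) {p : ℝ → Lp (State d) 2 μ₀} (hpT : p T = 0)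
    (hp : ∀ t, HasDerivAt p (-(B t).adjoint (p t) + γ (Z t)) t)
    (h : H1Control T d M) (hh : h.eval 0 = 0) :
    lam * dJ₂ h = ∫ t in (0 : ℝ)..T,
      ⟪controlForce K₂ (coStateMeasure (Z t) (p t)) (u.extend t), h.extend t⟫ := by
  obtain ⟨hadm, hmin⟩ := hopt
  obtain ⟨H, hH⟩ := h.exists_norm_extend_le hT.le
  choose Zf hZf using fun ε : ℝ => exists_isDisplacement μ₀ h₁ h₂
    ((u + ε • h).continuous_extend hT.le)
  have hder := hasDerivAt_runningCost hT.le h₁ h₂ (u.continuous_extend hT.le) hZ hB hBc hγc hJ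
    hpT hp (h.continuous_extend hT.le) hH (Zf := Zf) fun ε => by
      have := hZf ε
      rwa [show (u + ε • h).extend = fun t => u.extend t + ε • h.extend t from
        funext (u.extend_add_smul hT.le h ε)] at this
  have hd := hder.add ((hdJ₂ h hh).const_mul lam)
  have heq : ∀ t ∈ Icc 0 T, μ t = displaced μ₀ (Zf 0 t) := by
    refine IsDisplacement.eq_displaced (u := u) ?_ hT h₁ h₂ hadm
    simpa using hZf 0
  -- The competitor with the control `u + ε h` is admissible, so `ε = 0` minimizes the cost.
  have hloc : IsLocalMin (fun ε : ℝ => (∫ t in (0 : ℝ)..T, j (moments g (displaced μ₀ (Zf ε t))))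
      + lam * J₂ (u + ε • h)) 0 := by
    refine Eventually.of_forall fun ε => ?_
    have hε : (u + ε • h).eval 0 = u₀ := by
      rw [u.eval_add_smul h ε ⟨le_rfl, hT.le⟩, hh, smul_zero, add_zero]
      exact hadm.2.2.1
    refine le_trans (le_of_eq ?_) (hmin _ _ ((hZf ε).admissible hT h₁ h₂ hμ₀ hε))
    simp only [zero_smul, add_zero, cost]
    congr 1
    refine intervalIntegral.integral_congr fun t ht => ?_
    rw [uIcc_of_le hT.le] at ht
    simp only [heq t ht]
  have := hloc.hasDerivAt_eq_zero hd
  linarith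

end Optimality

/-! ### The strong form of the optimality condition -/

section StrongForm
variable {d M : ℕ} {T : ℝ}

/-- Integration by parts against an absolutely continuous control vanishing at the initial time. -/
theorem H1Control.integral_inner_eval (hT : 0 ≤ T) {G : ℝ → ControlValue d M} (hG : Continuous G)
    (h : H1Control T d M) (hh : h.eval 0 = 0) :
    ∫ t in (0 : ℝ)..T, ⟪G t, h.eval t⟫ = -∫ s in (0 : ℝ)..T, ⟪∫ r in T..s, G r, h.2 s⟫ := by
  set ν : Measure ℝ := volume.restrict (Ioc 0 T) with hν
  obtain ⟨b, hb⟩ := isCompact_Icc.exists_bound_of_continuousOn (s := Icc 0 T) hG.continuousOn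
  have hi : Integrable h.2 ν := h.integrableOn
  -- Fubini's theorem on the triangle `0 < s ≤ t ≤ T`.
  have h1 : ∀ t ∈ Ioc 0 T, ⟪G t, h.eval t⟫ = ∫ s, ⟪G t, (Iic t).indicator h.2 s⟫ ∂ν := by
    intro t ht
    rw [integral_inner (hi.indicator measurableSet_Iic), hν,
      setIntegral_indicator measurableSet_Iic, Ioc_inter_Iic, min_eq_right ht.2,
      ← intervalIntegral.integral_of_le ht.1.le]
    rw [H1Control.eval_zero] at hh
    rw [H1Control.eval, hh, zero_add]
  have h2 : ∀ s ∈ Ioc 0 T, ∫ t, ⟪G t, (Iic t).indicator h.2 s⟫ ∂ν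
      = -⟪∫ r in T..s, G r, h.2 s⟫ := by
    intro s hs
    have hGi : Integrable G ν := (hG.integrableOn_Icc (a := 0) (b := T)).mono_set Ioc_subset_Icc_self
    have e : ∀ t, ⟪G t, (Iic t).indicator h.2 s⟫ = ⟪h.2 s, (Ici s).indicator G t⟫ := fun t => by
      by_cases hst : s ≤ t
      · rw [indicator_of_mem (show s ∈ Iic t from hst), indicator_of_mem (show t ∈ Ici s from hst),
          real_inner_comm]
      · rw [indicator_of_notMem (show s ∉ Iic t from hst),
          indicator_of_notMem (show t ∉ Ici s from hst), inner_zero_right,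
          inner_zero_right]
    have hset : Ioc 0 T ∩ Ici s = Icc s T := by
      ext t
      simp only [mem_inter_iff, mem_Ioc, mem_Ici, mem_Icc]
      exact ⟨fun h => ⟨h.2, h.1.2⟩, fun h => ⟨⟨hs.1.trans_le h.1, h.2⟩, h.1⟩⟩
    simp only [e]
    rw [integral_inner (hGi.indicator measurableSet_Ici), hν,
      setIntegral_indicator measurableSet_Ici, hset, integral_Icc_eq_integral_Ioc,
      ← intervalIntegral.integral_of_le hs.2, intervalIntegral.integral_symm, inner_neg_right,
      real_inner_comm]
  have hint : Integrable (Function.uncurry fun t s => ⟪G t, (Iic t).indicator h.2 s⟫)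
      (ν.prod ν) := by
    have hm : AEStronglyMeasurable (fun q : ℝ × ℝ => ⟪G q.1, h.2 q.2⟫) (ν.prod ν) :=
      (hG.comp continuous_fst).aestronglyMeasurable.inner hi.aestronglyMeasurable.comp_snd
    have e : (Function.uncurry fun t s => ⟪G t, (Iic t).indicator h.2 s⟫)
        = {q : ℝ × ℝ | q.2 ≤ q.1}.indicator fun q => ⟪G q.1, h.2 q.2⟫ := by
      ext ⟨t, s⟩
      by_cases hst : s ≤ t
      · simp [hst]
      · simp [hst]
    have hbd : ∀ᵐ q ∂(ν.prod ν), ‖G q.1‖ ≤ b := by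
      refine (Measure.quasiMeasurePreserving_fst (μ := ν) (ν := ν)).ae (p := fun t => ‖G t‖ ≤ b) ?_
      filter_upwards [ae_restrict_mem measurableSet_Ioc] with t ht
      exact hb t (Ioc_subset_Icc_self ht)
    rw [e]
    refine ((hi.norm.comp_snd ν).const_mul b).mono' (hm.indicator
      (measurableSet_le measurable_snd measurable_fst)) ?_
    filter_upwards [hbd] with q hq
    refine (norm_indicator_le_norm_self _ _).trans ((norm_inner_le_norm _ _).trans ?_)
    gcongr
  rw [intervalIntegral.integral_of_le hT, intervalIntegral.integral_of_le hT,
    setIntegral_congr_fun measurableSet_Ioc h1, integral_integral_swap hint,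
    setIntegral_congr_fun measurableSet_Ioc h2, integral_neg]

/-- The weak form of `u'' = G`, `u'(T) = 0`, implies its strong form. -/
theorem H1Control.exists_hasDerivWithinAt_of_weak (hT : 0 < T) (u : H1Control T d M)
    {G : ℝ → ControlValue d M} (hG : Continuous G)
    (hu : ∀ h : H1Control T d M, h.eval 0 = 0 →
      (∫ t in (0 : ℝ)..T, ⟪u.2 t, h.2 t⟫) + ∫ t in (0 : ℝ)..T, ⟪G t, h.eval t⟫ = 0) :
    ∃ w : ℝ → ControlValue d M, (∀ t ∈ Icc 0 T, HasDerivWithinAt u.eval (w t) (Icc 0 T) t) ∧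
      (∀ t, HasDerivAt w (G t) t) ∧ w T = 0 := by
  set w : ℝ → ControlValue d M := fun s => ∫ r in T..s, G r with hw
  have hwd : ∀ t, HasDerivAt w (G t) t := fun t =>
    intervalIntegral.integral_hasDerivAt_right (hG.intervalIntegrable _ _)
      (hG.stronglyMeasurableAtFilter _ _) hG.continuousAt
  have hwc : Continuous w := continuous_iff_continuousAt.2 fun t => (hwd t).continuousAt
  obtain ⟨b, hb⟩ := isCompact_Icc.exists_bound_of_continuousOn (s := Icc 0 T) hwc.continuousOn
  have hwm : MemLp w 2 (volume.restrict (Ioc 0 T)) := by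
    refine MemLp.of_bound hwc.aestronglyMeasurable b ?_
    filter_upwards [ae_restrict_mem measurableSet_Ioc] with t ht
    exact hb t (Ioc_subset_Icc_self ht)
  -- The variation with the derivative `u' - w` makes the weak equation read `‖u' - w‖² = 0`.
  set k : Lp (ControlValue d M) 2 (volume.restrict (Ioc 0 T)) := u.2 - hwm.toLp with hk
  have hh : H1Control.eval ((0, k) : H1Control T d M) 0 = 0 := by rw [H1Control.eval_zero]
  have key := hu (0, k) hh
  rw [H1Control.integral_inner_eval hT.le hG _ hh, intervalIntegral.integral_of_le hT.le,
    intervalIntegral.integral_of_le hT.le] at key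
  have e1 : ∫ t in Ioc 0 T, ⟪u.2 t, k t⟫ = ⟪u.2, k⟫ := (L2.inner_def (𝕜 := ℝ) u.2 k).symm
  have e2 : ∫ t in Ioc 0 T, ⟪∫ r in T..t, G r, k t⟫ = ⟪hwm.toLp, k⟫ := by
    rw [L2.inner_def]
    refine integral_congr_ae ?_
    filter_upwards [hwm.coeFn_toLp] with t ht
    rw [ht]
  have hk0 : k = 0 := by
    rw [← inner_self_eq_zero (𝕜 := ℝ)]
    calc ⟪k, k⟫ = ⟪u.2, k⟫ - ⟪hwm.toLp, k⟫ := by rw [← inner_sub_left]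
      _ = 0 := by rw [← e1, ← e2, sub_eq_add_neg]; exact key
  have hae : u.2 =ᵐ[volume.restrict (Ioc 0 T)] w := by
    rw [sub_eq_zero.1 (hk.symm.trans hk0)]
    exact hwm.coeFn_toLp
  have heval : ∀ t ∈ Icc 0 T, u.eval t = u.1 + ∫ s in (0 : ℝ)..t, w s := fun t ht => by
    rw [H1Control.eval, intervalIntegral.integral_of_le ht.1, intervalIntegral.integral_of_le ht.1]
    congr 1
    exact integral_congr_ae (ae_mono (Measure.restrict_mono (Ioc_subset_Ioc_right ht.2) le_rfl) hae)
  refine ⟨w, fun t ht => ?_, hwd, by simp [hw]⟩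
  have : HasDerivAt (fun t => u.1 + ∫ s in (0 : ℝ)..t, w s) (w t) t :=
    (intervalIntegral.integral_hasDerivAt_right (hwc.intervalIntegrable _ _)
      (hwc.stronglyMeasurableAtFilter _ _) hwc.continuousAt).const_add _
  exact this.hasDerivWithinAt.congr heval (heval t ht)

end StrongForm

end MeanFieldControl

theorem theorem3p8 {d M L : ℕ} (T lam : ℝ) (hT : 0 < T) (hlam : 0 < lam)
    (K₁ K₂ : MeanFieldControl.State d → MeanFieldControl.State d)
    (hK₁ : MeanFieldControl.IsCb2 K₁) (hK₂ : MeanFieldControl.IsCb2 K₂)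
    (j : (Fin L → ℝ) → ℝ) (hj : ContDiff ℝ 1 j)
    (g : Fin L → MeanFieldControl.State d → ℝ) (hg : ∀ i, ContDiff ℝ 1 (g i))
    (Cg : ℝ) (hgrowth : ∀ i x, ‖gradient (g i) x‖ ≤ Cg * (1 + ‖x‖))
    (J₂ : MeanFieldControl.H1Control T d M → ℝ)
    (μ₀ : Measure (MeanFieldControl.State d)) (hμ₀ : MeanFieldControl.MemP2 μ₀)
    (u₀ : MeanFieldControl.ControlValue d M)
    (μ : ℝ → Measure (MeanFieldControl.State d)) (u : MeanFieldControl.H1Control T d M)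
    (hopt : MeanFieldControl.IsOptimalPair T lam K₁ K₂ j g J₂ μ₀ u₀ μ u)
    (dJ₂ : MeanFieldControl.H1Control T d M →L[ℝ] ℝ)
    (hdJ₂ : MeanFieldControl.IsGateauxDerivAt J₂ dJ₂ u) :
    -- the state equation with its initial condition, and the initial condition of the control
    MeanFieldControl.IsP2Curve T μ ∧ μ 0 = μ₀ ∧ u.eval 0 = u₀ ∧
    MeanFieldControl.SolvesContinuityEq T K₁ K₂ μ₀ μ u.eval ∧
    ∃ m : ℝ → VectorMeasure (MeanFieldControl.State d) (MeanFieldControl.State d),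
      -- the adjoint equation with its terminal condition
      MeanFieldControl.IsVectorMeasureCurve T m ∧ m T = 0 ∧
      MeanFieldControl.SolvesAdjointEq T K₁ K₂ j g μ u.eval m ∧
      -- the optimality condition, tested with all variations vanishing at the initial time
      (∀ h : MeanFieldControl.H1Control T d M, h.eval 0 = 0 →
        dJ₂ h = (1 / lam) * ∫ t in (0 : ℝ)..T,
          ⟪MeanFieldControl.controlForce K₂ (m t) (u.eval t), h.eval t⟫) ∧
      -- its strong form, with the terminal condition of the control, whenever `dJ₂` is the
      -- derivative of the kinetic energy plus a functional with continuous `L²` gradient `f`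
      (∀ f : ℝ → MeanFieldControl.ControlValue d M, ContinuousOn f (Icc 0 T) →
        (∀ h : MeanFieldControl.H1Control T d M, h.eval 0 = 0 →
          dJ₂ h = (∫ t in (0 : ℝ)..T, ⟪u.2 t, h.2 t⟫) + ∫ t in (0 : ℝ)..T, ⟪f t, h.eval t⟫) →
        ∃ w : ℝ → MeanFieldControl.ControlValue d M,
          (∀ t ∈ Icc 0 T, HasDerivWithinAt u.eval (w t) (Icc 0 T) t) ∧
          (∀ t ∈ Icc 0 T, HasDerivWithinAt w
            (f t - (1 / lam) • MeanFieldControl.controlForce K₂ (m t) (u.eval t))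
            (Icc 0 T) t) ∧
          w T = 0) := by
  open MeanFieldControl in
  have hprob : IsProbabilityMeasure μ₀ := hμ₀.1
  have hadm := hopt.1
  obtain ⟨C₁, h₁⟩ := hK₁.exists_isKernel
  obtain ⟨C₂, h₂⟩ := hK₂.exists_isKernel
  replace h₁ := h₁.mono (le_max_left C₁ C₂)
  replace h₂ := h₂.mono (le_max_right C₁ C₂)
  have hw := u.continuous_extend hT.le
  obtain ⟨Z, hZ⟩ := exists_isDisplacement μ₀ h₁ h₂ hw
  obtain ⟨B, hB, hBc, hBb⟩ := hZ.exists_isLinearization h₁ h₂ hw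
  obtain ⟨γ, hγc, hγ, hJ⟩ := exists_costState hμ₀ hj hg hgrowth
  have hcc : Continuous fun t => γ (Z t) := hγc.comp hZ.continuous
  obtain ⟨p, hpT, hp⟩ := exists_adjointState hBc (b := max C₁ C₂ * (M + 2))
    (fun t => by exact_mod_cast hBb t) hcc T
  have hpc : Continuous p := continuous_iff_continuousAt.2 fun t => (hp t).continuousAt
  have hext : ∀ t ∈ Icc 0 T, u.eval t = u.extend t := fun t ht => (u.extend_of_mem ht).symm
  have hgat : ∀ h : H1Control T d M, h.eval 0 = 0 →
      dJ₂ h = (1 / lam) * ∫ t in (0 : ℝ)..T,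
        ⟪controlForce K₂ (coStateMeasure (Z t) (p t)) (u.eval t), h.eval t⟫ := fun h hh => by
    have e : ∫ t in (0 : ℝ)..T, ⟪controlForce K₂ (coStateMeasure (Z t) (p t)) (u.eval t), h.eval t⟫
        = lam * dJ₂ h := by
      rw [hopt.gateaux_eq hT h₁ h₂ hμ₀ hdJ₂ hZ hB hBc hγc hJ hpT hp h hh]
      refine intervalIntegral.integral_congr fun t ht => ?_
      rw [uIcc_of_le hT.le] at ht
      simp only [hext t ht, h.extend_of_mem ht]
    rw [e, one_div, inv_mul_cancel_left₀ hlam.ne']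
  refine ⟨hadm.1, hadm.2.1, hadm.2.2.1, hadm.2.2.2, fun t => coStateMeasure (Z t) (p t),
    isVectorMeasureCurve_coStateMeasure hZ.continuous hpc, ?_,
    solvesAdjointEq_coStateMeasure hT h₁ h₂ hw hZ hB hBc hcc hp hg (fun t => hγ (Z t))
      (hZ.eq_displaced hT h₁ h₂ hadm) hext, hgat, fun f hf hfd => ?_⟩
  · simp only [hpT, coStateMeasure_zero]
  · have hFc := continuous_controlForce h₂ hZ.continuous hpc hw
    have hFs : Continuous fun t =>
        (1 / lam) • controlForce K₂ (coStateMeasure (Z t) (p t)) (u.extend t) :=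
      hFc.const_smul (1 / lam)
    have hfc : Continuous fun t => f (clamp T t) :=
      hf.comp_continuous continuous_clamp (clamp_mem hT.le)
    obtain ⟨w, hw1, hw2, hw3⟩ := u.exists_hasDerivWithinAt_of_weak hT
      (G := fun t => f (clamp T t)
        - (1 / lam) • controlForce K₂ (coStateMeasure (Z t) (p t)) (u.extend t))
      (hfc.sub hFs) fun h hh => by
        have hhc : Continuous fun t => h.extend t := h.continuous_extend hT.le
        have e : ∫ t in (0 : ℝ)..T, ⟪f (clamp T t)
              - (1 / lam) • controlForce K₂ (coStateMeasure (Z t) (p t)) (u.extend t), h.eval t⟫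
            = (∫ t in (0 : ℝ)..T, ⟪f t, h.eval t⟫) - (1 / lam) * ∫ t in (0 : ℝ)..T,
              ⟪controlForce K₂ (coStateMeasure (Z t) (p t)) (u.eval t), h.eval t⟫ := by
          have e1 : ∫ t in (0 : ℝ)..T, ⟪f t, h.eval t⟫
              = ∫ t in (0 : ℝ)..T, ⟪f (clamp T t), h.extend t⟫ :=
            intervalIntegral.integral_congr fun t ht => by
              rw [uIcc_of_le hT.le] at ht
              simp only [clamp_of_mem ht, h.extend_of_mem ht]
          have e2 : ∫ t in (0 : ℝ)..T,
                ⟪controlForce K₂ (coStateMeasure (Z t) (p t)) (u.eval t), h.eval t⟫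
              = ∫ t in (0 : ℝ)..T,
                ⟪controlForce K₂ (coStateMeasure (Z t) (p t)) (u.extend t), h.extend t⟫ :=
            intervalIntegral.integral_congr fun t ht => by
              rw [uIcc_of_le hT.le] at ht
              simp only [hext t ht, h.extend_of_mem ht]
          rw [e1, e2, ← intervalIntegral.integral_const_mul, ← intervalIntegral.integral_sub
            ((hfc.inner hhc).intervalIntegrable _ _)
            ((continuous_const.mul (hFc.inner hhc)).intervalIntegrable _ _)]
          refine intervalIntegral.integral_congr fun t ht => ?_
          rw [uIcc_of_le hT.le] at ht
          simp only [h.extend_of_mem ht, inner_sub_left, real_inner_smul_left]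
        have h3 := hfd h hh
        rw [hgat h hh] at h3
        rw [e]
        linarith
    refine ⟨w, hw1, fun t ht => ?_, hw3⟩
    have := (hw2 t).hasDerivWithinAt (s := Icc 0 T)
    rwa [clamp_of_mem ht, ← hext t ht] at this
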